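/- Let $\rho,\mu>0$ and $\lambda>0$ be the density and the Lamé parameters of an isotropic elastic material, let $\omega>0$, and put $$C_p=\sqrt{(\lambda+2\mu)/\rho},\qquad C_s=\sqrt{\mu/\rho},$$ so that $C_p^2>2C_s^2$. For $\delta>0$ let $\Omega_1=(-\infty,\delta)\times\mathbb R$ and $\Omega_2=(0,\infty)\times\mathbb R$. Consider the errors $e_j^n$ ($j=1,2$, $n\ge 0$) of the parallel Schwarz method for the time-harmonic Navier equations with (zeroth order) Taylor transmission conditions: for $n\ge 1$, $$\mu\Delta e_j^n+(\lambda+\mu)\nabla(\nabla\cdot e_j^n)+\omega^2\rho\, e_j^n=0\ \text{ in }\Omega_j,$$ $$(\mathcal T_1+\mathcal S)e_1^n=(\mathcal T_1+\mathcal S)e_2^{n-1}\ \text{ at } x=\delta,\qquad (\mathcal T_2+\mathcal S)e_2^n=(\mathcal T_2+\mathcal S)e_1^{n-1}\ \text{ at } x=0,$$ where $\mathcal T_j u=2\mu\,\partial u/\partial n_j+\lambda n_j\,\nabla\cdot u+\mu\, n_j\times(\nabla\times u)$ with $n_1=(1,0)$, $n_2=(-1,0)$, and $\mathcal S=\mathrm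 i\rho\omega\,\mathrm{diag}(C_p,C_s)$. After Fourier transform in $y$, with Fourier variable $k>0$, put $$\lambda_1=\sqrt{k^2-\omega^2/C_s^2},\qquad \lambda_2=\sqrt{k^2-\omega^2/C_p^2}$$ (values in $[0,\infty)\cup\mathrm i(0,\infty)$). For $n\ge1$ the transformed error $\hat e_1^n(\cdot,k)$ is required to be a combination of $e^{\lambda_1x}$ and $e^{\lambda_2x}$, and $\hat e_2^n(\cdot,k)$ a combination of $e^{-\lambda_1x}$ and $e^{-\lambda_2x}$, with coefficients in $\mathbb C^2$ (decay or outgoing radiation condition); the initial errors are arbitrary. Let $\rho_T(k)=\rho_T(k,\omega,C_p,C_s,\delta)$ be the convergence factor per iteration for the mode $k$, that is, the infimum of all $r\ge 0$ such that every error sequence is $O(r^n)$ as $n\to\infty$, pointwise in $x$. The method is said to converge, diverge or stagnate at $k$ if $\rho_T(k)<1$, $\rho_T(k)>1$ or $\rho_T(k)=1$, respectively. **Theorem.** There is $\delta_0=\delta_0(\omega,C_p,C_s)>0$ such that for every $\delta\in(0,\delta_0)$ there is $k^*=k^*(\omega,C_p,C_s,\delta)\in(\omega/C_s,\infty)$ with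 the following properties. For every $k>0$ the iteration for the mode $k$ is well defined (all initial errors determine it uniquely). It converges for $$k\in\left(0,\tfrac{\omega}{C_p}\right)\cup\left(\tfrac{\omega}{C_p},\tfrac{\omega}{C_s}\right)\cup(k^*,\infty),$$ diverges for $k\in(\omega/C_s,k^*)$, and stagnates for $k\in\{\omega/C_p,\ \omega/C_s,\ k^*\}$. -/

import Mathlib

open scoped NNReal ENNReal

noncomputable section

namespace NavierSchwarz

/-- An isotropic elastic material: density `rho`, Lamé parameters `lam` and `mu`. -/
structure Material where
  rho : ℝ
  lam : ℝ
  mu : ℝ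
  rho_pos : 0 < rho
  mu_pos : 0 < mu

/-- Speed of pressure waves. -/
def Material.Cp (m : Material) : ℝ := Real.sqrt ((m.lam + 2 * m.mu) / m.rho)

/-- Speed of shear waves. -/
def Material.Cs (m : Material) : ℝ := Real.sqrt (m.mu / m.rho)

/-- Principal square root of a real number, with values in `ℂ`: it is `√t` for `t ≥ 0` and
`i √(-t)` for `t < 0`. -/
def rootC (t : ℝ) : ℂ :=
  if 0 ≤ t then (Real.sqrt t : ℂ) else Complex.I * (Real.sqrt (-t) : ℂ)

/-- The exponent `λ₁ = √(k² - ω² / Cs²)` of the shear waves. -/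
def lambda1 (m : Material) (ω k : ℝ) : ℂ := rootC (k ^ 2 - ω ^ 2 / m.Cs ^ 2)

/-- The exponent `λ₂ = √(k² - ω² / Cp²)` of the pressure waves. -/
def lambda2 (m : Material) (ω k : ℝ) : ℂ := rootC (k ^ 2 - ω ^ 2 / m.Cp ^ 2)

/-- A Fourier mode of a displacement field: `u 0` and `u 1` are the two components, as functions of
`x`, of `û(x, k)`, the Fourier transform in `y`. Thus `∂/∂y` acts as multiplication by `i k`. -/
abbrev Mode := Fin 2 → ℝ → ℂ

/-- Fourier symbol (in `y`) of the divergence `∂ₓ u₁ + ∂_y u₂`. -/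
def divg (k : ℝ) (u : Mode) (x : ℝ) : ℂ := deriv (u 0) x + Complex.I * k * u 1 x

/-- Fourier symbol (in `y`) of the scalar curl `∂ₓ u₂ - ∂_y u₁`. -/
def curl (k : ℝ) (u : Mode) (x : ℝ) : ℂ := deriv (u 1) x - Complex.I * k * u 0 x

/-- Fourier symbol (in `y`) of the scalar Laplacian `∂ₓ² + ∂_y²`. -/
def lapl (k : ℝ) (f : ℝ → ℂ) (x : ℝ) : ℂ := deriv (deriv f) x - (k : ℂ) ^ 2 * f x

/-- `u` solves on `Ω` the homogeneous Navier equations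
`μ Δu + (λ + μ) ∇(∇·u) + ω² ρ u = 0` for the Fourier variable `k`. -/
def SolvesNavier (m : Material) (ω k : ℝ) (Ω : Set ℝ) (u : Mode) : Prop :=
  ∀ x ∈ Ω,
    m.mu * lapl k (u 0) x + (m.lam + m.mu) * deriv (divg k u) x + ω ^ 2 * m.rho * u 0 x = 0 ∧
    m.mu * lapl k (u 1) x + (m.lam + m.mu) * (Complex.I * k * divg k u x)
      + ω ^ 2 * m.rho * u 1 x = 0

/-- Decay or outgoing radiation condition at `x → -∞`: only the exponentials `exp (λ₁ x)` and
`exp (λ₂ x)` occur. These are decaying if `λⱼ > 0`, constant if `λⱼ = 0`, and outgoing (for the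
time dependence `exp (i ω t)`) if `λⱼ ∈ i ℝ₊`. The mode is given with its analytic extension to all
real `x`. -/
def RadiatesLeft (m : Material) (ω k : ℝ) (u : Mode) : Prop :=
  ∃ a b : Fin 2 → ℂ, ∀ i x,
    u i x = a i * Complex.exp (lambda1 m ω k * x) + b i * Complex.exp (lambda2 m ω k * x)

/-- Decay or outgoing radiation condition at `x → +∞`. -/
def RadiatesRight (m : Material) (ω k : ℝ) (u : Mode) : Prop :=
  ∃ a b : Fin 2 → ℂ, ∀ i x,
    u i x = a i * Complex.exp (-(lambda1 m ω k * x)) + b i * Complex.exp (-(lambda2 m ω k * x))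

/-- The traction `2 μ ∂u/∂n + λ n (∇·u) + μ n × (∇ × u)` in the direction of the normal vector
`(n, 0)`, where `n = 1` or `n = -1`. For a plane field, `∇ × u` is the multiple `curl u` of the
third unit vector, so that `n × (∇ × u) = (0, -n curl u)`. -/
def traction (m : Material) (k n : ℝ) (u : Mode) (x : ℝ) : Fin 2 → ℂ :=
  ![2 * m.mu * (n * deriv (u 0) x) + m.lam * n * divg k u x,
    2 * m.mu * (n * deriv (u 1) x) + m.mu * (-(n * curl k u x))]

/-- The trace `(T + S) u` at `x`, for the normal `(n, 0)` and the Fourier symbol `S`. -/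
def transTrace (m : Material) (k n : ℝ) (S : Matrix (Fin 2) (Fin 2) ℂ) (u : Mode) (x : ℝ) :
    Fin 2 → ℂ :=
  traction m k n u x + S.mulVec (fun i => u i x)

/-- The errors `e₁ⁿ`, `e₂ⁿ` (`n = 0, 1, 2, …`), for the Fourier variable `k`, of the parallel
Schwarz method for the subdomains `Ω₁ = (-∞, δ) × ℝ` and `Ω₂ = (0, ∞) × ℝ` with transmission
operators `T₁ + S₁` at `x = δ` and `T₂ + S₂` at `x = 0`. The initial errors are arbitrary. -/
structure IsSchwarzRun (m : Material) (ω δ k : ℝ) (S₁ S₂ : Matrix (Fin 2) (Fin 2) ℂ)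
    (e₁ e₂ : ℕ → Mode) : Prop where
  init₁ : ∀ i, Differentiable ℝ (e₁ 0 i)
  init₂ : ∀ i, Differentiable ℝ (e₂ 0 i)
  navier₁ : ∀ n, SolvesNavier m ω k (Set.Iio δ) (e₁ (n + 1))
  navier₂ : ∀ n, SolvesNavier m ω k (Set.Ioi 0) (e₂ (n + 1))
  radiates₁ : ∀ n, RadiatesLeft m ω k (e₁ (n + 1))
  radiates₂ : ∀ n, RadiatesRight m ω k (e₂ (n + 1))
  trans₁ : ∀ n, transTrace m k 1 S₁ (e₁ (n + 1)) δ = transTrace m k 1 S₁ (e₂ n) δ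
  trans₂ : ∀ n, transTrace m k (-1) S₂ (e₂ (n + 1)) 0 = transTrace m k (-1) S₂ (e₁ n) 0

/-- Every pair of initial errors determines the Schwarz iteration uniquely. -/
def WellPosed (m : Material) (ω δ k : ℝ) (S₁ S₂ : Matrix (Fin 2) (Fin 2) ℂ) : Prop :=
  ∀ v₁ v₂ : Mode, (∀ i, Differentiable ℝ (v₁ i)) → (∀ i, Differentiable ℝ (v₂ i)) →
    ∃! e : (ℕ → Mode) × (ℕ → Mode),
      IsSchwarzRun m ω δ k S₁ S₂ e.1 e.2 ∧ e.1 0 = v₁ ∧ e.2 0 = v₂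

/-- All errors, for the Fourier variable `k`, are `O(rⁿ)` at every point of the subdomains. -/
def ErrorsBigO (m : Material) (ω δ k : ℝ) (S₁ S₂ : Matrix (Fin 2) (Fin 2) ℂ) (r : ℝ) : Prop :=
  ∀ e₁ e₂ : ℕ → Mode, IsSchwarzRun m ω δ k S₁ S₂ e₁ e₂ → ∀ i,
    (∀ x ∈ Set.Iio δ, (fun n => e₁ n i x) =O[Filter.atTop] (fun n : ℕ => r ^ n)) ∧
    (∀ x ∈ Set.Ioi (0 : ℝ), (fun n => e₂ n i x) =O[Filter.atTop] (fun n : ℕ => r ^ n))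

/-- The convergence factor per iteration of the Schwarz method for the Fourier variable `k`: the
infimum of all `r ≥ 0` such that all errors are `O(rⁿ)`. As the errors live in a finite dimensional
space, this is the spectral radius of the iteration. -/
def convFactor (m : Material) (ω δ k : ℝ) (S₁ S₂ : Matrix (Fin 2) (Fin 2) ℂ) : ℝ≥0∞ :=
  ⨅ (r : ℝ≥0) (_ : ErrorsBigO m ω δ k S₁ S₂ (r : ℝ)), (r : ℝ≥0∞)

/-- The Fourier symbol of the Taylor transmission operators (zeroth order low frequency
approximation of the transparent ones). Since it is diagonal, it is the same for both
subdomains. -/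
def taylorSymbol (m : Material) (ω : ℝ) : Matrix (Fin 2) (Fin 2) ℂ :=
  !![Complex.I * m.rho * ω * m.Cp, 0; 0, Complex.I * m.rho * ω * m.Cs]

/-- The convergence factor of the Schwarz method with Taylor transmission conditions. -/
def rhoTaylor (m : Material) (ω δ k : ℝ) : ℝ≥0∞ :=
  convFactor m ω δ k (taylorSymbol m ω) (taylorSymbol m ω)

/-- The error in the Fourier mode `k` contracts. -/
def Converges (m : Material) (ω δ k : ℝ) : Prop := rhoTaylor m ω δ k < 1

/-- The error in the Fourier mode `k` is amplified. -/
def Diverges (m : Material) (ω δ k : ℝ) : Prop := 1 < rhoTaylor m ω δ k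

/-- The convergence factor for the Fourier mode `k` equals one. -/
def Stagnates (m : Material) (ω δ k : ℝ) : Prop := rhoTaylor m ω δ k = 1

end NavierSchwarz

end

/-!
On each Fourier mode, the errors in both subdomains are superpositions of a pressure and a shear
wave, so the parallel Schwarz method is the iteration of a complex 2 × 2 matrix `M` acting on the
two amplitudes. Its convergence factor is the spectral radius of `M` (`rhoTaylor_eq`), and since
`|det M| < 1` in all cases, the sign of one real number, the Schur–Cohn expression of the
characteristic polynomial of `M`, distinguishes between convergence, stagnation and divergence
(`behaviour_of_schurCohn`). Lengths are measured in units of `Cs / ω`; then the only parameters are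
`r = Cp / Cs > √2`, the overlap `δ` and the Fourier variable `κ`, and the exponents of the waves are
`z₁ = √(κ² - 1)` and `z₂ = √(κ² - 1 / r²)`.

* For `κ < 1 / r` both waves propagate. The overlap only enters through phases, and the Schur–Cohn
  expression is positive whatever the phases are (`schurCohn_pos_of_propagating`).
* For `1 / r ≤ κ ≤ 1` the shear wave propagates and the pressure wave is evanescent. The Schur–Cohn
  expression is a positive multiple of `mixedForm`, which vanishes at both end points. In between it
  is at least of the order `z₁² z₂²`, the terms caused by a small overlap being of higher order
  uniformly up to the end points (`exists_mixedForm_pos`).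
* For `κ > 1` both waves are evanescent. In the variable `v = (z₁ + z₂) / 2` the Schur–Cohn
  expression is a positive multiple of `gain - deficit` (`evanescentForm_eq`). Here `deficit` does
  not depend on the overlap and is positive near `κ = 1`, because of `r² > 2`, and `gain` tends to `0`
  with the overlap for fixed `v`. After division by `κ²`, the deficit is strictly decreasing
  (`deficit_div_strictAnti`) and the gain is increasing as long as `δ v` is below a constant
  (`gain_div_waveSq_le`); beyond, the gain, which is of the order `v⁴`, exceeds the deficit, which
  is of the order `v²` (`deficit_lt_gain`). Hence the two cross exactly once (`exists_crossing`),
  and the crossing is the critical wave number `k*`.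

The monotonicity of the gain comes from writing it as a sum of products of increasing factors. The
exponential growth of the denominators `sinh² (δ v)` and `cosh² (δ v)` is compensated by a factor
`v² + shift`, which the rational factors can spare. The remaining divided differences of `sinh² x`
and `sinh² x / x²` are increasing because the product of the two arguments `x = δ v` and
`x = δ (z₂ - z₁) / 2` is fixed.
-/

noncomputable section

namespace NavierSchwarz

/-! ### The unit disc test for the roots of a quadratic polynomial -/

/-- The Schur–Cohn expression of the quadratic polynomial `x² - T x + Δ`. If `|Δ| < 1`, its sign
tells whether the roots lie in the open unit disc. -/
def schurCohn (T Δ : ℂ) : ℝ :=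
  (1 - Complex.normSq Δ) ^ 2 - Complex.normSq (T - (starRingEnd ℂ) T * Δ)

theorem schurCohn_add_mul (x₁ x₂ : ℂ) :
    schurCohn (x₁ + x₂) (x₁ * x₂) =
      (1 - Complex.normSq x₁) * (1 - Complex.normSq x₂) *
        Complex.normSq (1 - x₁ * (starRingEnd ℂ) x₂) := by
  simp only [schurCohn, Complex.normSq_apply, Complex.add_re, Complex.add_im, Complex.mul_re,
    Complex.mul_im, Complex.sub_re, Complex.sub_im, Complex.conj_re, Complex.conj_im,
    Complex.one_re, Complex.one_im]
  ring

theorem normSq_one_sub_mul_conj_pos {x₁ x₂ : ℂ} (h : ‖x₁ * x₂‖ < 1) :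
    0 < Complex.normSq (1 - x₁ * (starRingEnd ℂ) x₂) := by
  rw [Complex.normSq_pos]
  intro h0
  have h1 : x₁ * (starRingEnd ℂ) x₂ = 1 := (sub_eq_zero.mp h0).symm
  have h2 : ‖x₁ * (starRingEnd ℂ) x₂‖ = 1 := by rw [h1, norm_one]
  rw [norm_mul, RCLike.norm_conj, ← norm_mul] at h2
  linarith

/-- The test is read off the factorization `schurCohn_add_mul`, whose third factor is positive if
`|x₁ x₂| < 1`. -/
theorem schurCohn_sign {x₁ x₂ : ℂ} (h : ‖x₁ * x₂‖ < 1) :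
    (0 < schurCohn (x₁ + x₂) (x₁ * x₂) → max ‖x₁‖ ‖x₂‖ < 1) ∧
    (schurCohn (x₁ + x₂) (x₁ * x₂) = 0 → max ‖x₁‖ ‖x₂‖ = 1) ∧
    (schurCohn (x₁ + x₂) (x₁ * x₂) < 0 → 1 < max ‖x₁‖ ‖x₂‖) := by
  have hc := normSq_one_sub_mul_conj_pos h
  rw [schurCohn_add_mul, Complex.normSq_eq_norm_sq x₁, Complex.normSq_eq_norm_sq x₂]
  rw [norm_mul] at h
  have p₁ := norm_nonneg x₁
  have p₂ := norm_nonneg x₂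
  set c := Complex.normSq (1 - x₁ * (starRingEnd ℂ) x₂)
  set y₁ := ‖x₁‖
  set y₂ := ‖x₂‖
  refine ⟨fun hS => ?_, fun hS => ?_, fun hS => ?_⟩
  · have hS' : 0 < (1 - y₁ ^ 2) * (1 - y₂ ^ 2) := (pos_iff_pos_of_mul_pos hS).mpr hc
    rcases lt_or_ge y₁ 1 with h1 | h1
    · have : 0 < 1 - y₁ ^ 2 := by nlinarith
      have h2 : 0 < 1 - y₂ ^ 2 := (pos_iff_pos_of_mul_pos hS').mp this
      exact max_lt h1 (by nlinarith)
    · have h2 : y₂ < 1 := by nlinarith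
      nlinarith [mul_nonneg (by nlinarith : (0 : ℝ) ≤ y₁ ^ 2 - 1)
        (by nlinarith : (0 : ℝ) ≤ 1 - y₂ ^ 2)]
  · have hS' : (1 - y₁ ^ 2) * (1 - y₂ ^ 2) = 0 := by
      rcases mul_eq_zero.mp hS with h' | h'
      · exact h'
      · exact absurd h' hc.ne'
    rcases mul_eq_zero.mp hS' with h1 | h1
    · have h1 : y₁ = 1 := by nlinarith
      rw [h1] at h ⊢
      exact max_eq_left (by linarith)
    · have h1 : y₂ = 1 := by nlinarith
      rw [h1] at h ⊢
      exact max_eq_right (by linarith)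
  · have hS' : (1 - y₁ ^ 2) * (1 - y₂ ^ 2) < 0 := by
      by_contra h'
      exact absurd hS (not_lt.mpr (mul_nonneg (not_lt.mp h') hc.le))
    by_contra h'
    have h' := not_lt.mp h'
    have h1 := (le_max_left y₁ y₂).trans h'
    have h2 := (le_max_right y₁ y₂).trans h'
    nlinarith [mul_nonneg (by nlinarith : (0 : ℝ) ≤ 1 - y₁ ^ 2)
        (by nlinarith : (0 : ℝ) ≤ 1 - y₂ ^ 2)]

theorem exists_roots (T Δ : ℂ) : ∃ x₁ x₂ : ℂ, x₁ + x₂ = T ∧ x₁ * x₂ = Δ := by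
  obtain ⟨s, hs⟩ := IsAlgClosed.exists_pow_nat_eq (T ^ 2 - 4 * Δ) (n := 2) (by norm_num)
  refine ⟨(T + s) / 2, (T - s) / 2, by ring, ?_⟩
  linear_combination (-1 / 4 : ℂ) * hs

/-! ### Powers of a complex 2 × 2 matrix -/

open Matrix in
theorem mul_self_fin_two (M : Matrix (Fin 2) (Fin 2) ℂ) :
    M * M = M.trace • M - M.det • (1 : Matrix (Fin 2) (Fin 2) ℂ) := by
  ext i j
  fin_cases i <;> fin_cases j <;>
    simp [Matrix.mul_apply, Matrix.trace, Matrix.det_fin_two, Fin.sum_univ_two] <;> ring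

open Matrix in
/-- The powers of `M` grow at most like `rⁿ` for any `r` above the spectral radius, also if `M` has
a double eigenvalue and is not diagonalizable. -/
theorem exists_norm_pow_mulVec_le (M : Matrix (Fin 2) (Fin 2) ℂ) {x₁ x₂ : ℂ}
    (htr : x₁ + x₂ = M.trace) (hdet : x₁ * x₂ = M.det) {r : ℝ} (h₁ : ‖x₁‖ < r) (h₂ : ‖x₂‖ < r)
    (v : Fin 2 → ℂ) : ∃ C : ℝ, ∀ n : ℕ, ‖(M ^ n) *ᵥ v‖ ≤ C * r ^ n := by
  have hr : 0 < r := (norm_nonneg _).trans_lt h₁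
  set w : ℕ → Fin 2 → ℂ := fun n => (M ^ n) *ᵥ v with hw
  -- By Cayley–Hamilton, `w (n + 1) - x₁ w n` is a geometric sequence of ratio `x₂`.
  have hd : ∀ n, w (n + 1) - x₁ • w n = x₂ ^ n • (w 1 - x₁ • w 0) := by
    intro n
    induction n with
    | zero => simp
    | succ n ih =>
      have h2 : w (n + 2) = M.trace • w (n + 1) - M.det • w n := by
        have : M ^ (n + 2) = M.trace • M ^ (n + 1) - M.det • M ^ n := by
          rw [pow_add, sq, mul_self_fin_two, mul_sub, mul_smul_comm, mul_smul_comm, mul_one,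
            ← pow_succ]
        simp only [hw, this, Matrix.sub_mulVec, Matrix.smul_mulVec]
      rw [h2, pow_succ', mul_smul, ← ih, ← htr, ← hdet]
      module
  set d := ‖w 1 - x₁ • w 0‖ with hd0
  refine ⟨max ‖w 0‖ (d / (r - ‖x₁‖)), fun n => ?_⟩
  set C := max ‖w 0‖ (d / (r - ‖x₁‖)) with hC
  have hCd : d ≤ C * (r - ‖x₁‖) := by
    rw [← div_le_iff₀ (by linarith)]
    exact le_max_right _ _
  induction n with
  | zero =>
    rw [pow_zero r, mul_one]
    exact le_max_left ‖w 0‖ (d / (r - ‖x₁‖))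
  | succ n ih =>
    have h1 : w (n + 1) = x₁ • w n + x₂ ^ n • (w 1 - x₁ • w 0) := by
      rw [← hd n]; abel
    have h2 : ‖x₂‖ ^ n ≤ r ^ n := pow_le_pow_left₀ (norm_nonneg _) h₂.le n
    calc ‖w (n + 1)‖ ≤ ‖x₁‖ * ‖w n‖ + ‖x₂‖ ^ n * d := by
          rw [h1]
          refine (norm_add_le _ _).trans ?_
          rw [norm_smul, norm_smul, norm_pow]
      _ ≤ ‖x₁‖ * (C * r ^ n) + r ^ n * (C * (r - ‖x₁‖)) := by
          gcongr
      _ = C * r ^ (n + 1) := by ring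

open Matrix in
theorem exists_eigenvector (M : Matrix (Fin 2) (Fin 2) ℂ) {x₁ x₂ : ℂ}
    (htr : x₁ + x₂ = M.trace) (hdet : x₁ * x₂ = M.det) :
    ∃ v : Fin 2 → ℂ, v ≠ 0 ∧ M *ᵥ v = x₁ • v := by
  have h : (M - x₁ • (1 : Matrix (Fin 2) (Fin 2) ℂ)).det = 0 := by
    rw [Matrix.det_fin_two] at hdet ⊢
    rw [Matrix.trace_fin_two] at htr
    simp
    linear_combination x₁ * htr - hdet
  obtain ⟨v, hv, h⟩ := Matrix.exists_mulVec_eq_zero_iff.mpr h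
  refine ⟨v, hv, ?_⟩
  rw [Matrix.sub_mulVec, Matrix.smul_mulVec, Matrix.one_mulVec] at h
  exact sub_eq_zero.mp h

/-! ### Radiating solutions of the Navier equations -/

theorem Material.mu_eq (m : Material) (h : 0 < m.Cs) : m.mu = m.rho * m.Cs ^ 2 := by
  rw [Material.Cs, Real.sqrt_pos] at h
  rw [Material.Cs, Real.sq_sqrt h.le]
  field_simp [m.rho_pos.ne']

theorem Material.lam_eq (m : Material) (hs : 0 < m.Cs) (hp : 0 < m.Cp) :
    m.lam = m.rho * (m.Cp ^ 2 - 2 * m.Cs ^ 2) := by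
  have h := m.mu_eq hs
  rw [Material.Cp, Real.sqrt_pos] at hp
  have h2 : m.Cp ^ 2 * m.rho = m.lam + 2 * m.mu := by
    rw [Material.Cp, Real.sq_sqrt hp.le]
    field_simp [m.rho_pos.ne']
  linear_combination -2 * h - h2

theorem rootC_sq (t : ℝ) : rootC t ^ 2 = t := by
  unfold rootC
  split_ifs with h
  · rw [← Complex.ofReal_pow, Real.sq_sqrt h]
  · rw [mul_pow, Complex.I_sq, ← Complex.ofReal_pow, Real.sq_sqrt (by linarith)]
    push_cast
    ring

theorem rootC_sq_mul {g : ℝ} (hg : 0 < g) (t : ℝ) : rootC (g ^ 2 * t) = g * rootC t := by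
  have h : 0 ≤ g ^ 2 * t ↔ 0 ≤ t := by
    constructor
    · intro h
      by_contra h'
      nlinarith [mul_pos (pow_pos hg 2) (neg_pos.mpr (not_le.mp h'))]
    · intro h; positivity
  unfold rootC
  simp only [h]
  split_ifs with h'
  · rw [Real.sqrt_mul (by positivity), Real.sqrt_sq hg.le]
    push_cast; ring
  · rw [show -(g ^ 2 * t) = g ^ 2 * (-t) by ring, Real.sqrt_mul (by positivity), Real.sqrt_sq hg.le]
    push_cast; ring

/-- The function `A exp (z₁ x) + B exp (z₂ x)` of a real variable. -/
def biexp (z₁ z₂ A B : ℂ) (x : ℝ) : ℂ := A * Complex.exp (z₁ * x) + B * Complex.exp (z₂ * x)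

theorem hasDerivAt_biexp (z₁ z₂ A B : ℂ) (x : ℝ) :
    HasDerivAt (biexp z₁ z₂ A B) (biexp z₁ z₂ (A * z₁) (B * z₂) x) x := by
  have h : ∀ z : ℂ, HasDerivAt (fun x : ℝ => Complex.exp (z * x)) (Complex.exp (z * x) * z) x := by
    intro z
    have h1 : HasDerivAt (fun x : ℂ => Complex.exp (z * x)) (Complex.exp (z * x) * z) (x : ℂ) := by
      simpa using ((hasDerivAt_id (x : ℂ)).const_mul z).cexp
    exact h1.comp_ofReal
  have := ((h z₁).const_mul A).add ((h z₂).const_mul B)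
  exact this.congr_deriv (by simp only [biexp]; ring)

theorem deriv_biexp (z₁ z₂ A B : ℂ) :
    deriv (biexp z₁ z₂ A B) = biexp z₁ z₂ (A * z₁) (B * z₂) :=
  funext fun x => (hasDerivAt_biexp z₁ z₂ A B x).deriv

theorem biexp_coeff_eq_zero {z₁ z₂ A B : ℂ} (hz : z₁ ≠ z₂) {Ω : Set ℝ} (hΩ : IsOpen Ω)
    (hne : Ω.Nonempty) (h : ∀ x ∈ Ω, biexp z₁ z₂ A B x = 0) : A = 0 ∧ B = 0 := by
  obtain ⟨x, hx⟩ := hne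
  have h0 := h x hx
  have h1 : biexp z₁ z₂ (A * z₁) (B * z₂) x = 0 := by
    rw [← deriv_biexp]
    have : biexp z₁ z₂ A B =ᶠ[nhds x] fun _ => 0 :=
      Filter.eventually_of_mem (hΩ.mem_nhds hx) h
    rw [this.deriv_eq, deriv_const]
  simp only [biexp] at h0 h1
  have e₁ := Complex.exp_ne_zero (z₁ * x)
  have e₂ := Complex.exp_ne_zero (z₂ * x)
  have hz' := sub_ne_zero.mpr hz
  constructor
  · have : A * ((z₁ - z₂) * Complex.exp (z₁ * x)) = 0 := by linear_combination h1 - z₂ * h0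
    simpa [hz', e₁] using this
  · have : B * ((z₁ - z₂) * Complex.exp (z₂ * x)) = 0 := by linear_combination z₁ * h0 - h1
    simpa [hz', e₂] using this

/-- The Navier operator applied to `a exp (Z x)`, with the exponential cancelled. -/
def navierSymbol (m : Material) (ω k : ℝ) (Z : ℂ) (a : Fin 2 → ℂ) : Fin 2 → ℂ :=
  ![m.mu * (Z ^ 2 - k ^ 2) * a 0 + (m.lam + m.mu) * (Z * (Z * a 0 + Complex.I * k * a 1))
      + ω ^ 2 * m.rho * a 0,
    m.mu * (Z ^ 2 - k ^ 2) * a 1 + (m.lam + m.mu) *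
      (Complex.I * k * (Z * a 0 + Complex.I * k * a 1)) + ω ^ 2 * m.rho * a 1]

theorem divg_biexp {k : ℝ} {Z₁ Z₂ : ℂ} {a b : Fin 2 → ℂ} {u : Mode}
    (hu : ∀ i, u i = biexp Z₁ Z₂ (a i) (b i)) :
    divg k u = biexp Z₁ Z₂ (Z₁ * a 0 + Complex.I * k * a 1) (Z₂ * b 0 + Complex.I * k * b 1) := by
  funext x
  simp only [divg, hu, deriv_biexp, biexp]
  ring

theorem solvesNavier_biexp_iff (m : Material) (ω k : ℝ) {Z₁ Z₂ : ℂ} (hZ : Z₁ ≠ Z₂) {Ω : Set ℝ}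
    (hΩ : IsOpen Ω) (hne : Ω.Nonempty) {a b : Fin 2 → ℂ} {u : Mode}
    (hu : ∀ i, u i = biexp Z₁ Z₂ (a i) (b i)) :
    SolvesNavier m ω k Ω u ↔ navierSymbol m ω k Z₁ a = 0 ∧ navierSymbol m ω k Z₂ b = 0 := by
  have key : ∀ x,
      m.mu * lapl k (u 0) x + (m.lam + m.mu) * deriv (divg k u) x + ω ^ 2 * m.rho * u 0 x
        = biexp Z₁ Z₂ (navierSymbol m ω k Z₁ a 0) (navierSymbol m ω k Z₂ b 0) x ∧
      m.mu * lapl k (u 1) x + (m.lam + m.mu) * (Complex.I * k * divg k u x)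
        + ω ^ 2 * m.rho * u 1 x
        = biexp Z₁ Z₂ (navierSymbol m ω k Z₁ a 1) (navierSymbol m ω k Z₂ b 1) x := by
    intro x
    rw [divg_biexp hu]
    simp only [lapl, hu, deriv_biexp]
    simp only [biexp, navierSymbol, Matrix.cons_val_zero, Matrix.cons_val_one]
    constructor <;> ring
  constructor
  · intro h
    have h0 := biexp_coeff_eq_zero hZ hΩ hne fun x hx => (key x).1.symm.trans (h x hx).1
    have h1 := biexp_coeff_eq_zero hZ hΩ hne fun x hx => (key x).2.symm.trans (h x hx).2
    constructor <;> ext i <;> fin_cases i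
    exacts [h0.1, h1.1, h0.2, h1.2]
  · rintro ⟨ha, hb⟩ x -
    rw [(key x).1, (key x).2, ha, hb]
    simp [biexp]

/-- The superposition of a pressure wave (amplitude `c 0`) and a shear wave (amplitude `c 1`), in
the scaling in which lengths are measured in multiples of `1 / g = Cs / ω`: the Fourier variable is
`g κ` and the exponents are `g z₁` (shear) and `g z₂` (pressure). -/
def planeMode (g κ : ℝ) (z₁ z₂ : ℂ) (c : Fin 2 → ℂ) : Mode :=
  ![biexp (g * z₁) (g * z₂) (c 1 * (Complex.I * κ)) (c 0 * z₂),
    biexp (g * z₁) (g * z₂) (-(c 1 * z₁)) (c 0 * (Complex.I * κ))]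

theorem planeMode_apply_zero (g κ : ℝ) (z₁ z₂ : ℂ) (c : Fin 2 → ℂ) (x : ℝ) :
    planeMode g κ z₁ z₂ c 0 x = c 1 * (Complex.I * κ) * Complex.exp (g * z₁ * x) +
      c 0 * z₂ * Complex.exp (g * z₂ * x) := rfl

theorem planeMode_apply_one (g κ : ℝ) (z₁ z₂ : ℂ) (c : Fin 2 → ℂ) (x : ℝ) :
    planeMode g κ z₁ z₂ c 1 x = -(c 1 * z₁) * Complex.exp (g * z₁ * x) +
      c 0 * (Complex.I * κ) * Complex.exp (g * z₂ * x) := rfl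

theorem planeMode_eq_biexp (g κ : ℝ) (z₁ z₂ : ℂ) (c : Fin 2 → ℂ) (i : Fin 2) :
    planeMode g κ z₁ z₂ c i = biexp (g * z₁) (g * z₂) (![c 1 * (Complex.I * κ), -(c 1 * z₁)] i)
      (![c 0 * z₂, c 0 * (Complex.I * κ)] i) := by
  fin_cases i <;> rfl

section scaled

variable {m : Material} {g κ r : ℝ} {z₁ z₂ : ℂ}

theorem exponents_ne (hr : 1 < r) (hg : 0 < g) (h₁ : z₁ ^ 2 = κ ^ 2 - 1)
    (h₂ : z₂ ^ 2 = κ ^ 2 - 1 / r ^ 2) : g * z₁ ≠ g * z₂ := by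
  intro h
  have h' : z₁ = z₂ := mul_left_cancel₀ (by exact_mod_cast hg.ne') h
  rw [h', h₂] at h₁
  have h3 : ((1 / r ^ 2 : ℝ) : ℂ) = ((1 : ℝ) : ℂ) := by push_cast; linear_combination -h₁
  have h4 : 1 / r ^ 2 = 1 := by exact_mod_cast h3
  rw [div_eq_one_iff_eq (by positivity)] at h4
  nlinarith

/-- At the shear exponent, the Navier operator has rank one: it only sees the divergence. -/
theorem navierSymbol_shear (hs : 0 < m.Cs) (hr : 1 < r) (hp : m.Cp = r * m.Cs)
    (h₁ : z₁ ^ 2 = κ ^ 2 - 1) (a : Fin 2 → ℂ) :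
    navierSymbol m (g * m.Cs) (g * κ : ℝ) (g * z₁) a =
      (m.rho * m.Cs ^ 2 * g ^ 2 * (r ^ 2 - 1) * (z₁ * a 0 + Complex.I * κ * a 1) : ℂ) •
        ![z₁, Complex.I * κ] := by
  have hmu := m.mu_eq hs
  have hlam := m.lam_eq hs (by rw [hp]; positivity)
  ext i
  fin_cases i
  · simp [navierSymbol, hmu, hlam, hp]
    linear_combination (m.rho * m.Cs ^ 2 * g ^ 2 * a 0 : ℂ) * h₁
  · simp [navierSymbol, hmu, hlam, hp]
    linear_combination (m.rho * m.Cs ^ 2 * g ^ 2 * a 1 : ℂ) * h₁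

/-- At the pressure exponent, the kernel of the Navier operator is spanned by the gradient
`(z₂, i κ)`. -/
theorem navierSymbol_pressure (hs : 0 < m.Cs) (hr : 1 < r) (hp : m.Cp = r * m.Cs)
    (h₂ : z₂ ^ 2 = κ ^ 2 - 1 / r ^ 2) (b : Fin 2 → ℂ) :
    navierSymbol m (g * m.Cs) (g * κ : ℝ) (g * z₂) b =
      (m.rho * m.Cs ^ 2 * g ^ 2 * (r ^ 2 - 1) : ℂ) •
        ((1 / r ^ 2 : ℂ) • b + (z₂ * b 0 + Complex.I * κ * b 1) • ![z₂, Complex.I * κ]) := by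
  have hmu := m.mu_eq hs
  have hlam := m.lam_eq hs (by rw [hp]; positivity)
  have hr0 : (r : ℂ) ≠ 0 := by exact_mod_cast (by linarith : r ≠ 0)
  have hr1 : (r : ℂ) ^ 2 * (1 / r ^ 2) = 1 := by field_simp
  ext i
  fin_cases i
  · simp [navierSymbol, hmu, hlam, hp, Matrix.vecHead, Matrix.vecTail]
    rw [one_div] at h₂ hr1
    linear_combination (m.rho * m.Cs ^ 2 * g ^ 2 * b 0 : ℂ) * h₂ -
      (m.rho * m.Cs ^ 2 * g ^ 2 * b 0 : ℂ) * hr1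
  · simp [navierSymbol, hmu, hlam, hp, Matrix.vecHead, Matrix.vecTail]
    rw [one_div] at h₂ hr1
    linear_combination (m.rho * m.Cs ^ 2 * g ^ 2 * b 1 : ℂ) * h₂ -
      (m.rho * m.Cs ^ 2 * g ^ 2 * b 1 : ℂ) * hr1

theorem solvesNavier_planeMode (hs : 0 < m.Cs) (hr : 1 < r) (hp : m.Cp = r * m.Cs) (hg : 0 < g)
    (h₁ : z₁ ^ 2 = κ ^ 2 - 1) (h₂ : z₂ ^ 2 = κ ^ 2 - 1 / r ^ 2) {Ω : Set ℝ} (hΩ : IsOpen Ω)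
    (hne : Ω.Nonempty) (c : Fin 2 → ℂ) :
    SolvesNavier m (g * m.Cs) (g * κ) Ω (planeMode g κ z₁ z₂ c) := by
  rw [solvesNavier_biexp_iff m _ _ (exponents_ne hr hg h₁ h₂) hΩ hne
      (planeMode_eq_biexp g κ z₁ z₂ c),
    navierSymbol_shear hs hr hp h₁, navierSymbol_pressure hs hr hp h₂]
  constructor
  · convert zero_smul ℂ _
    simp
    right
    ring
  · rw [smul_eq_zero]
    right
    have hI := Complex.I_sq
    ext i
    fin_cases i
    · simp
      linear_combination c 0 * z₂ * h₂ + c 0 * z₂ * κ ^ 2 * hI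
    · simp
      linear_combination c 0 * (Complex.I * κ) * h₂ + c 0 * (Complex.I * κ) * κ ^ 2 * hI

/-- Conversely, every solution of the Navier equations built from the two exponentials is a
superposition of a pressure and a shear wave. Here `κ ≠ 0` is needed to recover the amplitudes if an
exponent vanishes. -/
theorem exists_eq_planeMode (hs : 0 < m.Cs) (hr : 1 < r) (hp : m.Cp = r * m.Cs) (hg : 0 < g)
    (hκ : 0 < κ) (h₁ : z₁ ^ 2 = κ ^ 2 - 1) (h₂ : z₂ ^ 2 = κ ^ 2 - 1 / r ^ 2) {Ω : Set ℝ}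
    (hΩ : IsOpen Ω) (hne : Ω.Nonempty) {a b : Fin 2 → ℂ} {u : Mode}
    (hu : ∀ i, u i = biexp (g * z₁) (g * z₂) (a i) (b i))
    (h : SolvesNavier m (g * m.Cs) (g * κ) Ω u) : ∃ c, u = planeMode g κ z₁ z₂ c := by
  rw [solvesNavier_biexp_iff m _ _ (exponents_ne hr hg h₁ h₂) hΩ hne hu,
    navierSymbol_shear hs hr hp h₁, navierSymbol_pressure hs hr hp h₂] at h
  have hκ' : (κ : ℂ) ≠ 0 := by exact_mod_cast hκ.ne'
  have hr0 : (r : ℂ) ≠ 0 := by exact_mod_cast (by linarith : r ≠ 0)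
  have hrr : (r : ℂ) ^ 2 - 1 ≠ 0 := by
    have : r ^ 2 - 1 ≠ 0 := by nlinarith
    exact_mod_cast this
  have hrho : (m.rho : ℂ) ≠ 0 := by exact_mod_cast m.rho_pos.ne'
  have hCs : (m.Cs : ℂ) ≠ 0 := by exact_mod_cast hs.ne'
  have hg' : (g : ℂ) ≠ 0 := by exact_mod_cast hg.ne'
  obtain ⟨ha, hb⟩ := h
  have ha' : z₁ * a 0 + Complex.I * κ * a 1 = 0 := by
    have := congrFun ha 1
    simpa [hκ', hrr, hrho, hCs, hg'] using this
  rw [smul_eq_zero] at hb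
  replace hb := hb.resolve_left (by simp [hrr, hrho, hCs, hg'])
  have hb0 := congrFun hb 0
  have hb1 := congrFun hb 1
  simp at hb0 hb1
  have hb' : Complex.I * κ * b 0 = z₂ * b 1 := by
    have : (r ^ 2 : ℂ)⁻¹ * (Complex.I * κ * b 0 - z₂ * b 1) = 0 := by
      linear_combination Complex.I * κ * hb0 - z₂ * hb1
    rw [mul_eq_zero] at this
    exact sub_eq_zero.mp (this.resolve_left (by simp [hr0]))
  have hIκ : Complex.I * κ ≠ 0 := mul_ne_zero Complex.I_ne_zero hκ'
  refine ⟨![b 1 / (Complex.I * κ), a 0 / (Complex.I * κ)], ?_⟩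
  funext i
  rw [hu, planeMode_eq_biexp]
  fin_cases i
  · simp only [Fin.zero_eta, Matrix.cons_val_zero, Matrix.cons_val_one]
    congr 1
    · field_simp
    · rw [div_mul_eq_mul_div, eq_div_iff hIκ]
      linear_combination hb'
  · simp only [Fin.mk_one, Matrix.cons_val_zero, Matrix.cons_val_one]
    congr 1
    · rw [div_mul_eq_mul_div, ← neg_div, eq_div_iff hIκ]
      linear_combination ha'
    · field_simp

/-- The matrix of the trace `(T + S) u`, for the normal `(n, 0)`, on superpositions of a pressure
and a shear wave, up to the factor `ρ ω Cs`. -/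
def traceMatrix (κ r n : ℝ) (z₁ z₂ : ℂ) : Matrix (Fin 2) (Fin 2) ℂ :=
  !![n * (2 * κ ^ 2 - 1) + Complex.I * r * z₂, Complex.I * κ * (2 * n * z₁ + Complex.I * r);
    Complex.I * κ * (2 * n * z₂ + Complex.I), -(n * (2 * κ ^ 2 - 1) + Complex.I * z₁)]

open Matrix in
theorem transTrace_planeMode (hs : 0 < m.Cs) (hr : 1 < r) (hp : m.Cp = r * m.Cs)
    (h₁ : z₁ ^ 2 = κ ^ 2 - 1) (h₂ : z₂ ^ 2 = κ ^ 2 - 1 / r ^ 2) (n : ℝ) (c : Fin 2 → ℂ) (x : ℝ) :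
    transTrace m (g * κ) n (taylorSymbol m (g * m.Cs)) (planeMode g κ z₁ z₂ c) x =
      (m.rho * m.Cs ^ 2 * g : ℂ) • (traceMatrix κ r n z₁ z₂ *ᵥ
        ![c 0 * Complex.exp (g * z₂ * x), c 1 * Complex.exp (g * z₁ * x)]) := by
  have hmu := m.mu_eq hs
  have hlam := m.lam_eq hs (by rw [hp]; positivity)
  have hr0 : (r : ℂ) ≠ 0 := by exact_mod_cast (by linarith : r ≠ 0)
  have hr1 : (r : ℂ) ^ 2 * (1 / r ^ 2) = 1 := by field_simp
  have hI := Complex.I_sq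
  have hd : ∀ i, deriv (planeMode g κ z₁ z₂ c i) = biexp (g * z₁) (g * z₂) _ _ := fun i => by
    rw [planeMode_eq_biexp, deriv_biexp]
  ext i
  fin_cases i
  · simp [transTrace, traction, divg, hd, taylorSymbol, traceMatrix, hmu, hlam, hp,
      dotProduct, Fin.sum_univ_two, planeMode_apply_zero, planeMode_apply_one, biexp]
    linear_combination (m.rho * m.Cs ^ 2 * g * n * c 0 * Complex.exp (g * z₂ * x) : ℂ) *
      (r ^ 2 * h₂ - hr1 + (r ^ 2 - 2) * κ ^ 2 * hI)
  · simp [transTrace, traction, curl, hd, taylorSymbol, traceMatrix, hmu, hlam, hp,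
      dotProduct, Fin.sum_univ_two, planeMode_apply_zero, planeMode_apply_one, biexp]
    linear_combination (m.rho * m.Cs ^ 2 * g * n * c 1 * Complex.exp (g * z₁ * x) : ℂ) *
      (κ ^ 2 * hI - h₁)

/-- The polarizations of the two waves are linearly independent if `κ² ≠ z₁ z₂`, so that a nonzero
wave vanishes nowhere. -/
theorem planeMode_apply_ne_zero (h : (κ : ℂ) ^ 2 - z₁ * z₂ ≠ 0) {c : Fin 2 → ℂ}
    (hc : c ≠ 0) (x : ℝ) : ∃ i, planeMode g κ z₁ z₂ c i x ≠ 0 := by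
  by_contra! h0
  have hI := Complex.I_sq
  have e0 := h0 0
  have e1 := h0 1
  rw [planeMode_apply_zero] at e0
  rw [planeMode_apply_one] at e1
  have e₁ := Complex.exp_ne_zero (g * z₁ * x)
  have e₂ := Complex.exp_ne_zero (g * z₂ * x)
  apply hc
  ext i
  fin_cases i
  · have : c 0 * Complex.exp (g * z₂ * x) * (κ ^ 2 - z₁ * z₂) = 0 := by
      linear_combination -z₁ * e0 - Complex.I * κ * e1 +
        c 0 * Complex.exp (g * z₂ * x) * κ ^ 2 * hI
    simpa [e₂, h] using this
  · have : c 1 * Complex.exp (g * z₁ * x) * (κ ^ 2 - z₁ * z₂) = 0 := by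
      linear_combination z₂ * e1 - Complex.I * κ * e0 +
        c 1 * Complex.exp (g * z₁ * x) * κ ^ 2 * hI
    simpa [e₁, h] using this

end scaled

/-! ### The Schwarz iteration as a matrix iteration -/

/-- The scaling used throughout: `r = Cp / Cs`, `g = ω / Cs`, `κ = k / g`, and `g z₁`, `g z₂` are
the exponents of the shear and of the pressure waves. -/
structure IsScaling (m : Material) (ω k g κ r : ℝ) (z₁ z₂ : ℂ) : Prop where
  Cs_pos : 0 < m.Cs
  one_lt : 1 < r
  Cp_eq : m.Cp = r * m.Cs
  g_pos : 0 < g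
  κ_pos : 0 < κ
  ω_eq : ω = g * m.Cs
  k_eq : k = g * κ
  sq₁ : z₁ ^ 2 = κ ^ 2 - 1
  sq₂ : z₂ ^ 2 = κ ^ 2 - 1 / r ^ 2
  lambda₁ : lambda1 m ω k = g * z₁
  lambda₂ : lambda2 m ω k = g * z₂

theorem isScaling_rootC {m : Material} {ω k r : ℝ} (hs : 0 < m.Cs) (hr : 1 < r)
    (hp : m.Cp = r * m.Cs) (hω : 0 < ω) (hk : 0 < k) :
    IsScaling m ω k (ω / m.Cs) (k / (ω / m.Cs)) r (rootC ((k / (ω / m.Cs)) ^ 2 - 1))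
      (rootC ((k / (ω / m.Cs)) ^ 2 - 1 / r ^ 2)) where
  Cs_pos := hs
  one_lt := hr
  Cp_eq := hp
  g_pos := by positivity
  κ_pos := by positivity
  ω_eq := by field_simp
  k_eq := by field_simp
  sq₁ := by rw [rootC_sq]; push_cast; ring
  sq₂ := by rw [rootC_sq]; push_cast; ring
  lambda₁ := by
    rw [lambda1, ← rootC_sq_mul (by positivity)]
    congr 1
    field_simp
  lambda₂ := by
    rw [lambda2, ← rootC_sq_mul (by positivity), hp]
    congr 1
    field_simp

/-- The solution in the left subdomain whose pressure and shear amplitudes at `x = δ` are `f 0` and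
`f 1`. -/
def leftMode (g κ δ : ℝ) (z₁ z₂ : ℂ) (f : Fin 2 → ℂ) : Mode :=
  planeMode g κ z₁ z₂ ![f 0 * Complex.exp (-(g * z₂ * δ)), f 1 * Complex.exp (-(g * z₁ * δ))]

/-- The solution in the right subdomain whose pressure and shear amplitudes at `x = 0` are `d 0` and
`-d 1`; the sign makes it the mirror image of a left solution. -/
def rightMode (g κ : ℝ) (z₁ z₂ : ℂ) (d : Fin 2 → ℂ) : Mode :=
  planeMode g κ (-z₁) (-z₂) ![d 0, -d 1]

/-- `M` maps the amplitudes of one half step to those of the next one: the transmission matrix times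
`M f` is the trace of the wave with amplitudes `f` that comes from the other subdomain and has
travelled the distance `δ`. -/
def IsIterationMatrix (g κ r δ : ℝ) (z₁ z₂ : ℂ) (M : Matrix (Fin 2) (Fin 2) ℂ) : Prop :=
  traceMatrix κ r 1 z₁ z₂ * M = traceMatrix κ r 1 (-z₁) (-z₂) *
    Matrix.diagonal ![Complex.exp (-(g * z₂ * δ)), -Complex.exp (-(g * z₁ * δ))]

theorem exists_leftMode_apply (g κ δ : ℝ) (z₁ z₂ : ℂ) (i : Fin 2) (x : ℝ) :
    ∃ α β : ℂ, ∀ f, leftMode g κ δ z₁ z₂ f i x = f 0 * α + f 1 * β := by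
  fin_cases i
  · refine ⟨Complex.exp (-(g * z₂ * δ)) * z₂ * Complex.exp (g * z₂ * x),
      Complex.exp (-(g * z₁ * δ)) * (Complex.I * κ) * Complex.exp (g * z₁ * x), fun f => ?_⟩
    simp [leftMode, planeMode_apply_zero]
    ring
  · refine ⟨Complex.exp (-(g * z₂ * δ)) * (Complex.I * κ) * Complex.exp (g * z₂ * x),
      -(Complex.exp (-(g * z₁ * δ)) * z₁ * Complex.exp (g * z₁ * x)), fun f => ?_⟩
    simp [leftMode, planeMode_apply_one]
    ring

theorem exists_rightMode_apply (g κ : ℝ) (z₁ z₂ : ℂ) (i : Fin 2) (x : ℝ) :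
    ∃ α β : ℂ, ∀ d, rightMode g κ z₁ z₂ d i x = d 0 * α + d 1 * β := by
  fin_cases i
  · refine ⟨-z₂ * Complex.exp (-(g * z₂ * x)),
      -(Complex.I * κ) * Complex.exp (-(g * z₁ * x)), fun f => ?_⟩
    simp [rightMode, planeMode_apply_zero]
    ring
  · refine ⟨(Complex.I * κ) * Complex.exp (-(g * z₂ * x)),
      -(z₁ * Complex.exp (-(g * z₁ * x))), fun f => ?_⟩
    simp [rightMode, planeMode_apply_one]
    ring

theorem differentiable_planeMode (g κ : ℝ) (z₁ z₂ : ℂ) (c : Fin 2 → ℂ) (i : Fin 2) :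
    Differentiable ℝ (planeMode g κ z₁ z₂ c i) := by
  rw [planeMode_eq_biexp]
  exact fun x => (hasDerivAt_biexp _ _ _ _ x).differentiableAt

theorem exists_planeMode_apply (g κ : ℝ) (z₁ z₂ : ℂ) (c : Fin 2 → ℂ) :
    ∃ a b : Fin 2 → ℂ, ∀ i (x : ℝ), planeMode g κ z₁ z₂ c i x =
      a i * Complex.exp (g * z₁ * x) + b i * Complex.exp (g * z₂ * x) :=
  ⟨![c 1 * (Complex.I * κ), -(c 1 * z₁)], ![c 0 * z₂, c 0 * (Complex.I * κ)], fun i x => by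
    rw [planeMode_eq_biexp, biexp]⟩

section traces

open Matrix

variable {m : Material} {ω k g κ r δ : ℝ} {z₁ z₂ : ℂ} {M : Matrix (Fin 2) (Fin 2) ℂ}

theorem transTrace_left_self (h : IsScaling m ω k g κ r z₁ z₂) (f : Fin 2 → ℂ) :
    transTrace m k 1 (taylorSymbol m ω) (leftMode g κ δ z₁ z₂ f) δ =
      (m.rho * m.Cs ^ 2 * g : ℂ) • (traceMatrix κ r 1 z₁ z₂ *ᵥ f) := by
  rw [h.k_eq, h.ω_eq, leftMode, transTrace_planeMode h.Cs_pos h.one_lt h.Cp_eq h.sq₁ h.sq₂]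
  congr 2
  ext i
  fin_cases i <;> simp [mul_assoc, ← Complex.exp_add]

theorem transTrace_right_other (h : IsScaling m ω k g κ r z₁ z₂)
    (hM : IsIterationMatrix g κ r δ z₁ z₂ M) (d : Fin 2 → ℂ) :
    transTrace m k 1 (taylorSymbol m ω) (rightMode g κ z₁ z₂ d) δ =
      (m.rho * m.Cs ^ 2 * g : ℂ) • (traceMatrix κ r 1 z₁ z₂ *ᵥ (M *ᵥ d)) := by
  rw [Matrix.mulVec_mulVec, hM, ← Matrix.mulVec_mulVec, h.k_eq, h.ω_eq, rightMode,
    transTrace_planeMode h.Cs_pos h.one_lt h.Cp_eq (by rw [neg_sq, h.sq₁]) (by rw [neg_sq, h.sq₂])]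
  congr 2
  ext i
  fin_cases i <;> simp [Matrix.mulVec_diagonal, mul_comm]

theorem transTrace_right_self (h : IsScaling m ω k g κ r z₁ z₂) (d : Fin 2 → ℂ) :
    transTrace m k (-1) (taylorSymbol m ω) (rightMode g κ z₁ z₂ d) 0 =
      (m.rho * m.Cs ^ 2 * g : ℂ) •
        (Matrix.diagonal ![-1, 1] *ᵥ (traceMatrix κ r 1 z₁ z₂ *ᵥ d)) := by
  rw [h.k_eq, h.ω_eq, rightMode, transTrace_planeMode h.Cs_pos h.one_lt h.Cp_eq
    (by rw [neg_sq, h.sq₁]) (by rw [neg_sq, h.sq₂])]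
  congr 1
  ext i
  fin_cases i
  · simp [traceMatrix, Matrix.mulVec_diagonal, vecHead, vecTail]; ring
  · simp [traceMatrix, Matrix.mulVec_diagonal, vecHead, vecTail]; ring

theorem transTrace_left_other (h : IsScaling m ω k g κ r z₁ z₂)
    (hM : IsIterationMatrix g κ r δ z₁ z₂ M) (f : Fin 2 → ℂ) :
    transTrace m k (-1) (taylorSymbol m ω) (leftMode g κ δ z₁ z₂ f) 0 =
      (m.rho * m.Cs ^ 2 * g : ℂ) •
        (Matrix.diagonal ![-1, 1] *ᵥ (traceMatrix κ r 1 z₁ z₂ *ᵥ (M *ᵥ f))) := by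
  rw [Matrix.mulVec_mulVec f (traceMatrix κ r 1 z₁ z₂), hM, ← Matrix.mulVec_mulVec,
    h.k_eq, h.ω_eq, leftMode,
    transTrace_planeMode h.Cs_pos h.one_lt h.Cp_eq h.sq₁ h.sq₂]
  congr 1
  ext i
  fin_cases i
  · simp [traceMatrix, Matrix.mulVec_diagonal, vecHead, vecTail]; ring
  · simp [traceMatrix, Matrix.mulVec_diagonal, vecHead, vecTail]; ring

theorem scale_ne_zero (h : IsScaling m ω k g κ r z₁ z₂) : (m.rho * m.Cs ^ 2 * g : ℂ) ≠ 0 := by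
  have h1 := m.rho_pos
  have h2 := h.Cs_pos
  have h3 := h.g_pos
  have : m.rho * m.Cs ^ 2 * g ≠ 0 := by positivity
  exact_mod_cast this

theorem diagonal_mulVec_inj {v w : Fin 2 → ℂ}
    (h : Matrix.diagonal ![-1, 1] *ᵥ v = Matrix.diagonal ![-1, 1] *ᵥ w) : v = w := by
  have h0 := congrFun h 0
  have h1 := congrFun h 1
  simp [Matrix.mulVec_diagonal] at h0 h1
  ext i
  fin_cases i <;> assumption

theorem mulVec_inj_of_det {A : Matrix (Fin 2) (Fin 2) ℂ} (hA : A.det ≠ 0) {v w : Fin 2 → ℂ}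
    (h : A *ᵥ v = A *ᵥ w) : v = w :=
  Matrix.mulVec_injective_of_isUnit ((Matrix.isUnit_iff_isUnit_det A).mpr hA.isUnit) h

theorem exists_eq_leftMode (h : IsScaling m ω k g κ r z₁ z₂) {u : Mode}
    (hu : SolvesNavier m ω k (Set.Iio δ) u) (hr : RadiatesLeft m ω k u) :
    ∃ f, u = leftMode g κ δ z₁ z₂ f := by
  obtain ⟨a, b, hab⟩ := hr
  rw [h.k_eq, h.ω_eq] at hu
  have hu' : ∀ i, u i = biexp (g * z₁) (g * z₂) (a i) (b i) := fun i => by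
    funext x
    rw [hab, h.lambda₁, h.lambda₂, biexp]
  obtain ⟨c, rfl⟩ := exists_eq_planeMode h.Cs_pos h.one_lt h.Cp_eq h.g_pos h.κ_pos h.sq₁ h.sq₂
    isOpen_Iio ⟨δ - 1, by simp⟩ hu' hu
  refine ⟨![c 0 * Complex.exp (g * z₂ * δ), c 1 * Complex.exp (g * z₁ * δ)], ?_⟩
  rw [leftMode]
  congr 1
  ext i
  fin_cases i <;> simp [mul_assoc, ← Complex.exp_add]

theorem exists_eq_rightMode (h : IsScaling m ω k g κ r z₁ z₂) {u : Mode}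
    (hu : SolvesNavier m ω k (Set.Ioi 0) u) (hr : RadiatesRight m ω k u) :
    ∃ d, u = rightMode g κ z₁ z₂ d := by
  obtain ⟨a, b, hab⟩ := hr
  rw [h.k_eq, h.ω_eq] at hu
  have hu' : ∀ i, u i = biexp (g * -z₁) (g * -z₂) (a i) (b i) := fun i => by
    funext x
    rw [hab, h.lambda₁, h.lambda₂, biexp]
    simp
  obtain ⟨c, rfl⟩ := exists_eq_planeMode h.Cs_pos h.one_lt h.Cp_eq h.g_pos h.κ_pos
    (by rw [neg_sq, h.sq₁]) (by rw [neg_sq, h.sq₂]) isOpen_Ioi ⟨1, by simp⟩ hu' hu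
  refine ⟨![c 0, -c 1], ?_⟩
  rw [rightMode]
  congr 1
  ext i
  fin_cases i <;> simp

theorem solvesNavier_leftMode (h : IsScaling m ω k g κ r z₁ z₂) (f : Fin 2 → ℂ) :
    SolvesNavier m ω k (Set.Iio δ) (leftMode g κ δ z₁ z₂ f) := by
  rw [h.k_eq, h.ω_eq]
  exact solvesNavier_planeMode h.Cs_pos h.one_lt h.Cp_eq h.g_pos h.sq₁ h.sq₂ isOpen_Iio
    ⟨δ - 1, by simp⟩ _

theorem solvesNavier_rightMode (h : IsScaling m ω k g κ r z₁ z₂) (d : Fin 2 → ℂ) :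
    SolvesNavier m ω k (Set.Ioi 0) (rightMode g κ z₁ z₂ d) := by
  rw [h.k_eq, h.ω_eq]
  exact solvesNavier_planeMode h.Cs_pos h.one_lt h.Cp_eq h.g_pos (by rw [neg_sq, h.sq₁])
    (by rw [neg_sq, h.sq₂]) isOpen_Ioi ⟨1, by simp⟩ _

theorem radiatesLeft_leftMode (h : IsScaling m ω k g κ r z₁ z₂) (f : Fin 2 → ℂ) :
    RadiatesLeft m ω k (leftMode g κ δ z₁ z₂ f) := by
  obtain ⟨a, b, hab⟩ := exists_planeMode_apply g κ z₁ z₂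
    ![f 0 * Complex.exp (-(g * z₂ * δ)), f 1 * Complex.exp (-(g * z₁ * δ))]
  refine ⟨a, b, fun i x => ?_⟩
  rw [leftMode, hab, h.lambda₁, h.lambda₂]

theorem radiatesRight_rightMode (h : IsScaling m ω k g κ r z₁ z₂) (d : Fin 2 → ℂ) :
    RadiatesRight m ω k (rightMode g κ z₁ z₂ d) := by
  obtain ⟨a, b, hab⟩ := exists_planeMode_apply g κ (-z₁) (-z₂) ![d 0, -d 1]
  refine ⟨a, b, fun i x => ?_⟩
  rw [rightMode, hab, h.lambda₁, h.lambda₂, mul_neg, mul_neg, neg_mul, neg_mul]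

theorem existsUnique_left (h : IsScaling m ω k g κ r z₁ z₂)
    (hA : (traceMatrix κ r 1 z₁ z₂).det ≠ 0) (w : Fin 2 → ℂ) :
    ∃! u, SolvesNavier m ω k (Set.Iio δ) u ∧ RadiatesLeft m ω k u ∧
      transTrace m k 1 (taylorSymbol m ω) u δ = w := by
  have hc := scale_ne_zero h
  obtain ⟨f, hf⟩ := Matrix.mulVec_surjective_iff_isUnit.mpr
    ((Matrix.isUnit_iff_isUnit_det _).mpr hA.isUnit) ((m.rho * m.Cs ^ 2 * g : ℂ)⁻¹ • w)
  refine ⟨leftMode g κ δ z₁ z₂ f, ⟨solvesNavier_leftMode h f, radiatesLeft_leftMode h f, ?_⟩, ?_⟩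
  · rw [transTrace_left_self h, hf, smul_smul, mul_inv_cancel₀ hc, one_smul]
  · rintro u ⟨h1, h2, h3⟩
    obtain ⟨f', rfl⟩ := exists_eq_leftMode h h1 h2
    rw [transTrace_left_self h] at h3
    rw [← h3, smul_smul, inv_mul_cancel₀ hc, one_smul] at hf
    rw [mulVec_inj_of_det hA hf]

theorem existsUnique_right (h : IsScaling m ω k g κ r z₁ z₂)
    (hA : (traceMatrix κ r 1 z₁ z₂).det ≠ 0) (w : Fin 2 → ℂ) :
    ∃! u, SolvesNavier m ω k (Set.Ioi 0) u ∧ RadiatesRight m ω k u ∧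
      transTrace m k (-1) (taylorSymbol m ω) u 0 = w := by
  have hc := scale_ne_zero h
  obtain ⟨d, hd⟩ := Matrix.mulVec_surjective_iff_isUnit.mpr
    ((Matrix.isUnit_iff_isUnit_det _).mpr hA.isUnit)
    (Matrix.diagonal ![-1, 1] *ᵥ ((m.rho * m.Cs ^ 2 * g : ℂ)⁻¹ • w))
  have hJ : ∀ v : Fin 2 → ℂ,
      Matrix.diagonal ![(-1 : ℂ), 1] *ᵥ (Matrix.diagonal ![-1, 1] *ᵥ v) = v := by
    intro v
    ext i
    fin_cases i <;> simp [Matrix.mulVec_diagonal]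
  refine ⟨rightMode g κ z₁ z₂ d, ⟨solvesNavier_rightMode h d, radiatesRight_rightMode h d, ?_⟩, ?_⟩
  · rw [transTrace_right_self h, hd, hJ, smul_smul, mul_inv_cancel₀ hc, one_smul]
  · rintro u ⟨h1, h2, h3⟩
    obtain ⟨d', rfl⟩ := exists_eq_rightMode h h1 h2
    rw [transTrace_right_self h] at h3
    rw [← h3, smul_smul, inv_mul_cancel₀ hc, one_smul, hJ] at hd
    rw [mulVec_inj_of_det hA hd]

/-- The Schwarz iteration is well defined as soon as the transmission matrix is invertible. -/
theorem wellPosed_of_det_ne_zero (h : IsScaling m ω k g κ r z₁ z₂)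
    (hA : (traceMatrix κ r 1 z₁ z₂).det ≠ 0) :
    WellPosed m ω δ k (taylorSymbol m ω) (taylorSymbol m ω) := by
  intro v₁ v₂ hv₁ hv₂
  choose solL solL_spec solL_unique using fun w => (existsUnique_left (δ := δ) h hA w)
  choose solR solR_spec solR_unique using fun w => (existsUnique_right h hA w)
  let step : Mode × Mode → Mode × Mode := fun e =>
    (solL (transTrace m k 1 (taylorSymbol m ω) e.2 δ),
      solR (transTrace m k (-1) (taylorSymbol m ω) e.1 0))
  let run : ℕ → Mode × Mode := fun n => step^[n] (v₁, v₂)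
  have hrun : ∀ n, run (n + 1) = step (run n) := fun n => Function.iterate_succ_apply' _ _ _
  refine ⟨(fun n => (run n).1, fun n => (run n).2),
    ⟨⟨hv₁, hv₂, ?_, ?_, ?_, ?_, ?_, ?_⟩, rfl, rfl⟩, ?_⟩
  · intro n; simp only [hrun]; exact (solL_spec _).1
  · intro n; simp only [hrun]; exact (solR_spec _).1
  · intro n; simp only [hrun]; exact (solL_spec _).2.1
  · intro n; simp only [hrun]; exact (solR_spec _).2.1
  · intro n; simp only [hrun]; exact (solL_spec _).2.2
  · intro n; simp only [hrun]; exact (solR_spec _).2.2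
  · rintro ⟨e₁, e₂⟩ ⟨he, h1, h2⟩
    have : ∀ n, (e₁ n, e₂ n) = run n := by
      intro n
      induction n with
      | zero => exact Prod.ext h1 h2
      | succ n ih =>
        rw [hrun, ← ih]
        exact Prod.ext (solL_unique _ _ ⟨he.navier₁ n, he.radiates₁ n, he.trans₁ n⟩)
          (solR_unique _ _ ⟨he.navier₂ n, he.radiates₂ n, he.trans₂ n⟩)
    refine Prod.ext (funext fun n => ?_) (funext fun n => ?_)
    · exact congrArg Prod.fst (this n)
    · exact congrArg Prod.snd (this n)

/-- In every run, the amplitudes in the two subdomains are exchanged and multiplied by the iteration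
matrix. -/
theorem exists_amplitudes (h : IsScaling m ω k g κ r z₁ z₂)
    (hA : (traceMatrix κ r 1 z₁ z₂).det ≠ 0) (hM : IsIterationMatrix g κ r δ z₁ z₂ M)
    {e₁ e₂ : ℕ → Mode}
    (he : IsSchwarzRun m ω δ k (taylorSymbol m ω) (taylorSymbol m ω) e₁ e₂) :
    ∃ f d : ℕ → Fin 2 → ℂ, (∀ n, e₁ (n + 1) = leftMode g κ δ z₁ z₂ (f n)) ∧
      (∀ n, e₂ (n + 1) = rightMode g κ z₁ z₂ (d n)) ∧
      (∀ n, f (n + 1) = M *ᵥ d n) ∧ (∀ n, d (n + 1) = M *ᵥ f n) := by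
  choose f hf using fun n => exists_eq_leftMode h (he.navier₁ n) (he.radiates₁ n)
  choose d hd using fun n => exists_eq_rightMode h (he.navier₂ n) (he.radiates₂ n)
  have hc := scale_ne_zero h
  refine ⟨f, d, hf, hd, fun n => ?_, fun n => ?_⟩
  · have := he.trans₁ (n + 1)
    rw [hf, hd, transTrace_left_self h, transTrace_right_other h hM] at this
    exact mulVec_inj_of_det hA (smul_right_injective _ hc this)
  · have := he.trans₂ (n + 1)
    rw [hf, hd, transTrace_right_self h, transTrace_left_other h hM] at this
    exact mulVec_inj_of_det hA (diagonal_mulVec_inj (smul_right_injective _ hc this))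

/-- The convergence factor is at most the spectral radius of the iteration matrix. -/
theorem errorsBigO_of_lt (h : IsScaling m ω k g κ r z₁ z₂)
    (hA : (traceMatrix κ r 1 z₁ z₂).det ≠ 0) (hM : IsIterationMatrix g κ r δ z₁ z₂ M)
    {x₁ x₂ : ℂ} (htr : x₁ + x₂ = M.trace) (hdet : x₁ * x₂ = M.det) {R : ℝ} (h₁ : ‖x₁‖ < R)
    (h₂ : ‖x₂‖ < R) : ErrorsBigO m ω δ k (taylorSymbol m ω) (taylorSymbol m ω) R := by
  have hR : 0 < R := (norm_nonneg _).trans_lt h₁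
  intro e₁ e₂ he i
  obtain ⟨f, d, hf, hd, hfd, hdf⟩ := exists_amplitudes h hA hM he
  obtain ⟨C₁, hC₁⟩ := exists_norm_pow_mulVec_le M htr hdet h₁ h₂ (f 0)
  obtain ⟨C₂, hC₂⟩ := exists_norm_pow_mulVec_le M htr hdet h₁ h₂ (d 0)
  have hswap : ∀ n, (f n = M ^ n *ᵥ f 0 ∧ d n = M ^ n *ᵥ d 0) ∨
      (f n = M ^ n *ᵥ d 0 ∧ d n = M ^ n *ᵥ f 0) := by
    intro n
    induction n with
    | zero => simp
    | succ n ih =>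
      rw [hfd, hdf, pow_succ', ← Matrix.mulVec_mulVec, ← Matrix.mulVec_mulVec]
      rcases ih with ⟨h1, h2⟩ | ⟨h1, h2⟩
      · right; rw [h1, h2]; exact ⟨rfl, rfl⟩
      · left; rw [h1, h2]; exact ⟨rfl, rfl⟩
  have hbd : ∀ n, ‖f n‖ ≤ max C₁ C₂ * R ^ n ∧ ‖d n‖ ≤ max C₁ C₂ * R ^ n := by
    intro n
    have b₁ := (hC₁ n).trans (mul_le_mul_of_nonneg_right (le_max_left C₁ C₂) (pow_pos hR n).le)
    have b₂ := (hC₂ n).trans (mul_le_mul_of_nonneg_right (le_max_right C₁ C₂) (pow_pos hR n).le)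
    rcases hswap n with ⟨h1, h2⟩ | ⟨h1, h2⟩ <;> rw [h1, h2] <;> constructor <;> assumption
  have aux : ∀ (u : ℕ → ℂ) (w : ℕ → Fin 2 → ℂ) (α β : ℂ),
      (∀ n, ‖w n‖ ≤ max C₁ C₂ * R ^ n) → (∀ n, u (n + 1) = w n 0 * α + w n 1 * β) →
      u =O[Filter.atTop] fun n : ℕ => R ^ n := by
    intro u w α β hw hu
    refine Asymptotics.IsBigO.of_bound (max C₁ C₂ * (‖α‖ + ‖β‖) / R) ?_
    filter_upwards [Filter.eventually_ge_atTop 1] with n hn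
    obtain ⟨n, rfl⟩ := Nat.exists_eq_add_of_le' hn
    rw [hu, Real.norm_of_nonneg (pow_pos hR _).le]
    have w0 := norm_le_pi_norm (w n) 0
    have w1 := norm_le_pi_norm (w n) 1
    calc ‖w n 0 * α + w n 1 * β‖ ≤ ‖w n 0‖ * ‖α‖ + ‖w n 1‖ * ‖β‖ := by
          refine (norm_add_le _ _).trans ?_
          rw [norm_mul, norm_mul]
      _ ≤ ‖w n‖ * ‖α‖ + ‖w n‖ * ‖β‖ := by gcongr
      _ = ‖w n‖ * (‖α‖ + ‖β‖) := by ring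
      _ ≤ max C₁ C₂ * R ^ n * (‖α‖ + ‖β‖) := by gcongr; exact hw n
      _ = max C₁ C₂ * (‖α‖ + ‖β‖) / R * R ^ (n + 1) := by field_simp; ring
  constructor
  · intro x _
    obtain ⟨α, β, hαβ⟩ := exists_leftMode_apply g κ δ z₁ z₂ i x
    exact aux _ f α β (fun n => (hbd n).1) fun n => by rw [hf, hαβ]
  · intro x _
    obtain ⟨α, β, hαβ⟩ := exists_rightMode_apply g κ z₁ z₂ i x
    exact aux _ d α β (fun n => (hbd n).2) fun n => by rw [hd, hαβ]

theorem norm_le_of_pow_mul_isBigO {x c : ℂ} (hc : c ≠ 0) {R : ℝ} (hR : 0 ≤ R)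
    (h : (fun n : ℕ => x ^ n * c) =O[Filter.atTop] fun n : ℕ => R ^ n) : ‖x‖ ≤ R := by
  by_contra! hlt
  have hx : x ≠ 0 := norm_pos_iff.mp (hR.trans_lt hlt)
  have h1 : (fun n : ℕ => x ^ n) =O[Filter.atTop] fun n : ℕ => R ^ n := by
    refine (Asymptotics.IsBigO.const_mul_left h c⁻¹).congr_left fun n => ?_
    field_simp
  have h2 : (fun n : ℕ => R ^ n) =o[Filter.atTop] fun n : ℕ => ‖x‖ ^ n :=
    isLittleO_pow_pow_of_lt_left hR hlt
  have h3 : (fun n : ℕ => x ^ n) =o[Filter.atTop] fun n : ℕ => x ^ n := by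
    refine (h1.trans_isLittleO h2).trans_isBigO (Asymptotics.isBigO_of_le _ fun n => ?_)
    rw [norm_pow, norm_pow, norm_norm]
  exact Asymptotics.isLittleO_irrefl (Filter.Frequently.of_forall fun n => pow_ne_zero n hx) h3

/-- The convergence factor is at least the modulus of each eigenvalue of the iteration matrix. -/
theorem norm_le_of_errorsBigO (h : IsScaling m ω k g κ r z₁ z₂)
    (hz : (κ : ℂ) ^ 2 - z₁ * z₂ ≠ 0) (hM : IsIterationMatrix g κ r δ z₁ z₂ M)
    {x₁ x₂ : ℂ} (htr : x₁ + x₂ = M.trace) (hdet : x₁ * x₂ = M.det) {R : ℝ} (hR : 0 ≤ R)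
    (hE : ErrorsBigO m ω δ k (taylorSymbol m ω) (taylorSymbol m ω) R) : ‖x₁‖ ≤ R := by
  obtain ⟨v, hv, hMv⟩ := exists_eigenvector M htr hdet
  -- An eigenvector, used in both subdomains, starts an explicit run.
  have hMx : ∀ n : ℕ, M *ᵥ (x₁ ^ n • v) = x₁ ^ (n + 1) • v := fun n => by
    rw [Matrix.mulVec_smul, hMv, smul_smul, pow_succ]
  have hrun : IsSchwarzRun m ω δ k (taylorSymbol m ω) (taylorSymbol m ω)
      (fun n => leftMode g κ δ z₁ z₂ (x₁ ^ n • v)) (fun n => rightMode g κ z₁ z₂ (x₁ ^ n • v)) :=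
    { init₁ := differentiable_planeMode _ _ _ _ _
      init₂ := differentiable_planeMode _ _ _ _ _
      navier₁ := fun n => solvesNavier_leftMode h _
      navier₂ := fun n => solvesNavier_rightMode h _
      radiates₁ := fun n => radiatesLeft_leftMode h _
      radiates₂ := fun n => radiatesRight_rightMode h _
      trans₁ := fun n => by rw [transTrace_left_self h, transTrace_right_other h hM, hMx]
      trans₂ := fun n => by rw [transTrace_right_self h, transTrace_left_other h hM, hMx] }
  have hne : ∃ i, leftMode g κ δ z₁ z₂ v i (δ - 1) ≠ 0 := by
    refine planeMode_apply_ne_zero hz (fun h0 => hv ?_) _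
    have h00 := congrFun h0 0
    have h01 := congrFun h0 1
    simp at h00 h01
    ext i
    fin_cases i <;> assumption
  obtain ⟨i, hi⟩ := hne
  have hO := (hE _ _ hrun i).1 (δ - 1) (by simp)
  obtain ⟨α, β, hαβ⟩ := exists_leftMode_apply g κ δ z₁ z₂ i (δ - 1)
  refine norm_le_of_pow_mul_isBigO hi hR (hO.congr_left fun n => ?_)
  rw [hαβ, hαβ]
  simp only [Pi.smul_apply, smul_eq_mul]
  ring

/-- The convergence factor is the spectral radius of the iteration matrix. -/
theorem rhoTaylor_eq (h : IsScaling m ω k g κ r z₁ z₂)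
    (hA : (traceMatrix κ r 1 z₁ z₂).det ≠ 0) (hz : (κ : ℂ) ^ 2 - z₁ * z₂ ≠ 0)
    (hM : IsIterationMatrix g κ r δ z₁ z₂ M)
    {x₁ x₂ : ℂ} (htr : x₁ + x₂ = M.trace) (hdet : x₁ * x₂ = M.det) :
    rhoTaylor m ω δ k = ENNReal.ofReal (max ‖x₁‖ ‖x₂‖) := by
  unfold rhoTaylor convFactor
  apply le_antisymm
  · refine ENNReal.le_of_forall_pos_le_add fun ε hε _ => ?_
    have hpos : 0 ≤ max ‖x₁‖ ‖x₂‖ := (norm_nonneg _).trans (le_max_left _ _)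
    have hE := errorsBigO_of_lt h hA hM htr hdet (R := ((max ‖x₁‖ ‖x₂‖).toNNReal + ε : ℝ≥0))
      (by rw [NNReal.coe_add, Real.coe_toNNReal _ hpos]
          exact (le_max_left ‖x₁‖ ‖x₂‖).trans_lt (lt_add_of_pos_right _ hε))
      (by rw [NNReal.coe_add, Real.coe_toNNReal _ hpos]
          exact (le_max_right ‖x₁‖ ‖x₂‖).trans_lt (lt_add_of_pos_right _ hε))
    refine le_trans (iInf₂_le ((max ‖x₁‖ ‖x₂‖).toNNReal + ε) hE) ?_
    rw [ENNReal.coe_add, ENNReal.ofReal]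
  · refine le_iInf₂ fun R hE => ?_
    refine ENNReal.ofReal_le_of_le_toReal ?_
    rw [ENNReal.coe_toReal]
    exact max_le (norm_le_of_errorsBigO h hz hM htr hdet R.2 hE)
      (norm_le_of_errorsBigO h hz hM (by rw [add_comm, htr]) (by rw [mul_comm, hdet]) R.2 hE)

/-- The behaviour of the Schwarz method is decided by the Schur–Cohn expression of the
characteristic polynomial of the iteration matrix. -/
theorem behaviour_of_schurCohn (h : IsScaling m ω k g κ r z₁ z₂)
    (hA : (traceMatrix κ r 1 z₁ z₂).det ≠ 0) (hz : (κ : ℂ) ^ 2 - z₁ * z₂ ≠ 0)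
    (hM : IsIterationMatrix g κ r δ z₁ z₂ M) (hΔ : ‖M.det‖ < 1) :
    (0 < schurCohn M.trace M.det → Converges m ω δ k) ∧
    (schurCohn M.trace M.det = 0 → Stagnates m ω δ k) ∧
    (schurCohn M.trace M.det < 0 → Diverges m ω δ k) := by
  obtain ⟨x₁, x₂, htr, hdet⟩ := exists_roots M.trace M.det
  have hρ := rhoTaylor_eq h hA hz hM htr hdet
  have := schurCohn_sign (x₁ := x₁) (x₂ := x₂) (by rwa [hdet])
  rw [htr, hdet] at this
  unfold Converges Stagnates Diverges
  rw [hρ]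
  refine ⟨fun hS => ?_, fun hS => ?_, fun hS => ?_⟩
  · exact ENNReal.ofReal_lt_one.mpr (this.1 hS)
  · exact ENNReal.ofReal_eq_one.mpr (this.2.1 hS)
  · exact ENNReal.one_lt_ofReal.mpr (this.2.2 hS)

end traces

/-! ### The iteration matrix -/

/-- The coefficient `(2κ² - 1)² + r κ²` of the Rayleigh-type determinants below. -/
def coefA (κ r : ℝ) : ℝ := (2 * κ ^ 2 - 1) ^ 2 + r * κ ^ 2

/-- The coefficient `4κ² + r` of `z₁ z₂` in the Rayleigh-type determinants below. -/
def coefC (κ r : ℝ) : ℝ := 4 * κ ^ 2 + r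

/-- The coupling `4κ² - 2 + r` of pressure and shear waves. -/
def coupling (κ r : ℝ) : ℝ := 4 * κ ^ 2 - 2 + r

/-- By this identity the determinant of the iteration matrix simplifies to `det_iterationMatrix`. -/
theorem coupling_identity (κ r : ℝ) :
    coefA κ r * coefC κ r - r = κ ^ 2 * coupling κ r ^ 2 := by
  unfold coefA coefC coupling; ring

/-- The negative of the determinant of the transmission matrix. -/
def transDet (κ r : ℝ) (z₁ z₂ : ℂ) : ℂ :=
  coefA κ r - coefC κ r * (z₁ * z₂) - Complex.I * (z₁ + r * z₂)

theorem det_traceMatrix (κ r : ℝ) (z₁ z₂ : ℂ) :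
    (traceMatrix κ r 1 z₁ z₂).det = -transDet κ r z₁ z₂ := by
  have hI := Complex.I_sq
  simp [traceMatrix, Matrix.det_fin_two_of, transDet, coefA, coefC]
  ring_nf
  simp only [Complex.I_sq, Complex.I_pow_three, Complex.I_pow_four]
  ring

/-- The iteration matrix; `e₁` and `e₂` are the factors by which the shear and the pressure wave
change across the overlap. -/
def iterationMatrix (κ r : ℝ) (z₁ z₂ e₁ e₂ : ℂ) : Matrix (Fin 2) (Fin 2) ℂ :=
  (transDet κ r z₁ z₂)⁻¹ •
    !![(coefA κ r + coefC κ r * (z₁ * z₂) - Complex.I * (z₁ - r * z₂)) * e₂,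
      2 * Complex.I * κ * z₁ * coupling κ r * e₁;
      2 * Complex.I * κ * z₂ * coupling κ r * e₂,
      -((coefA κ r + coefC κ r * (z₁ * z₂) + Complex.I * (z₁ - r * z₂)) * e₁)]

theorem isIterationMatrix_iterationMatrix (g κ r δ : ℝ) {z₁ z₂ : ℂ}
    (hD : transDet κ r z₁ z₂ ≠ 0) :
    IsIterationMatrix g κ r δ z₁ z₂ (iterationMatrix κ r z₁ z₂ (Complex.exp (-(g * z₁ * δ)))
      (Complex.exp (-(g * z₂ * δ)))) := by
  unfold IsIterationMatrix iterationMatrix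
  generalize Complex.exp (-(g * z₁ * δ)) = e₁
  generalize Complex.exp (-(g * z₂ * δ)) = e₂
  rw [Matrix.mul_smul, inv_smul_eq_iff₀ hD]
  have hd : Matrix.diagonal ![e₂, -e₁] = !![e₂, 0; 0, -e₁] := by
    ext i j
    fin_cases i <;> fin_cases j <;> rfl
  rw [hd]
  ext i j
  fin_cases i <;> fin_cases j <;>
    simp [traceMatrix, transDet, coefA, coefC, coupling] <;> ring_nf <;>
    simp only [Complex.I_sq, Complex.I_pow_three] <;> ring

theorem trace_iterationMatrix (κ r : ℝ) (z₁ z₂ e₁ e₂ : ℂ) :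
    (iterationMatrix κ r z₁ z₂ e₁ e₂).trace =
      ((coefA κ r + coefC κ r * (z₁ * z₂) - Complex.I * (z₁ - r * z₂)) * e₂ -
        (coefA κ r + coefC κ r * (z₁ * z₂) + Complex.I * (z₁ - r * z₂)) * e₁) /
          transDet κ r z₁ z₂ := by
  rw [iterationMatrix, Matrix.trace_smul, Matrix.trace_fin_two_of, smul_eq_mul]
  ring

theorem det_iterationMatrix (κ r : ℝ) {z₁ z₂ : ℂ} (e₁ e₂ : ℂ) (hD : transDet κ r z₁ z₂ ≠ 0) :
    (iterationMatrix κ r z₁ z₂ e₁ e₂).det =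
      -((coefA κ r - coefC κ r * (z₁ * z₂) + Complex.I * (z₁ + r * z₂)) * (e₁ * e₂)) /
        transDet κ r z₁ z₂ := by
  have hI := Complex.I_sq
  have hid : (coefA κ r * coefC κ r - r : ℂ) = κ ^ 2 * coupling κ r ^ 2 := by
    exact_mod_cast coupling_identity κ r
  have key : (coefA κ r + coefC κ r * (z₁ * z₂) - Complex.I * (z₁ - r * z₂)) * e₂ *
      -((coefA κ r + coefC κ r * (z₁ * z₂) + Complex.I * (z₁ - r * z₂)) * e₁) -
      2 * Complex.I * κ * z₁ * coupling κ r * e₁ * (2 * Complex.I * κ * z₂ * coupling κ r * e₂) =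
      -((coefA κ r - coefC κ r * (z₁ * z₂) + Complex.I * (z₁ + r * z₂)) * (e₁ * e₂)) *
        transDet κ r z₁ z₂ := by
    rw [transDet]
    linear_combination (-4 * e₁ * e₂ * z₁ * z₂) * hid + (e₁ * e₂) * ((z₁ - r * z₂) ^ 2
      - (z₁ + r * z₂) ^ 2 - 4 * κ ^ 2 * z₁ * z₂ * coupling κ r ^ 2) * hI
  rw [iterationMatrix, Matrix.det_smul, Matrix.det_fin_two_of, Fintype.card_fin, key]
  field_simp

theorem schurCohn_div {D : ℂ} (hD : D ≠ 0) (τ η : ℂ) :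
    schurCohn (τ / D) (η / D) * Complex.normSq D ^ 2 =
      (Complex.normSq D - Complex.normSq η) ^ 2 -
        Complex.normSq (τ * (starRingEnd ℂ) D - (starRingEnd ℂ) τ * η) := by
  have h0 : (starRingEnd ℂ) D ≠ 0 := by simpa using hD
  have hn : Complex.normSq D ≠ 0 := by simpa using hD
  have h1 : τ / D - (starRingEnd ℂ) (τ / D) * (η / D) =
      (τ * (starRingEnd ℂ) D - (starRingEnd ℂ) τ * η) / (D * (starRingEnd ℂ) D) := by
    rw [map_div₀]
    field_simp
  rw [schurCohn, h1, Complex.mul_conj, Complex.normSq_div, Complex.normSq_div,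
    Complex.normSq_ofReal]
  field_simp

/-! ### The Schur–Cohn expression in the three regimes -/

theorem coefA_pos {κ r : ℝ} (hκ : 0 < κ) (hr : 0 < r) : 0 < coefA κ r := by
  unfold coefA; positivity

theorem coefC_pos {κ r : ℝ} (hr : 0 < r) : 0 < coefC κ r := by
  unfold coefC; positivity

theorem norm_div_lt_one {D η : ℂ} (h : Complex.normSq η < Complex.normSq D) : ‖η / D‖ < 1 := by
  have hD : 0 < Complex.normSq D := (Complex.normSq_nonneg η).trans_lt h
  have h1 : Complex.normSq (η / D) < 1 := by
    rw [Complex.normSq_div, div_lt_one hD]; exact h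
  rw [Complex.normSq_eq_norm_sq] at h1
  exact (sq_lt_one_iff₀ (norm_nonneg _)).mp h1

theorem two_mul_abs_add_abs_lt {G H N L : ℝ} (hN : 0 < N) (hL : 0 < L) (hG : |G| < N)
    (hH : |H| < L) : 2 * |G * L + H * N| + 2 * |G * L - H * N| < 4 * (N * L) := by
  obtain ⟨g1, g2⟩ := abs_lt.mp hG
  obtain ⟨g3, g4⟩ := abs_lt.mp hH
  have k1 : G * L < N * L := mul_lt_mul_of_pos_right g2 hL
  have k2 : -N * L < G * L := mul_lt_mul_of_pos_right g1 hL
  have k3 : H * N < L * N := mul_lt_mul_of_pos_right g4 hN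
  have k4 : -L * N < H * N := mul_lt_mul_of_pos_right g3 hN
  rcases abs_cases (G * L + H * N) with ⟨e, _⟩ | ⟨e, _⟩ <;>
  rcases abs_cases (G * L - H * N) with ⟨e', _⟩ | ⟨e', _⟩ <;> rw [e, e'] <;> linarith

theorem normSq_eq_one_of_mul_conj {e : ℂ} (h : e * (starRingEnd ℂ) e = 1) :
    Complex.normSq e = 1 := by
  rw [Complex.mul_conj] at h
  exact_mod_cast h

theorem norm_eq_one_of_mul_conj {e : ℂ} (h : e * (starRingEnd ℂ) e = 1) : ‖e‖ = 1 := by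
  have := normSq_eq_one_of_mul_conj h
  rw [Complex.normSq_eq_norm_sq] at this
  nlinarith [norm_nonneg e]

/-- Both waves propagate: the iteration is a strict contraction whatever the phases are. -/
theorem schurCohn_pos_of_propagating {κ r l₁ l₂ : ℝ} (hκ : 0 < κ) (hr : 0 < r) (h₁ : 0 < l₁)
    (h₂ : 0 < l₂) {e₁ e₂ : ℂ} (he₁ : e₁ * (starRingEnd ℂ) e₁ = 1)
    (he₂ : e₂ * (starRingEnd ℂ) e₂ = 1) :
    transDet κ r (Complex.I * l₁) (Complex.I * l₂) ≠ 0 ∧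
    ‖(iterationMatrix κ r (Complex.I * l₁) (Complex.I * l₂) e₁ e₂).det‖ < 1 ∧
    0 < schurCohn (iterationMatrix κ r (Complex.I * l₁) (Complex.I * l₂) e₁ e₂).trace
      (iterationMatrix κ r (Complex.I * l₁) (Complex.I * l₂) e₁ e₂).det := by
  have ha := coefA_pos hκ hr
  have hc := coefC_pos (κ := κ) hr
  have hI := Complex.I_sq
  set a := coefA κ r with ha'
  set c := coefC κ r with hc'
  set N := a + c * (l₁ * l₂) with hN
  set G := a - c * (l₁ * l₂) with hG
  set L := l₁ + r * l₂ with hL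
  set H := l₁ - r * l₂ with hH
  have hNpos : 0 < N := by positivity
  have hLpos : 0 < L := by positivity
  have hD : transDet κ r (Complex.I * l₁) (Complex.I * l₂) = ((N + L : ℝ) : ℂ) := by
    rw [transDet, ← ha', ← hc', hN, hL]
    push_cast
    linear_combination (-c * l₁ * l₂ - l₁ - r * l₂ : ℂ) * hI
  have hD0 : transDet κ r (Complex.I * l₁) (Complex.I * l₂) ≠ 0 := by
    rw [hD]
    exact_mod_cast (by positivity : N + L ≠ 0)
  have hτ : (coefA κ r + coefC κ r * (Complex.I * l₁ * (Complex.I * l₂)) -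
      Complex.I * (Complex.I * l₁ - r * (Complex.I * l₂))) * e₂ -
      (coefA κ r + coefC κ r * (Complex.I * l₁ * (Complex.I * l₂)) +
      Complex.I * (Complex.I * l₁ - r * (Complex.I * l₂))) * e₁ =
      ((G + H : ℝ) : ℂ) * e₂ - ((G - H : ℝ) : ℂ) * e₁ := by
    rw [← ha', ← hc', hG, hH]
    push_cast
    linear_combination (c * l₁ * l₂ * e₂ - c * l₁ * l₂ * e₁ - (l₁ - r * l₂) * (e₁ + e₂) : ℂ) * hI
  have hη : -((coefA κ r - coefC κ r * (Complex.I * l₁ * (Complex.I * l₂)) +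
      Complex.I * (Complex.I * l₁ + r * (Complex.I * l₂))) * (e₁ * e₂)) =
      -(((N - L : ℝ) : ℂ) * (e₁ * e₂)) := by
    rw [← ha', ← hc', hN, hL]
    push_cast
    linear_combination (c * l₁ * l₂ - l₁ - r * l₂ : ℂ) * (e₁ * e₂) * hI
  have hηn : Complex.normSq (-(((N - L : ℝ) : ℂ) * (e₁ * e₂))) = (N - L) ^ 2 := by
    rw [Complex.normSq_neg, Complex.normSq_mul, Complex.normSq_mul, normSq_eq_one_of_mul_conj he₁,
      normSq_eq_one_of_mul_conj he₂,
      Complex.normSq_ofReal]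
    ring
  have hDn : Complex.normSq ((N + L : ℝ) : ℂ) = (N + L) ^ 2 := by
    rw [Complex.normSq_ofReal]; ring
  refine ⟨hD0, ?_, ?_⟩
  · rw [det_iterationMatrix κ r e₁ e₂ hD0, hη, hD]
    apply norm_div_lt_one
    rw [hηn, hDn]
    nlinarith [mul_pos hNpos hLpos]
  · have hS := schurCohn_div hD0 (((G + H : ℝ) : ℂ) * e₂ - ((G - H : ℝ) : ℂ) * e₁)
      (-(((N - L : ℝ) : ℂ) * (e₁ * e₂)))
    rw [trace_iterationMatrix, det_iterationMatrix κ r e₁ e₂ hD0, hη, hτ]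
    rw [hηn] at hS
    refine pos_of_mul_pos_left
      (b := Complex.normSq (transDet κ r (Complex.I * l₁) (Complex.I * l₂)) ^ 2) ?_ (sq_nonneg _)
    rw [hS, hD, hDn, Complex.conj_ofReal]
    have hV : (((G + H : ℝ) : ℂ) * e₂ - ((G - H : ℝ) : ℂ) * e₁) * ((N + L : ℝ) : ℂ) -
        (starRingEnd ℂ) (((G + H : ℝ) : ℂ) * e₂ - ((G - H : ℝ) : ℂ) * e₁) *
          (-(((N - L : ℝ) : ℂ) * (e₁ * e₂))) =
        ((2 * (G * L + H * N) : ℝ) : ℂ) * e₂ - ((2 * (G * L - H * N) : ℝ) : ℂ) * e₁ := by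
      simp only [map_sub, map_mul, Complex.conj_ofReal]
      push_cast
      linear_combination ((G + H) * (N - L) * e₁ : ℂ) * he₂ - ((G - H) * (N - L) * e₂ : ℂ) * he₁
    rw [hV]
    have hGN : |G| < N := by
      have := mul_pos hc (mul_pos h₁ h₂)
      rw [abs_lt]; constructor <;> simp only [hG, hN] <;> linarith
    have hHL : |H| < L := by
      have := mul_pos hr h₂
      rw [abs_lt]; constructor <;> simp only [hH, hL] <;> linarith
    have hb : ‖((2 * (G * L + H * N) : ℝ) : ℂ) * e₂ - ((2 * (G * L - H * N) : ℝ) : ℂ) * e₁‖ <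
        4 * (N * L) := by
      refine (norm_sub_le _ _).trans_lt ?_
      rw [norm_mul, norm_mul, norm_eq_one_of_mul_conj he₁, norm_eq_one_of_mul_conj he₂,
        Complex.norm_real, Complex.norm_real, mul_one, mul_one,
        Real.norm_eq_abs, Real.norm_eq_abs, abs_mul, abs_mul, abs_two]
      exact two_mul_abs_add_abs_lt hNpos hLpos hGN hHL
    rw [Complex.normSq_eq_norm_sq]
    have h0 := norm_nonneg
      (((2 * (G * L + H * N) : ℝ) : ℂ) * e₂ - ((2 * (G * L - H * N) : ℝ) : ℂ) * e₁)
    have h4 : (N + L) ^ 2 - (N - L) ^ 2 = 4 * (N * L) := by ring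
    rw [h4]
    exact sub_pos.mpr (pow_lt_pow_left₀ hb h0 two_ne_zero)

/-- The Schur–Cohn expression, up to a positive factor, if the pressure wave is evanescent and the
shear wave propagates. Here `C`, `S` are the cosine and sine of the phase of the shear wave and
`ch`, `sh` are the hyperbolic cosine and sine of the damping exponent of the pressure wave. -/
def mixedForm (a b σ τ C S ch sh : ℝ) : ℝ :=
  (a * σ + b * τ) ^ 2 * (1 + 2 * sh ^ 2) +
    (a * σ + b * τ) * (a ^ 2 + σ ^ 2 + b ^ 2 + τ ^ 2) * sh * ch -
    (a * b - σ * τ) ^ 2 - (σ * a - b * τ) ^ 2 - (a * b + σ * τ) ^ 2 +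
    C * ((σ * a - b * τ) * (a ^ 2 - σ ^ 2 - b ^ 2 + τ ^ 2) * sh +
      2 * (a * b + σ * τ) * (a * b - σ * τ) * ch) -
    S * ((a * b + σ * τ) * (a ^ 2 - σ ^ 2 - b ^ 2 + τ ^ 2) * sh -
      2 * (σ * a - b * τ) * (a * b - σ * τ) * ch)

/-- In the mixed regime, `d` and `conj F` are the coefficients of the two waves in the trace of the
iteration matrix and `ch - sh` is the damping of the pressure wave. -/
theorem schurCohn_of_conj {d F e : ℂ} {ch sh : ℝ} (hd : d ≠ 0) (he : e * (starRingEnd ℂ) e = 1)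
    (hch : ch ^ 2 - sh ^ 2 = 1) :
    schurCohn (((starRingEnd ℂ) d * (ch - sh) - (starRingEnd ℂ) F * e) / d)
      (-(F * (e * (ch - sh))) / d) * Complex.normSq d ^ 2 = (ch - sh) ^ 2 *
        (((Complex.normSq d - Complex.normSq F) * ch +
            (Complex.normSq d + Complex.normSq F) * sh) ^ 2
          - Complex.normSq ((starRingEnd ℂ) d ^ 2 - F ^ 2 - e *
            ((ch + sh) * ((starRingEnd ℂ) F * (starRingEnd ℂ) d) - (ch - sh) * (d * F)))) := by
  have hch' : (ch ^ 2 - sh ^ 2 : ℂ) = 1 := by exact_mod_cast hch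
  have e2 : Complex.normSq (ch - sh : ℂ) = (ch - sh) ^ 2 := by
    rw [← Complex.ofReal_sub, Complex.normSq_ofReal]; ring
  have hV : ((starRingEnd ℂ) d * (ch - sh) - (starRingEnd ℂ) F * e) * (starRingEnd ℂ) d -
      (starRingEnd ℂ) ((starRingEnd ℂ) d * (ch - sh) - (starRingEnd ℂ) F * e) *
        -(F * (e * (ch - sh))) = (ch - sh) * ((starRingEnd ℂ) d ^ 2 - F ^ 2 - e *
            ((ch + sh) * ((starRingEnd ℂ) F * (starRingEnd ℂ) d) - (ch - sh) * (d * F))) := by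
    simp only [map_sub, map_mul, Complex.conj_conj, Complex.conj_ofReal]
    linear_combination (-F ^ 2 * (ch - sh) : ℂ) * he +
      (e * (starRingEnd ℂ) F * (starRingEnd ℂ) d) * hch'
  rw [schurCohn_div hd, hV, Complex.normSq_neg, Complex.normSq_mul, Complex.normSq_mul,
    Complex.normSq_mul, normSq_eq_one_of_mul_conj he, e2]
  have hX : Complex.normSq d - Complex.normSq F * (1 * (ch - sh) ^ 2) = (ch - sh) *
      ((Complex.normSq d - Complex.normSq F) * ch +
        (Complex.normSq d + Complex.normSq F) * sh) := by
    linear_combination -Complex.normSq d * hch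
  rw [hX]
  ring

theorem mixed_det_bound {a b σ τ ch sh : ℝ} (ha : 0 < a) (hb : 0 ≤ b) (hσ : 0 ≤ σ) (hτ : 0 ≤ τ)
    (hch : ch ^ 2 - sh ^ 2 = 1) (hε : 0 < ch - sh) (hsh : 0 ≤ sh) (hlt : 0 < σ ∨ 0 < sh) :
    ((a - σ) ^ 2 + (b - τ) ^ 2) * (ch - sh) ^ 2 < (a + σ) ^ 2 + (b + τ) ^ 2 := by
  have hle : (ch - sh) * (ch + sh) = 1 := by linarith
  have hch1 : 1 ≤ ch + sh := by nlinarith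
  have hle1 : ch - sh ≤ 1 := by nlinarith
  have hle2 : (ch - sh) ^ 2 ≤ 1 := pow_le_one₀ hε.le hle1
  have hF : 0 ≤ (a - σ) ^ 2 + (b - τ) ^ 2 := by positivity
  have hbτ := mul_nonneg hb hτ
  rcases hlt with h | h
  · have := mul_pos ha h
    have := mul_le_mul_of_nonneg_left hle2 hF
    linarith
  · have hlt1 : ch - sh < 1 := by
      by_contra h1
      nlinarith
    have hlt2 : (ch - sh) ^ 2 < 1 := pow_lt_one₀ hε.le hlt1 two_ne_zero
    have hd : 0 < (a + σ) ^ 2 + (b + τ) ^ 2 := by positivity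
    have h1 : (a - σ) ^ 2 + (b - τ) ^ 2 ≤ (a + σ) ^ 2 + (b + τ) ^ 2 := by
      have := mul_nonneg ha.le hσ
      linarith
    calc ((a - σ) ^ 2 + (b - τ) ^ 2) * (ch - sh) ^ 2
        ≤ ((a + σ) ^ 2 + (b + τ) ^ 2) * (ch - sh) ^ 2 := by gcongr
      _ < ((a + σ) ^ 2 + (b + τ) ^ 2) * 1 := by gcongr
      _ = _ := mul_one _

/-- The strict bound for the determinant needs either a propagating shear wave or a damped pressure
wave; the end points of the regime are included. -/
theorem schurCohn_mixed {κ r l₁ l₂ : ℝ} (hκ : 0 < κ) (hr : 0 < r) (h₁ : 0 ≤ l₁) (h₂ : 0 ≤ l₂)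
    {C S ch sh : ℝ} (hCS : C ^ 2 + S ^ 2 = 1) (hch : ch ^ 2 - sh ^ 2 = 1) (hε : 0 < ch - sh)
    (hsh : 0 ≤ sh) (hlt : 0 < l₁ ∨ 0 < sh) :
    transDet κ r (Complex.I * l₁) l₂ ≠ 0 ∧
    ‖(iterationMatrix κ r (Complex.I * l₁) l₂ (C - Complex.I * S) (ch - sh)).det‖ < 1 ∧
    ∃ q > 0, schurCohn (iterationMatrix κ r (Complex.I * l₁) l₂ (C - Complex.I * S) (ch - sh)).trace
      (iterationMatrix κ r (Complex.I * l₁) l₂ (C - Complex.I * S) (ch - sh)).det =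
      q * mixedForm (coefA κ r) (coefC κ r * (l₁ * l₂)) l₁ (r * l₂) C S ch sh := by
  have ha := coefA_pos hκ hr
  have hc := coefC_pos (κ := κ) hr
  have hb0 : 0 ≤ coefC κ r * (l₁ * l₂) := by positivity
  have hτ0 : 0 ≤ r * l₂ := by positivity
  set e : ℂ := C - Complex.I * S with he
  have hee : e * (starRingEnd ℂ) e = 1 := by
    rw [he, Complex.mul_conj, show (C - Complex.I * S : ℂ) = ⟨C, -S⟩ by
      apply Complex.ext <;> simp, Complex.normSq_mk]
    exact_mod_cast (by linarith : C * C + -S * -S = 1)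
  set F : ℂ := coefA κ r - coefC κ r * (Complex.I * l₁ * l₂) +
    Complex.I * (Complex.I * l₁ + r * l₂) with hF
  have hF' : F = ⟨coefA κ r - l₁, -(coefC κ r * (l₁ * l₂) - r * l₂)⟩ := by
    apply Complex.ext <;> simp [hF] <;> ring
  have hd' : transDet κ r (Complex.I * l₁) l₂ =
      ⟨coefA κ r + l₁, -(coefC κ r * (l₁ * l₂) + r * l₂)⟩ := by
    apply Complex.ext <;> simp [transDet]
    ring
  have htr := trace_iterationMatrix κ r (Complex.I * l₁) l₂ e (ch - sh)
  have hdet := fun hd => det_iterationMatrix κ r (z₁ := Complex.I * l₁) (z₂ := l₂) e (ch - sh) hd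
  have hT : coefA κ r + coefC κ r * (Complex.I * l₁ * l₂) - Complex.I * (Complex.I * l₁ - r * l₂) =
      (starRingEnd ℂ) (transDet κ r (Complex.I * l₁) l₂) := by
    rw [hd']
    apply Complex.ext <;> simp
  have hT' : coefA κ r + coefC κ r * (Complex.I * l₁ * l₂) + Complex.I * (Complex.I * l₁ - r * l₂) =
      (starRingEnd ℂ) F := by
    rw [hF']
    apply Complex.ext
    · simp; ring
    · simp; ring
  rw [hT, hT'] at htr
  rw [← hF] at hdet
  generalize coefC κ r * (l₁ * l₂) = b at *
  generalize r * l₂ = τ at *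
  generalize coefA κ r = a at *
  generalize transDet κ r (Complex.I * l₁) l₂ = d at *
  clear_value F e
  have hdn : Complex.normSq d = (a + l₁) ^ 2 + (b + τ) ^ 2 := by
    rw [hd', Complex.normSq_mk]; ring
  have hFn : Complex.normSq F = (a - l₁) ^ 2 + (b - τ) ^ 2 := by
    rw [hF', Complex.normSq_mk]; ring
  have hdpos : 0 < Complex.normSq d := by rw [hdn]; positivity
  have hd0 : d ≠ 0 := Complex.normSq_pos.mp hdpos
  have e2 : Complex.normSq (ch - sh : ℂ) = (ch - sh) ^ 2 := by
    rw [← Complex.ofReal_sub, Complex.normSq_ofReal]; ring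
  refine ⟨hd0, ?_, 16 * (ch - sh) ^ 2 / Complex.normSq d ^ 2, by positivity, ?_⟩
  · rw [hdet hd0]
    apply norm_div_lt_one
    rw [Complex.normSq_neg, Complex.normSq_mul, Complex.normSq_mul, normSq_eq_one_of_mul_conj hee,
      e2, one_mul, hFn, hdn]
    exact mixed_det_bound ha hb0 h₁ hτ0 hch hε hsh hlt
  · have hS := schurCohn_of_conj (F := F) hd0 hee hch
    rw [← htr, ← hdet hd0] at hS
    rw [div_mul_eq_mul_div, eq_div_iff (by positivity), hS, mixedForm]
    have hW : (starRingEnd ℂ) d ^ 2 - F ^ 2 - e *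
            ((ch + sh) * ((starRingEnd ℂ) F * (starRingEnd ℂ) d) - (ch - sh) * (d * F)) =
        ⟨4 * (l₁ * a - b * τ) - (C * (2 * (a ^ 2 - l₁ ^ 2 - b ^ 2 + τ ^ 2) * sh) +
          S * (4 * (a * b - l₁ * τ) * ch)),
        4 * (a * b + l₁ * τ) - (C * (4 * (a * b - l₁ * τ) * ch) -
          S * (2 * (a ^ 2 - l₁ ^ 2 - b ^ 2 + τ ^ 2) * sh))⟩ := by
      rw [he, hF', hd']
      apply Complex.ext
      · simp [sq]; ring
      · simp [sq]; ring
    rw [hW, hdn, hFn, Complex.normSq_mk]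
    linear_combination (ch - sh) ^ 2 *
      ((16 * (a * l₁ + b * τ) ^ 2 - 16 * (a * b - l₁ * τ) ^ 2) * hch -
      (4 * (a ^ 2 - l₁ ^ 2 - b ^ 2 + τ ^ 2) ^ 2 * sh ^ 2 +
        16 * (a * b - l₁ * τ) ^ 2 * ch ^ 2) * hCS)

/-- The Schur–Cohn expression, up to a positive factor, if both waves are evanescent. Here `χ` and
`ζ` are half the sum and half the difference of the two damping exponents. -/
def evanescentForm (κ r z₁ z₂ χ ζ : ℝ) : ℝ :=
  (Real.sinh χ ^ 2 - Real.sinh ζ ^ 2) *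
      ((coefA κ r + coefC κ r * (z₁ * z₂)) ^ 2 * Real.cosh χ ^ 2 +
        (z₁ - r * z₂) ^ 2 * Real.sinh χ ^ 2) -
    4 * (κ ^ 2 * coupling κ r ^ 2 * (z₁ * z₂)) * (Real.sinh χ ^ 2 * Real.cosh χ ^ 2)

theorem schurCohn_evanescent_aux (A h e₁ e₂ : ℝ) {d : ℂ} (hd : d ≠ 0) :
    schurCohn (((A - Complex.I * h) * e₂ - (A + Complex.I * h) * e₁) / d)
      (-((starRingEnd ℂ) d * (e₁ * e₂)) / d) * Complex.normSq d =
      Complex.normSq d * (1 - (e₁ * e₂) ^ 2) ^ 2 -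
        (A ^ 2 * (e₂ - e₁) ^ 2 * (1 + e₁ * e₂) ^ 2 +
          h ^ 2 * (e₁ + e₂) ^ 2 * (1 - e₁ * e₂) ^ 2) := by
  have hn : Complex.normSq d ≠ 0 := by simpa using hd
  have h1 := schurCohn_div hd ((A - Complex.I * h) * e₂ - (A + Complex.I * h) * e₁)
    (-((starRingEnd ℂ) d * (e₁ * e₂)))
  have h2 : ((A - Complex.I * h) * e₂ - (A + Complex.I * h) * e₁ : ℂ) * (starRingEnd ℂ) d -
      (starRingEnd ℂ) ((A - Complex.I * h) * e₂ - (A + Complex.I * h) * e₁ : ℂ) *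
        -((starRingEnd ℂ) d * (e₁ * e₂)) = (starRingEnd ℂ) d *
        (⟨A * (e₂ - e₁) * (1 + e₁ * e₂), -(h * (e₁ + e₂) * (1 - e₁ * e₂))⟩ : ℂ) := by
    apply Complex.ext <;> simp <;> ring
  have h3 : Complex.normSq (e₁ * e₂ : ℂ) = (e₁ * e₂) ^ 2 := by
    rw [← Complex.ofReal_mul, Complex.normSq_ofReal]; ring
  have h4 : Complex.normSq (⟨A * (e₂ - e₁) * (1 + e₁ * e₂), -(h * (e₁ + e₂) * (1 - e₁ * e₂))⟩ : ℂ) =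
      A ^ 2 * (e₂ - e₁) ^ 2 * (1 + e₁ * e₂) ^ 2 + h ^ 2 * (e₁ + e₂) ^ 2 * (1 - e₁ * e₂) ^ 2 := by
    rw [Complex.normSq_mk]; ring
  rw [h2, Complex.normSq_neg, Complex.normSq_mul ((starRingEnd ℂ) d),
    Complex.normSq_mul ((starRingEnd ℂ) d), Complex.normSq_conj, h3, h4] at h1
  apply mul_right_cancel₀ hn
  linear_combination h1

/-- If both waves are evanescent, the product of the eigenvalues is `exp (-(z₁ + z₂) δ)` in
modulus. -/
theorem schurCohn_evanescent {κ r z₁ z₂ δ : ℝ} (hr : 0 < r) (h₁ : 0 < z₁) (h₂ : 0 < z₂)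
    (hδ : 0 < δ) :
    transDet κ r z₁ z₂ ≠ 0 ∧
    ‖(iterationMatrix κ r z₁ z₂ (Real.exp (-(z₁ * δ)) : ℝ) (Real.exp (-(z₂ * δ)) : ℝ)).det‖ < 1 ∧
    ∃ q > 0,
      schurCohn
        (iterationMatrix κ r z₁ z₂ (Real.exp (-(z₁ * δ)) : ℝ) (Real.exp (-(z₂ * δ)) : ℝ)).trace
        (iterationMatrix κ r z₁ z₂ (Real.exp (-(z₁ * δ)) : ℝ) (Real.exp (-(z₂ * δ)) : ℝ)).det =
      q * evanescentForm κ r z₁ z₂ ((z₁ + z₂) / 2 * δ) ((z₂ - z₁) / 2 * δ) := by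
  have hd' : transDet κ r z₁ z₂ =
      ⟨coefA κ r - coefC κ r * (z₁ * z₂), -(z₁ + r * z₂)⟩ := by
    apply Complex.ext <;> simp [transDet]
  have hdn : Complex.normSq (transDet κ r z₁ z₂) =
      (coefA κ r - coefC κ r * (z₁ * z₂)) ^ 2 + (z₁ + r * z₂) ^ 2 := by
    rw [hd', Complex.normSq_mk]; ring
  have hdpos : 0 < Complex.normSq (transDet κ r z₁ z₂) := by rw [hdn]; positivity
  have hd0 : transDet κ r z₁ z₂ ≠ 0 := Complex.normSq_pos.mp hdpos
  set χ := (z₁ + z₂) / 2 * δ with hχ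
  set ζ := (z₂ - z₁) / 2 * δ with hζ
  have he₁ : Real.exp (-(z₁ * δ)) = Real.exp (-χ) * Real.exp ζ := by
    rw [← Real.exp_add]; congr 1; rw [hχ, hζ]; ring
  have he₂ : Real.exp (-(z₂ * δ)) = Real.exp (-χ) * Real.exp (-ζ) := by
    rw [← Real.exp_add]; congr 1; rw [hχ, hζ]; ring
  have hχpos : 0 < χ := by positivity
  have hlt : Real.exp (-χ) < 1 := by rw [Real.exp_lt_one_iff]; linarith
  set p := Real.exp (-χ) with hp
  have hppos : 0 < p := Real.exp_pos _
  have hpc : p * Real.cosh χ = (1 + p ^ 2) / 2 := by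
    rw [Real.cosh_eq, hp, sq, ← Real.exp_add, mul_div_assoc', mul_add, ← Real.exp_add,
      ← Real.exp_add]
    simp
  have hps : p * Real.sinh χ = (1 - p ^ 2) / 2 := by
    rw [Real.sinh_eq, hp, sq, ← Real.exp_add, mul_div_assoc', mul_sub, ← Real.exp_add,
      ← Real.exp_add]
    simp
  have hζc : Real.exp ζ + Real.exp (-ζ) = 2 * Real.cosh ζ := by rw [Real.cosh_eq]; ring
  have hζs : Real.exp ζ - Real.exp (-ζ) = 2 * Real.sinh ζ := by rw [Real.sinh_eq]; ring
  have hee : Real.exp ζ * Real.exp (-ζ) = 1 := by rw [← Real.exp_add]; simp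
  have hprod : Real.exp (-(z₁ * δ)) * Real.exp (-(z₂ * δ)) = p ^ 2 := by
    rw [he₁, he₂]; linear_combination p ^ 2 * hee
  have hdet := det_iterationMatrix κ r (z₁ := z₁) (z₂ := z₂) (Real.exp (-(z₁ * δ)) : ℝ)
    (Real.exp (-(z₂ * δ)) : ℝ) hd0
  have htr := trace_iterationMatrix κ r z₁ z₂ (Real.exp (-(z₁ * δ)) : ℝ)
    (Real.exp (-(z₂ * δ)) : ℝ)
  have hconj : (coefA κ r - coefC κ r * (z₁ * z₂) + Complex.I * (z₁ + r * z₂) : ℂ) =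
      (starRingEnd ℂ) (transDet κ r z₁ z₂) := by
    rw [hd']
    apply Complex.ext <;> simp
  rw [hconj] at hdet
  refine ⟨hd0, ?_, 16 * p ^ 4 / Complex.normSq (transDet κ r z₁ z₂), by positivity, ?_⟩
  · rw [hdet]
    apply norm_div_lt_one
    rw [Complex.normSq_neg, Complex.normSq_mul, Complex.normSq_conj, ← Complex.ofReal_mul, hprod,
      Complex.normSq_ofReal]
    have : p ^ 2 * p ^ 2 < 1 := by
      rw [← pow_add]; exact pow_lt_one₀ hppos.le hlt (by norm_num)
    nlinarith
  · have hS := schurCohn_evanescent_aux (coefA κ r + coefC κ r * (z₁ * z₂)) (z₁ - r * z₂)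
      (Real.exp (-(z₁ * δ))) (Real.exp (-(z₂ * δ))) hd0
    have htr' : (iterationMatrix κ r z₁ z₂ (Real.exp (-(z₁ * δ)) : ℝ)
        (Real.exp (-(z₂ * δ)) : ℝ)).trace =
        ((((coefA κ r + coefC κ r * (z₁ * z₂) : ℝ) : ℂ) - Complex.I * ((z₁ - r * z₂ : ℝ) : ℂ)) *
          (Real.exp (-(z₂ * δ)) : ℝ) - (((coefA κ r + coefC κ r * (z₁ * z₂) : ℝ) : ℂ) +
          Complex.I * ((z₁ - r * z₂ : ℝ) : ℂ)) * (Real.exp (-(z₁ * δ)) : ℝ)) /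
          transDet κ r z₁ z₂ := by
      rw [htr]
      push_cast
      rfl
    rw [← htr', ← hdet, hprod, hdn] at hS
    rw [div_mul_eq_mul_div, hdn, eq_div_iff (by rw [← hdn]; exact hdpos.ne'), hS]
    have hid := coupling_identity κ r
    have k1 : Real.exp (-(z₂ * δ)) - Real.exp (-(z₁ * δ)) = -(2 * p * Real.sinh ζ) := by
      rw [he₁, he₂]; linear_combination -p * hζs
    have k2 : Real.exp (-(z₁ * δ)) + Real.exp (-(z₂ * δ)) = 2 * p * Real.cosh ζ := by
      rw [he₁, he₂]; linear_combination p * hζc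
    have k3 : 1 + p ^ 2 = 2 * (p * Real.cosh χ) := by rw [hpc]; ring
    have k4 : 1 - p ^ 2 = 2 * (p * Real.sinh χ) := by rw [hps]; ring
    have k5 : 1 - (p ^ 2) ^ 2 = (2 * (p * Real.cosh χ)) * (2 * (p * Real.sinh χ)) := by
      rw [← k3, ← k4]; ring
    rw [k1, k2, k3, k4, k5, evanescentForm]
    have c1 := Real.cosh_sq χ
    have c2 := Real.cosh_sq ζ
    linear_combination 16 * p ^ 4 * ((z₁ - r * z₂) ^ 2 * Real.sinh χ ^ 2 * (c1 - c2) -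
      4 * (z₁ * z₂) * Real.sinh χ ^ 2 * Real.cosh χ ^ 2 * hid)

/-! ### Propagating shear waves and evanescent pressure waves -/

theorem mixedForm_of_left_eq_zero (a r c l₂ C S ch sh : ℝ) :
    mixedForm a (c * (0 * l₂)) 0 (r * l₂) C S ch sh = 0 := by
  unfold mixedForm; ring

theorem mixedForm_of_right_eq_zero (a r c l₁ C S ch : ℝ) :
    mixedForm a (c * (l₁ * 0)) l₁ (r * 0) C S ch 0 = 0 := by
  unfold mixedForm; ring

/-- The terms of `mixedForm` that are of lower order than `l₁² l₂²` are nonnegative, and the main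
term `4 r (a c - r) l₁² l₂²` dominates the others if the overlap is small. -/
theorem mixedForm_pos {a c r l₁ l₂ C S ch sh δ U : ℝ} (ha : 0 < a) (hc : 0 < c) (hr : 0 < r)
    (h₁ : 0 < l₁) (h₁' : l₁ ≤ 1) (h₂ : 0 < l₂) (h₂' : l₂ ≤ 1) (hW : 0 < a * c - r)
    (hC : |C| ≤ 1) (hC' : 1 - δ ^ 2 / 2 ≤ C * ch) (hS : 0 ≤ S) (hS' : S ≤ l₁ * δ) (hch : 1 ≤ ch)
    (hch' : ch ≤ 2) (hsh : 0 ≤ sh) (hsh' : sh ≤ 2 * (l₂ * δ)) (hδ : 0 < δ)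
    (hU : a ^ 2 + l₁ ^ 2 + (c * (l₁ * l₂)) ^ 2 + (r * l₂) ^ 2 ≤ U)
    (hsmall : (a * c + r) * (a * c - r) * δ ^ 2 + 2 * (a * c + r) * U * δ ^ 2 +
      4 * δ * c * r * (a * c - r) < 4 * r * (a * c - r)) :
    0 < mixedForm a (c * (l₁ * l₂)) l₁ (r * l₂) C S ch sh := by
  set b := c * (l₁ * l₂) with hb
  set τ := r * l₂ with hτ
  have hb0 : 0 < b := by positivity
  have hτ0 : 0 < τ := by positivity
  set J := a * l₁ + b * τ with hJ
  set m := l₁ * a - b * τ with hm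
  set n := a * b + l₁ * τ with hn
  set w := a * b - l₁ * τ with hw
  set Q := a ^ 2 + l₁ ^ 2 + b ^ 2 + τ ^ 2 with hQ
  set u := a ^ 2 - l₁ ^ 2 - b ^ 2 + τ ^ 2 with hu
  have hn' : n = (a * c + r) * (l₁ * l₂) := by rw [hn, hb, hτ]; ring
  have hw' : w = (a * c - r) * (l₁ * l₂) := by rw [hw, hb, hτ]; ring
  have hn0 : 0 < n := by positivity
  have hw0 : 0 < w := by rw [hw']; positivity
  have hJ0 : 0 < J := by positivity
  have hQ0 : 0 < Q := by positivity
  have hmJ : |m| ≤ J := by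
    have := mul_pos ha h₁
    have := mul_pos hb0 hτ0
    rw [abs_le]; constructor <;> simp only [hm, hJ] <;> linarith
  have huQ : |u| ≤ Q := by
    rw [abs_le]
    constructor <;> simp only [hu, hQ] <;>
      linarith [sq_nonneg a, sq_nonneg l₁, sq_nonneg b, sq_nonneg τ]
  -- the terms linear in `sh`
  have t1 : 0 ≤ (J * Q * ch + C * (m * u)) * sh := by
    refine mul_nonneg ?_ hsh
    have h1 : |C * (m * u)| ≤ 1 * (J * Q) := by
      rw [abs_mul, abs_mul]
      gcongr
    have h2 : J * Q * 1 ≤ J * Q * ch := by gcongr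
    linarith [neg_abs_le (C * (m * u))]
  have t2 : 0 ≤ 2 * (J * sh) ^ 2 := by positivity
  have t3 : -(n * w * δ ^ 2) ≤ 2 * n * w * (C * ch - 1) := by
    have := mul_le_mul_of_nonneg_left hC' (mul_pos hn0 hw0).le
    linarith
  have t4 : S * n * u * sh ≤ l₁ * δ * n * U * (2 * (l₂ * δ)) := by
    have h1 : u ≤ U := (le_abs_self u).trans (huQ.trans hU)
    have hU0 : 0 ≤ U := hQ0.le.trans hU
    calc S * n * u * sh ≤ S * n * U * sh := by gcongr
      _ ≤ l₁ * δ * n * U * (2 * (l₂ * δ)) := by gcongr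
  have t5 : -(2 * (l₁ * δ) * (b * τ) * w * 2) ≤ 2 * S * m * w * ch := by
    have h1 : -(b * τ) ≤ m := by
      have := mul_pos h₁ ha
      simp only [hm]; linarith
    have h2 : S * (b * τ) * w * ch ≤ l₁ * δ * (b * τ) * w * 2 := by gcongr
    have h3 : S * w * ch * -(b * τ) ≤ S * w * ch * m := by gcongr
    linarith
  have e1 : mixedForm a b l₁ τ C S ch sh = 2 * (J * sh) ^ 2 + (J * Q * ch + C * (m * u)) * sh +
      4 * (l₁ * τ) * w + 2 * n * w * (C * ch - 1) - S * n * u * sh + 2 * S * m * w * ch := by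
    simp only [mixedForm, hJ, hm, hn, hw, hQ, hu]; ring
  have e2 : l₁ * δ * (b * τ) * w ≤ δ * c * r * (a * c - r) * (l₁ * l₂) ^ 2 := by
    rw [hw', hb, hτ]
    have : l₁ * l₂ ≤ 1 := mul_le_one₀ h₁' h₂.le h₂'
    calc l₁ * δ * (c * (l₁ * l₂) * (r * l₂)) * ((a * c - r) * (l₁ * l₂))
        = δ * c * r * (a * c - r) * (l₁ * l₂) ^ 2 * (l₁ * l₂) := by ring
      _ ≤ δ * c * r * (a * c - r) * (l₁ * l₂) ^ 2 * 1 := by gcongr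
      _ = _ := mul_one _
  have e3 : 0 < (l₁ * l₂) ^ 2 := by positivity
  have e4 := mul_lt_mul_of_pos_right hsmall e3
  have e5 : n * w * δ ^ 2 = (a * c + r) * (a * c - r) * δ ^ 2 * (l₁ * l₂) ^ 2 := by
    rw [hn', hw']; ring
  have e6 : l₁ * δ * n * U * (2 * (l₂ * δ)) = 2 * (a * c + r) * U * δ ^ 2 * (l₁ * l₂) ^ 2 := by
    rw [hn']; ring
  have e7 : 4 * (l₁ * τ) * w = 4 * r * (a * c - r) * (l₁ * l₂) ^ 2 := by
    rw [hw', hτ]; ring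
  rw [e1]
  linarith

theorem sinh_le_two_mul {x : ℝ} (h0 : 0 ≤ x) (h1 : x ≤ 1) : Real.sinh x ≤ 2 * x := by
  have h := Real.abs_exp_sub_one_le (x := x) (by rwa [abs_of_nonneg h0])
  rw [abs_of_nonneg h0] at h
  have h' := (abs_le.mp h).2
  have h'' := Real.add_one_le_exp (-x)
  rw [Real.sinh_eq]
  linarith

theorem cosh_le_two {x : ℝ} (h0 : 0 ≤ x) (h1 : x ≤ 1) : Real.cosh x ≤ 2 := by
  have h := Real.abs_exp_sub_one_le (x := x) (by rwa [abs_of_nonneg h0])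
  rw [abs_of_nonneg h0] at h
  have h' := (abs_le.mp h).2
  have h'' : Real.exp (-x) ≤ 1 := Real.exp_le_one_iff.mpr (by linarith)
  rw [Real.cosh_eq]
  linarith

theorem mixed_smallness {n W c r δ U B W₀ : ℝ} (hn : 0 < n) (hnB : n ≤ B)
    (hcr : c ≤ 4 + r) (hr : 0 < r) (hW0 : 0 < W₀) (hW : W₀ ≤ W) (hU : 0 < U) (hδ : 0 < δ)
    (d1 : δ < 1) (d2 : δ * B < r) (d3 : δ * (4 * (4 + r)) < 1) (d4 : δ * (2 * B * U) < r * W₀) :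
    n * W * δ ^ 2 + 2 * n * U * δ ^ 2 + 4 * δ * c * r * W < 4 * r * W := by
  have hWpos : 0 < W := hW0.trans_le hW
  have hB : 0 < B := hn.trans_le hnB
  have hδ2 : δ ^ 2 ≤ δ := by nlinarith
  have s1 : n * W * δ ^ 2 ≤ r * W := by
    calc n * W * δ ^ 2 ≤ B * W * δ := by gcongr
      _ = δ * B * W := by ring
      _ ≤ r * W := by gcongr
  have s2 : 2 * n * U * δ ^ 2 ≤ r * W := by
    calc 2 * n * U * δ ^ 2 ≤ 2 * B * U * δ := by gcongr
      _ = δ * (2 * B * U) := by ring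
      _ ≤ r * W₀ := d4.le
      _ ≤ r * W := by gcongr
  have s3 : 4 * δ * c * r * W ≤ r * W := by
    calc 4 * δ * c * r * W ≤ 4 * δ * (4 + r) * r * W := by gcongr
      _ = δ * (4 * (4 + r)) * (r * W) := by ring
      _ ≤ 1 * (r * W) := by gcongr
      _ = r * W := one_mul _
  have : 0 < r * W := by positivity
  linarith

/-- For small overlaps, the mixed regime is contracting uniformly up to both of its end points. -/
theorem exists_mixedForm_pos {r : ℝ} (hr : 1 < r) :
    ∃ δ₀ : ℝ, 0 < δ₀ ∧ ∀ δ, 0 < δ → δ < δ₀ → ∀ κ, 1 / r < κ → κ < 1 →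
      ∀ l₁ l₂ : ℝ, 0 < l₁ → 0 < l₂ → l₁ ^ 2 = 1 - κ ^ 2 → l₂ ^ 2 = κ ^ 2 - 1 / r ^ 2 →
      0 < mixedForm (coefA κ r) (coefC κ r * (l₁ * l₂)) l₁ (r * l₂) (Real.cos (l₁ * δ))
        (Real.sin (l₁ * δ)) (Real.cosh (l₂ * δ)) (Real.sinh (l₂ * δ)) := by
  have hr0 : 0 < r := by linarith
  set B := (1 + r) * (4 + r) + r with hB
  set U := (1 + r) ^ 2 + 1 + (4 + r) ^ 2 + r ^ 2 with hU
  set Z₀ := 4 / r ^ 2 - 2 + r with hZ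
  have hZ0 : 0 < Z₀ := by
    have : Z₀ = (4 + r ^ 2 * (r - 2)) / r ^ 2 := by rw [hZ]; field_simp; ring
    rw [this]
    refine div_pos ?_ (by positivity)
    nlinarith [sq_nonneg (r - 1), sq_nonneg (r - 4 / 3)]
  set W₀ := Z₀ ^ 2 / r ^ 2 with hW
  have hW0 : 0 < W₀ := by positivity
  have hBpos : 0 < B := by positivity
  have hUpos : 0 < U := by positivity
  refine ⟨min 1 (min (r / B) (min (1 / (4 * (4 + r))) (r * W₀ / (2 * B * U)))),
    by positivity, ?_⟩
  intro δ hδ hδ0 κ hκ1 hκ2 l₁ l₂ h₁ h₂ hl₁ hl₂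
  rw [lt_min_iff, lt_min_iff, lt_min_iff] at hδ0
  obtain ⟨d1, d2, d3, d4⟩ := hδ0
  have hκ0 : 0 < κ := lt_trans (by positivity) hκ1
  have hκsq : κ ^ 2 < 1 := by nlinarith
  have hκsq' : 1 / r ^ 2 < κ ^ 2 := by
    have := pow_lt_pow_left₀ hκ1 (by positivity) two_ne_zero
    rwa [div_pow, one_pow] at this
  have ha := coefA_pos hκ0 hr0
  have hc := coefC_pos (κ := κ) hr0
  have ha1 : coefA κ r ≤ 1 + r := by
    unfold coefA
    nlinarith [sq_nonneg κ, mul_nonneg (sq_nonneg κ) (by linarith : 0 ≤ 1 - κ ^ 2)]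
  have hc1 : coefC κ r ≤ 4 + r := by unfold coefC; linarith
  have hid := coupling_identity κ r
  have hWκ : W₀ ≤ coefA κ r * coefC κ r - r := by
    rw [hid, hW]
    have hz : Z₀ ≤ coupling κ r := by
      rw [hZ, coupling]
      have : 4 / r ^ 2 = 4 * (1 / r ^ 2) := by ring
      linarith
    calc Z₀ ^ 2 / r ^ 2 = 1 / r ^ 2 * Z₀ ^ 2 := by ring
      _ ≤ κ ^ 2 * coupling κ r ^ 2 := by gcongr
  have hl1 : l₁ ≤ 1 := by nlinarith [sq_nonneg κ]
  have hl2 : l₂ ≤ 1 := by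
    have : 0 < 1 / r ^ 2 := by positivity
    nlinarith
  have x1 : l₁ * δ ≤ 1 := mul_le_one₀ hl1 hδ.le d1.le
  have x2 : l₂ * δ ≤ 1 := mul_le_one₀ hl2 hδ.le d1.le
  have hcos : 1 - δ ^ 2 / 2 ≤ Real.cos (l₁ * δ) := by
    refine le_trans ?_ (Real.one_sub_sq_div_two_le_cos (x := l₁ * δ))
    have : (l₁ * δ) ^ 2 ≤ (1 * δ) ^ 2 := by gcongr
    linarith
  have hcos0 : 0 ≤ Real.cos (l₁ * δ) := by nlinarith
  have hch := Real.one_le_cosh (l₂ * δ)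
  have hab : coefA κ r * coefC κ r + r ≤ B := by rw [hB]; gcongr
  set W := coefA κ r * coefC κ r - r with hWdef
  refine mixedForm_pos (U := U) (δ := δ) ha hc hr0 h₁ hl1 h₂ hl2 ?_ (Real.abs_cos_le_one _) ?_ ?_ ?_
    hch (cosh_le_two (by positivity) x2) (Real.sinh_nonneg_iff.mpr (by positivity))
    (sinh_le_two_mul (by positivity) x2) hδ ?_ ?_
  · exact hW0.trans_le hWκ
  · exact hcos.trans (le_mul_of_one_le_right hcos0 hch)
  · exact Real.sin_nonneg_of_nonneg_of_le_pi (by positivity) (by linarith [Real.pi_gt_three])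
  · exact Real.sin_le (by positivity)
  · have k1 : coefC κ r * (l₁ * l₂) ≤ (4 + r) * 1 :=
      mul_le_mul hc1 (mul_le_one₀ hl1 h₂.le hl2) (by positivity) (by positivity)
    have k2 : r * l₂ ≤ r * 1 := by gcongr
    have m1 := pow_le_pow_left₀ ha.le ha1 2
    have m2 := pow_le_pow_left₀ h₁.le hl1 2
    have m3 := pow_le_pow_left₀ (by positivity) k1 2
    have m4 := pow_le_pow_left₀ (by positivity) k2 2
    rw [hU]
    linarith
  · rw [lt_div_iff₀ (by positivity)] at d2 d3 d4
    exact mixed_smallness (by positivity) hab hc1 hr0 hW0 hWκ hUpos hδ d1 d2 d3 d4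

/-! ### Monotonicity of some hyperbolic expressions -/

theorem sinh_le_mul_cosh {x : ℝ} (hx : 0 ≤ x) : Real.sinh x ≤ x * Real.cosh x := by
  have hd : ∀ x : ℝ, HasDerivAt (fun x => x * Real.cosh x - Real.sinh x) (x * Real.sinh x) x := by
    intro x
    refine (((hasDerivAt_id x).mul (Real.hasDerivAt_cosh x)).sub
      (Real.hasDerivAt_sinh x)).congr_deriv ?_
    simp
  have hm : MonotoneOn (fun x => x * Real.cosh x - Real.sinh x) (Set.Ici 0) := by
    refine monotoneOn_of_deriv_nonneg (convex_Ici 0)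
      (fun x _ => (hd x).continuousAt.continuousWithinAt)
      (fun x _ => (hd x).differentiableAt.differentiableWithinAt) fun x hx => ?_
    rw [interior_Ici, Set.mem_Ioi] at hx
    rw [(hd x).deriv]
    exact mul_nonneg hx.le (Real.sinh_nonneg_iff.mpr hx.le)
  have := hm (Set.mem_Ici.mpr le_rfl) (Set.mem_Ici.mpr hx) hx
  simp at this
  linarith

theorem mul_cosh_le {x : ℝ} (hx : 0 ≤ x) : x * Real.cosh x ≤ (1 + x ^ 2) * Real.sinh x := by
  have hd : ∀ x : ℝ, HasDerivAt (fun x => (1 + x ^ 2) * Real.sinh x - x * Real.cosh x)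
      (x * Real.sinh x + x ^ 2 * Real.cosh x) x := by
    intro x
    refine ((((hasDerivAt_pow 2 x).const_add 1).mul (Real.hasDerivAt_sinh x)).sub
      ((hasDerivAt_id x).mul (Real.hasDerivAt_cosh x))).congr_deriv ?_
    simp
    ring
  have hm : MonotoneOn (fun x => (1 + x ^ 2) * Real.sinh x - x * Real.cosh x) (Set.Ici 0) := by
    refine monotoneOn_of_deriv_nonneg (convex_Ici 0)
      (fun x _ => (hd x).continuousAt.continuousWithinAt)
      (fun x _ => (hd x).differentiableAt.differentiableWithinAt) fun x hx => ?_
    rw [interior_Ici, Set.mem_Ioi] at hx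
    rw [(hd x).deriv]
    have := Real.sinh_nonneg_iff.mpr hx.le
    have := Real.cosh_pos x
    positivity
  have := hm (Set.mem_Ici.mpr le_rfl) (Set.mem_Ici.mpr hx) hx
  simp at this
  linarith

theorem sinh_div_le_sinh_div {x y : ℝ} (hx : 0 < x) (hxy : x ≤ y) :
    Real.sinh x / x ≤ Real.sinh y / y := by
  have hm : MonotoneOn (fun x => Real.sinh x / x) (Set.Ioi 0) := by
    have hd : ∀ x : ℝ, x ≠ 0 → HasDerivAt (fun x => Real.sinh x / x)
        ((Real.cosh x * x - Real.sinh x * 1) / x ^ 2) x := fun x hx =>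
      (Real.hasDerivAt_sinh x).div (hasDerivAt_id x) hx
    refine monotoneOn_of_deriv_nonneg (convex_Ioi 0)
      (fun x hx => (hd x (ne_of_gt hx)).continuousAt.continuousWithinAt)
      (fun x hx => ?_) fun x hx => ?_ <;> rw [interior_Ioi] at hx <;> have hx' : 0 < x := hx
    · exact (hd x hx'.ne').differentiableAt.differentiableWithinAt
    · rw [(hd x hx'.ne').deriv]
      have := sinh_le_mul_cosh hx'.le
      exact div_nonneg (by linarith) (by positivity)
  exact hm hx (hx.trans_le hxy) hxy

/-- The growth of `sinh² x / x²` is compensated by the factor `x² + B` as long as `x² + B ≤ 1`. -/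
theorem mul_sq_div_sinh_sq_le {B x y : ℝ} (hB : 0 ≤ B) (hx : 0 < x) (hxy : x ≤ y)
    (hy : y ^ 2 + B ≤ 1) :
    (x ^ 2 + B) * x ^ 2 / Real.sinh x ^ 2 ≤ (y ^ 2 + B) * y ^ 2 / Real.sinh y ^ 2 := by
  have hd : ∀ z : ℝ, 0 < z → HasDerivAt (fun z => (z ^ 2 + B) * z ^ 2 / Real.sinh z ^ 2)
      (2 * z * Real.sinh z * ((2 * z ^ 2 + B) * Real.sinh z - (z ^ 2 + B) * (z * Real.cosh z)) /
        (Real.sinh z ^ 2) ^ 2) z := by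
    intro z hz
    have hs := Real.sinh_pos_iff.mpr hz
    refine (((((hasDerivAt_pow 2 z).add_const B).mul (hasDerivAt_pow 2 z))).div
      ((Real.hasDerivAt_sinh z).pow 2) (pow_ne_zero 2 hs.ne')).congr_deriv ?_
    simp
    ring
  have hm : MonotoneOn (fun z => (z ^ 2 + B) * z ^ 2 / Real.sinh z ^ 2) (Set.Icc x y) := by
    refine monotoneOn_of_deriv_nonneg (convex_Icc x y)
      (fun z hz => (hd z (hx.trans_le hz.1)).continuousAt.continuousWithinAt)
      (fun z hz => ?_) fun z hz => ?_ <;> rw [interior_Icc] at hz <;> have hz0 := hx.trans hz.1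
    · exact (hd z hz0).differentiableAt.differentiableWithinAt
    · rw [(hd z hz0).deriv]
      have hs := Real.sinh_pos_iff.mpr hz0
      have hzB : z ^ 2 + B ≤ 1 := by
        have := pow_le_pow_left₀ hz0.le hz.2.le 2
        linarith
      have h1 := mul_le_mul_of_nonneg_left (mul_cosh_le hz0.le) (by positivity : 0 ≤ z ^ 2 + B)
      have h2 : z ^ 2 * (z ^ 2 + B) * Real.sinh z ≤ z ^ 2 * 1 * Real.sinh z := by gcongr
      refine div_nonneg (mul_nonneg (by positivity) ?_) (by positivity)
      linarith
  exact hm (Set.left_mem_Icc.mpr hxy) (Set.right_mem_Icc.mpr hxy) hxy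

theorem div_cosh_sq_le {B x y : ℝ} (hx : 0 < x) (hxy : x ≤ y)
    (hy : y ^ 2 + B ≤ 1) :
    (x ^ 2 + B) / Real.cosh x ^ 2 ≤ (y ^ 2 + B) / Real.cosh y ^ 2 := by
  have hd : ∀ z : ℝ, HasDerivAt (fun z => (z ^ 2 + B) / Real.cosh z ^ 2)
      (2 * Real.cosh z * (z * Real.cosh z - (z ^ 2 + B) * Real.sinh z) /
        (Real.cosh z ^ 2) ^ 2) z := by
    intro z
    have hs := Real.cosh_pos z
    refine ((((hasDerivAt_pow 2 z).add_const B)).div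
      ((Real.hasDerivAt_cosh z).pow 2) (pow_ne_zero 2 hs.ne')).congr_deriv ?_
    simp
    ring
  have hm : MonotoneOn (fun z => (z ^ 2 + B) / Real.cosh z ^ 2) (Set.Icc x y) := by
    refine monotoneOn_of_deriv_nonneg (convex_Icc x y)
      (fun z hz => (hd z).continuousAt.continuousWithinAt)
      (fun z hz => (hd z).differentiableAt.differentiableWithinAt) fun z hz => ?_
    rw [interior_Icc] at hz
    have hz0 := hx.trans hz.1
    rw [(hd z).deriv]
    have hs := Real.sinh_pos_iff.mpr hz0
    have hc := Real.cosh_pos z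
    have hzB : z ^ 2 + B ≤ 1 := by
      have := pow_le_pow_left₀ hz0.le hz.2.le 2
      linarith
    have h1 := sinh_le_mul_cosh hz0.le
    have h2 : (z ^ 2 + B) * Real.sinh z ≤ 1 * Real.sinh z := by gcongr
    refine div_nonneg (mul_nonneg (by positivity) ?_) (by positivity)
    linarith
  exact hm (Set.left_mem_Icc.mpr hxy) (Set.right_mem_Icc.mpr hxy) hxy

theorem pow_add_pow_le {p t₁ s₁ t₂ s₂ : ℝ} (hs₁ : 0 < s₁) (hst : s₁ ≤ t₁) (h₁ : t₁ * s₁ = p)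
    (h₂ : t₂ * s₂ = p) (ht : t₁ ≤ t₂) (n : ℕ) : t₁ ^ n + s₁ ^ n ≤ t₂ ^ n + s₂ ^ n := by
  have ht₁ : 0 < t₁ := hs₁.trans_le hst
  have ht₂ : 0 < t₂ := ht₁.trans_le ht
  have e : t₁ ^ n * s₁ ^ n = t₂ ^ n * s₂ ^ n := by rw [← mul_pow, ← mul_pow, h₁, h₂]
  have h1 : t₁ ^ n ≤ t₂ ^ n := pow_le_pow_left₀ ht₁.le ht n
  have h2 : s₁ ^ n ≤ t₂ ^ n := pow_le_pow_left₀ hs₁.le (hst.trans ht) n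
  have h3 : 0 < t₂ ^ n := pow_pos ht₂ n
  have h4 : 0 ≤ t₂ ^ n * (t₂ ^ n + s₂ ^ n - t₁ ^ n - s₁ ^ n) := by
    have : t₂ ^ n * (t₂ ^ n + s₂ ^ n - t₁ ^ n - s₁ ^ n) =
        (t₂ ^ n - t₁ ^ n) * (t₂ ^ n - s₁ ^ n) := by
      linear_combination -e
    rw [this]
    exact mul_nonneg (by linarith) (by linarith)
  have := (mul_nonneg_iff_of_pos_left h3).mp h4
  linarith

/-- If the product `t s` is kept fixed and the larger factor `t` grows, then the divided differences
`(tⁿ - sⁿ) / (t - s)` grow. -/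
theorem pow_divided_difference_le {p t₁ s₁ t₂ s₂ : ℝ} (hs₁ : 0 < s₁) (hst₁ : s₁ < t₁)
    (hst₂ : s₂ < t₂) (h₁ : t₁ * s₁ = p) (h₂ : t₂ * s₂ = p) (ht : t₁ ≤ t₂) (n : ℕ) :
    (t₁ ^ n - s₁ ^ n) / (t₁ - s₁) ≤ (t₂ ^ n - s₂ ^ n) / (t₂ - s₂) := by
  have hp : 0 < p := by rw [← h₁]; exact mul_pos (hs₁.trans hst₁) hs₁
  have hrec : ∀ {t s : ℝ}, s < t → t * s = p → ∀ n : ℕ, (t ^ (n + 2) - s ^ (n + 2)) / (t - s) =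
      (t ^ (n + 1) + s ^ (n + 1)) + p * ((t ^ n - s ^ n) / (t - s)) := by
    intro t s hst h n
    have : t - s ≠ 0 := (sub_pos.mpr hst).ne'
    rw [← h]
    field_simp
    ring
  induction n using Nat.twoStepInduction with
  | zero => simp
  | one =>
    rw [pow_one, pow_one, pow_one, pow_one, div_self (sub_pos.mpr hst₁).ne',
      div_self (sub_pos.mpr hst₂).ne']
  | more n ih _ =>
    rw [hrec hst₁ h₁, hrec hst₂ h₂]
    exact add_le_add (pow_add_pow_le hs₁ hst₁.le h₁ h₂ ht _) (mul_le_mul_of_nonneg_left ih hp.le)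

theorem hasSum_sinh_sq_div (δ : ℝ) {v : ℝ} (hv : v ≠ 0) :
    HasSum (fun n : ℕ => (2 * δ) ^ (2 * n + 2) / (2 * (2 * n + 2).factorial) * (v ^ 2) ^ n)
      (Real.sinh (δ * v) ^ 2 / v ^ 2) := by
  have h := (hasSum_nat_add_iff' 1).mpr (Real.hasSum_cosh (2 * (δ * v)))
  have h2 : Real.cosh (2 * (δ * v)) - ∑ i ∈ Finset.range 1,
      (2 * (δ * v)) ^ (2 * i) / (2 * i).factorial = 2 * Real.sinh (δ * v) ^ 2 := by
    rw [Real.cosh_two_mul, Real.cosh_sq]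
    simp
    ring
  rw [h2] at h
  have h3 := h.div_const (2 * v ^ 2)
  rw [mul_div_mul_left _ _ two_ne_zero] at h3
  have e : (fun n : ℕ => (2 * δ) ^ (2 * n + 2) / (2 * (2 * n + 2).factorial) * (v ^ 2) ^ n) =
      fun n : ℕ => (2 * (δ * v)) ^ (2 * (n + 1)) / (2 * (n + 1)).factorial / (2 * v ^ 2) := by
    funext n
    rw [show 2 * (n + 1) = 2 * n + 2 by ring]
    field_simp
    ring
  rw [e]
  exact h3

theorem sinh_sq_divided_difference_le (δ : ℝ) {v₁ u₁ v₂ u₂ p : ℝ} (hu₁ : 0 < u₁) (hu₂ : 0 < u₂)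
    (h₁ : u₁ < v₁) (h₂ : u₂ < v₂) (hp₁ : v₁ * u₁ = p) (hp₂ : v₂ * u₂ = p) (hv : v₁ ≤ v₂) :
    (Real.sinh (δ * v₁) ^ 2 / v₁ ^ 2 - Real.sinh (δ * u₁) ^ 2 / u₁ ^ 2) / (v₁ ^ 2 - u₁ ^ 2) ≤
      (Real.sinh (δ * v₂) ^ 2 / v₂ ^ 2 - Real.sinh (δ * u₂) ^ 2 / u₂ ^ 2) / (v₂ ^ 2 - u₂ ^ 2) := by
  have hv₁ : 0 < v₁ := hu₁.trans h₁
  have hv₂ : 0 < v₂ := hu₂.trans h₂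
  refine hasSum_le (fun n => ?_)
    (((hasSum_sinh_sq_div δ hv₁.ne').sub (hasSum_sinh_sq_div δ hu₁.ne')).div_const _)
    (((hasSum_sinh_sq_div δ hv₂.ne').sub (hasSum_sinh_sq_div δ hu₂.ne')).div_const _)
  rw [← mul_sub, ← mul_sub, mul_div_assoc, mul_div_assoc]
  refine mul_le_mul_of_nonneg_left ?_
    (div_nonneg (Even.pow_nonneg ⟨n + 1, by ring⟩ _) (by positivity))
  exact pow_divided_difference_le (p := p ^ 2) (by positivity)
    (pow_lt_pow_left₀ h₁ hu₁.le two_ne_zero) (pow_lt_pow_left₀ h₂ hu₂.le two_ne_zero)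
    (by rw [← hp₁]; ring) (by rw [← hp₂]; ring) (pow_le_pow_left₀ hv₁.le hv 2) n

theorem sinh_mul_sinh_div_le (δ : ℝ) (hδ : 0 < δ) {v₁ u₁ v₂ u₂ p : ℝ} (hu₁ : 0 < u₁) (hu₂ : 0 < u₂)
    (h₁ : u₁ < v₁) (h₂ : u₂ < v₂) (hp₁ : v₁ * u₁ = p) (hp₂ : v₂ * u₂ = p) (hv : v₁ ≤ v₂) :
    (Real.sinh (δ * v₁) ^ 2 - Real.sinh (δ * u₁) ^ 2) / (v₁ ^ 2 - u₁ ^ 2) ≤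
      (Real.sinh (δ * v₂) ^ 2 - Real.sinh (δ * u₂) ^ 2) / (v₂ ^ 2 - u₂ ^ 2) := by
  have key : ∀ {v u : ℝ}, 0 < u → u < v → (Real.sinh (δ * v) ^ 2 - Real.sinh (δ * u) ^ 2) /
      (v ^ 2 - u ^ 2) = δ ^ 2 * (Real.sinh (δ * (v + u)) / (δ * (v + u)) *
        (Real.sinh (δ * (v - u)) / (δ * (v - u)))) := by
    intro v u hu huv
    have e1 : Real.sinh (δ * v) ^ 2 - Real.sinh (δ * u) ^ 2 =
        Real.sinh (δ * (v + u)) * Real.sinh (δ * (v - u)) := by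
      rw [mul_add, mul_sub, Real.sinh_add, Real.sinh_sub]
      linear_combination (-Real.sinh (δ * v) ^ 2) * Real.cosh_sq (δ * u) +
        Real.sinh (δ * u) ^ 2 * Real.cosh_sq (δ * v)
    have e2 : v ^ 2 - u ^ 2 = (v + u) * (v - u) := by ring
    have n1 : v + u ≠ 0 := by linarith
    have n2 : v - u ≠ 0 := by linarith
    rw [e1, e2]
    field_simp
  rw [key hu₁ h₁, key hu₂ h₂]
  have hv₁ : 0 < v₁ := hu₁.trans h₁
  have hu : u₂ ≤ u₁ := by
    by_contra! h
    nlinarith [mul_lt_mul_of_pos_left h hv₁, mul_le_mul_of_nonneg_right hv hu₂.le]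
  have hadd : v₁ + u₁ ≤ v₂ + u₂ := by
    simpa using pow_add_pow_le hu₁ h₁.le hp₁ hp₂ hv 1
  have m1 := sinh_div_le_sinh_div (mul_pos hδ (add_pos hv₁ hu₁))
    (mul_le_mul_of_nonneg_left hadd hδ.le)
  have m2 := sinh_div_le_sinh_div (mul_pos hδ (sub_pos.mpr h₁))
    (mul_le_mul_of_nonneg_left (by linarith : v₁ - u₁ ≤ v₂ - u₂) hδ.le)
  have pos : ∀ {x : ℝ}, 0 < x → 0 ≤ Real.sinh x / x := fun {x} hx =>
    div_nonneg (Real.sinh_nonneg_iff.mpr hx.le) hx.le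
  have q1 := pos (mul_pos hδ (sub_pos.mpr h₁))
  have q2 := (pos (mul_pos hδ (add_pos hv₁ hu₁))).trans m1
  gcongr

/-! ### The rational parts of the evanescent regime -/

/-- The squared wave number `κ²` in terms of `t = ((z₁ + z₂) / 2)²`, where
`p = (z₂² - z₁²) / 4 = (1 - 1 / r²) / 4`. -/
def waveSq (p t : ℝ) : ℝ := t + p ^ 2 / t + 1 - 2 * p

/-- The quantity `coefA + coefC z₁ z₂` in terms of `t`. -/
def rayleighSum (r p t : ℝ) : ℝ := 2 * (r + 4 * waveSq p t) * (t - p) + 1 + r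

/-- The quantity `√t |z₁ - r z₂|` in terms of `t`. -/
def speedGap (r p t : ℝ) : ℝ := (r - 1) * t + (r + 1) * p

section

variable {r p t β : ℝ}

theorem lt_one_fourth (hrp : r ^ 2 * (1 - 4 * p) = 1) : p < 1 / 4 := by
  by_contra! h
  nlinarith [sq_nonneg r, mul_nonneg (sq_nonneg r) (by linarith : 0 ≤ 4 * p - 1)]

theorem one_eighth_lt (hr2 : 2 < r ^ 2) (hrp : r ^ 2 * (1 - 4 * p) = 1) : 1 / 8 < p := by
  by_contra! h
  nlinarith [mul_le_mul_of_nonneg_left (by linarith : 1 / 2 ≤ 1 - 4 * p) (sq_nonneg r)]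

/-- With `p = (1 - 1 / r²) / 4`, this is `(r - 1)² ≥ 0`. -/
theorem one_le_mul_one_sub (hr : 1 < r) (hrp : r ^ 2 * (1 - 4 * p) = 1) : 1 ≤ r * (1 - 2 * p) := by
  have h : 2 * r * (r * (1 - 2 * p) - 1) = (r - 1) ^ 2 := by linear_combination hrp
  have : 0 ≤ 2 * r * (r * (1 - 2 * p) - 1) := by rw [h]; positivity
  have := (mul_nonneg_iff_of_pos_left (by linarith : 0 < 2 * r)).mp this
  linarith

theorem speedGap_coeff_le (hr : 1 < r) (hrp : r ^ 2 * (1 - 4 * p) = 1) :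
    (r + 1) * p ≤ (r - 1) * (1 - 2 * p) := by
  have h : 4 * r ^ 2 * ((r - 1) * (1 - 2 * p) - (r + 1) * p) = (r - 1) ^ 3 := by
    linear_combination (2 * (r - 1) + (r + 1)) * hrp
  have h0 : 0 < (r - 1) ^ 3 := pow_pos (by linarith) 3
  rw [← h] at h0
  have := (pos_iff_pos_of_mul_pos h0).mp (by positivity)
  linarith

theorem rayleigh_slack_pos (hr : 1 < r) (hr2 : 2 < r ^ 2) (hrp : r ^ 2 * (1 - 4 * p) = 1) :
    0 < 16 * p + 4 * p * r - 1 - r := by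
  have h : r ^ 2 * (16 * p + 4 * p * r - 1 - r) = (3 * r - 4) * (r + 1) := by
    linear_combination (-4 - r) * hrp
  have h0 : 0 < (3 * r - 4) * (r + 1) := mul_pos (by nlinarith) (by linarith)
  rw [← h] at h0
  exact (pos_iff_pos_of_mul_pos h0).mp (by positivity)

theorem sq_div_le (hp : 0 < p) (ht : p ≤ t) : p ^ 2 / t ≤ p := by
  rw [div_le_iff₀ (hp.trans_le ht)]; nlinarith

theorem one_le_waveSq (hp : 0 < p) (ht : p ≤ t) : 1 ≤ waveSq p t := by
  have h0 : 0 < t := hp.trans_le ht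
  have h : waveSq p t - 1 = (t - p) ^ 2 / t := by unfold waveSq; field_simp; ring
  have : 0 ≤ (t - p) ^ 2 / t := by positivity
  linarith

theorem waveSq_lt_waveSq {t' : ℝ} (hp : 0 < p) (ht : p ≤ t) (htt : t < t') :
    waveSq p t < waveSq p t' := by
  have h0 : 0 < t := hp.trans_le ht
  have h1 : 0 < t' := h0.trans htt
  have h : waveSq p t' - waveSq p t = (t' - t) * (t * t' - p ^ 2) / (t * t') := by
    unfold waveSq; field_simp; ring
  have h2 : 0 < t * t' - p ^ 2 := by nlinarith
  have : 0 < (t' - t) * (t * t' - p ^ 2) / (t * t') :=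
    div_pos (mul_pos (by linarith) h2) (by positivity)
  linarith

theorem hasDerivAt_waveSq (p : ℝ) (ht : t ≠ 0) : HasDerivAt (waveSq p) (1 - p ^ 2 / t ^ 2) t := by
  have h := (((hasDerivAt_id t).add ((hasDerivAt_const t (p ^ 2)).div
    (hasDerivAt_id t) ht)).add_const 1).sub_const (2 * p)
  refine h.congr_deriv ?_
  simp
  ring

theorem hasDerivAt_rayleighSum (r p : ℝ) (ht : t ≠ 0) : HasDerivAt (rayleighSum r p)
    (8 * (1 - p ^ 2 / t ^ 2) * (t - p) + 2 * (r + 4 * waveSq p t)) t := by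
  have h := ((((((hasDerivAt_waveSq p ht).const_mul 4).const_add r).const_mul 2).mul
    ((hasDerivAt_id t).sub_const p)).add_const 1).add_const r
  refine h.congr_deriv ?_
  simp only [id]
  ring

/-- A shift `β` for which `rayleighSum² / (t waveSq (t + β))` and `speedGap² / (waveSq (t + β))` are
increasing. -/
def shift (r p : ℝ) : ℝ :=
  4 + 4 * r + 2 * (1 + r + 2 * r * p) + (1 + r) * p / (16 * p + 4 * p * r - 1 - r) +
    (r + 1) * p / (r - 1)

theorem shift_spec (hr : 1 < r) (hr2 : 2 < r ^ 2) (hrp : r ^ 2 * (1 - 4 * p) = 1) :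
    4 ≤ shift r p ∧ 4 * r ≤ shift r p ∧ 2 * (1 + r + 2 * r * p) ≤ shift r p ∧
      (1 + r) * p ≤ shift r p * (16 * p + 4 * p * r - 1 - r) ∧
      (r + 1) * p ≤ shift r p * (r - 1) := by
  have hη := rayleigh_slack_pos hr hr2 hrp
  have hp := one_eighth_lt hr2 hrp
  have hr' : 0 < r - 1 := by linarith
  have hp0 : 0 < p := by linarith
  have a1 : 0 ≤ (1 + r) * p / (16 * p + 4 * p * r - 1 - r) := by positivity
  have a2 : 0 ≤ (r + 1) * p / (r - 1) := by positivity
  have a3 : 0 ≤ 2 * (1 + r + 2 * r * p) := by positivity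
  refine ⟨?_, ?_, ?_, ?_, ?_⟩
  · unfold shift; linarith
  · unfold shift; linarith
  · unfold shift; linarith
  · rw [← div_le_iff₀ hη]; unfold shift; linarith
  · rw [← div_le_iff₀ hr']; unfold shift; linarith

/-- The logarithmic derivative of `rayleighSum² / (t waveSq (t + β))` is nonnegative, cleared of
denominators. -/
theorem rayleighSum_deriv_ineq (hr : 1 < r) (hr2 : 2 < r ^ 2) (hrp : r ^ 2 * (1 - 4 * p) = 1)
    (ht : p ≤ t) (h4 : 4 ≤ β) (h4r : 4 * r ≤ β) (h2 : 2 * (1 + r + 2 * r * p) ≤ β)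
    (hη : (1 + r) * p ≤ β * (16 * p + 4 * p * r - 1 - r)) :
    rayleighSum r p t * (waveSq p t + (t - p ^ 2 / t)) * (t + β) +
        rayleighSum r p t * t * waveSq p t ≤
      2 * (8 * (t - p ^ 2 / t) * (t - p) + t * (2 * (r + 4 * waveSq p t))) *
        waveSq p t * (t + β) := by
  have hp8 := one_eighth_lt hr2 hrp
  have hp4 := lt_one_fourth hrp
  have hp0 : 0 < p := by linarith
  have ht0 : 0 < t := hp0.trans_le ht
  have hK1 := one_le_waveSq hp0 ht
  have hs := sq_div_le hp0 ht
  have hs0 : 0 < p ^ 2 / t := by positivity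
  have hts : t * (p ^ 2 / t) = p ^ 2 := by field_simp
  have hη0 := rayleigh_slack_pos hr hr2 hrp
  have hKdef : waveSq p t = t + p ^ 2 / t + 1 - 2 * p := rfl
  have hYdef : rayleighSum r p t = 2 * (r + 4 * waveSq p t) * (t - p) + 1 + r := rfl
  set K := waveSq p t
  set s := p ^ 2 / t
  obtain ⟨g, hg⟩ : ∃ g, g = t - p := ⟨_, rfl⟩
  have hg0 : 0 ≤ g := by linarith
  have hX0 : 0 ≤ t - s := by linarith
  have hX : (t - s) * t = g * (t + p) := by rw [hg]; linear_combination -hts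
  have hX2 : t - s ≤ 2 * g := by
    have : (t - s) * t ≤ 2 * g * t := by rw [hX]; nlinarith
    exact le_of_mul_le_mul_right this ht0
  have hXK : (2 * g + 1) * (t - s) ≤ 2 * g * K := by
    have e : (2 * g + 1) * (t + p) ≤ 2 * (t * K) := by
      rw [hKdef, hg]
      nlinarith [mul_nonneg (by linarith : 0 ≤ 1 - 4 * p) (by linarith : 0 ≤ t - p)]
    have : (2 * g + 1) * (t - s) * t ≤ 2 * g * K * t := by
      calc (2 * g + 1) * (t - s) * t = g * ((2 * g + 1) * (t + p)) := by
            linear_combination (2 * g + 1) * hX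
        _ ≤ g * (2 * (t * K)) := by gcongr
        _ = 2 * g * K * t := by ring
    exact le_of_mul_le_mul_right this ht0
  have hgK : g ≤ K := by linarith
  rw [← hg] at hYdef ⊢
  have htg : t = g + p := by linarith
  set X := t - s with hXdef
  set Y := rayleighSum r p t
  set η := 16 * p + 4 * p * r - 1 - r with hηdef
  have hr0 : 0 < r := by linarith
  -- the bound on `Y X` in which the slack `η` is left
  have step1 : K * (6 * K * g + η + 8 * X * g) ≤ 2 * (8 * X * g + t * (2 * (r + 4 * K))) * K -
      Y * (K + X) := by
    have b1 : r * ((2 * g + 1) * X) ≤ r * (2 * g * K) := by gcongr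
    have b2 : X ≤ 2 * g * K := hX2.trans (le_mul_of_one_le_right (by linarith) hK1)
    have b3 : 0 ≤ 16 * p * K * (K - 1) := by
      have := sub_nonneg.mpr hK1
      positivity
    have b4 : 0 ≤ 2 * g * K * (K - 1) := by
      have := sub_nonneg.mpr hK1
      positivity
    rw [hYdef, htg, hηdef]
    linarith
  have step2 : Y * t ≤ (t + β) * (6 * K * g + η + 8 * X * g) := by
    have c1 : 0 ≤ t * η := by positivity
    have c2 : 2 * r * g ^ 2 + (1 + r + 2 * r * p) * g ≤ β * K * g := by
      have d1 : 2 * r * g ≤ β / 2 * g := by gcongr; linarith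
      have d2 : β / 2 * (g + 1 - p) ≤ β / 2 * K := by
        gcongr
        linarith
      have d3 : β * g ≤ β * K := by gcongr
      have d4 : 1 + r + 2 * r * p ≤ β / 2 * K := by
        calc 1 + r + 2 * r * p ≤ β / 2 * 1 := by linarith
          _ ≤ β / 2 * K := by gcongr
      have d5 : 2 * r * g + (1 + r + 2 * r * p) ≤ β * K := by linarith
      calc 2 * r * g ^ 2 + (1 + r + 2 * r * p) * g
          = (2 * r * g + (1 + r + 2 * r * p)) * g := by ring
        _ ≤ β * K * g := by gcongr
    have c3 : 2 * K * t * g ≤ (5 * β * K + 8 * X * t) * g := by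
      refine mul_le_mul_of_nonneg_right ?_ hg0
      rcases le_total t β with h | h
      · have : K * t ≤ K * β := by gcongr
        have : 0 ≤ 8 * X * t := by positivity
        nlinarith
      · have : 2 * K ≤ 8 * X := by linarith
        have : 2 * K * t ≤ 8 * X * t := by gcongr
        have : 0 ≤ 5 * β * K := by positivity
        linarith
    have c4 : 0 ≤ β * (8 * X * g) := by positivity
    have e : Y * t = 8 * K * g * t + 2 * r * g ^ 2 + (1 + r + 2 * r * p) * g + (1 + r) * p := by
      rw [hYdef, htg]; ring
    rw [e]
    linarith
  have hβ : 0 < t + β := by linarith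
  have f1 := mul_le_mul_of_nonneg_right step1 hβ.le
  have f2 := mul_le_mul_of_nonneg_right step2 (by linarith : 0 ≤ K)
  linarith

theorem rayleighSum_sq_div_mono (hr : 1 < r) (hr2 : 2 < r ^ 2) (hrp : r ^ 2 * (1 - 4 * p) = 1)
    {t' : ℝ} (ht : p ≤ t) (htt : t ≤ t') :
    rayleighSum r p t ^ 2 / (t * waveSq p t * (t + shift r p)) ≤
      rayleighSum r p t' ^ 2 / (t' * waveSq p t' * (t' + shift r p)) := by
  obtain ⟨h4, h4r, h2, hη, -⟩ := shift_spec hr hr2 hrp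
  have hp8 := one_eighth_lt hr2 hrp
  have hp0 : 0 < p := by linarith
  generalize shift r p = β at *
  have hden : ∀ x, p ≤ x → 0 < x * waveSq p x * (x + β) := fun x hx => by
    have := one_le_waveSq hp0 hx
    have : 0 < x := hp0.trans_le hx
    have : 0 < x + β := by linarith
    positivity
  have hd : ∀ x, p ≤ x → HasDerivAt
      (fun t => rayleighSum r p t ^ 2 / (t * waveSq p t * (t + β)))
      ((2 * rayleighSum r p x * (8 * (1 - p ^ 2 / x ^ 2) * (x - p) + 2 * (r + 4 * waveSq p x)) *
          (x * waveSq p x * (x + β)) - rayleighSum r p x ^ 2 *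
          ((waveSq p x + x * (1 - p ^ 2 / x ^ 2)) * (x + β) + x * waveSq p x)) /
        (x * waveSq p x * (x + β)) ^ 2) x := by
    intro x hx
    have hx0 : x ≠ 0 := (hp0.trans_le hx).ne'
    refine (((hasDerivAt_rayleighSum r p hx0).pow 2).div
      (((hasDerivAt_id x).mul (hasDerivAt_waveSq p hx0)).mul ((hasDerivAt_id x).add_const β))
      (hden x hx).ne').congr_deriv ?_
    simp
  have hm : MonotoneOn (fun t => rayleighSum r p t ^ 2 / (t * waveSq p t * (t + β)))
      (Set.Icc t t') := by
    refine monotoneOn_of_deriv_nonneg (convex_Icc t t')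
      (fun x hx => (hd x (ht.trans hx.1)).continuousAt.continuousWithinAt)
      (fun x hx => ?_) fun x hx => ?_ <;> rw [interior_Icc] at hx <;>
      have hx' : p ≤ x := ht.trans hx.1.le
    · exact (hd x hx').differentiableAt.differentiableWithinAt
    · rw [(hd x hx').deriv]
      refine div_nonneg ?_ (sq_nonneg _)
      have hx0 : 0 < x := hp0.trans_le hx'
      have key := rayleighSum_deriv_ineq hr hr2 hrp hx' h4 h4r h2 hη
      have hY : 0 ≤ rayleighSum r p x := by
        have := one_le_waveSq hp0 hx'
        have : 0 ≤ x - p := by linarith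
        unfold rayleighSum; positivity
      have e : x * (1 - p ^ 2 / x ^ 2) = x - p ^ 2 / x := by field_simp
      have := mul_le_mul_of_nonneg_left key hY
      have e2 : 2 * rayleighSum r p x * (8 * (1 - p ^ 2 / x ^ 2) * (x - p) +
          2 * (r + 4 * waveSq p x)) * (x * waveSq p x * (x + β)) =
          rayleighSum r p x * (2 * (8 * (x * (1 - p ^ 2 / x ^ 2)) * (x - p) +
            x * (2 * (r + 4 * waveSq p x))) * waveSq p x * (x + β)) := by ring
      rw [e2, e]
      linarith
  exact hm (Set.left_mem_Icc.mpr htt) (Set.right_mem_Icc.mpr htt) htt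

theorem speedGap_sq_div_mono (hr : 1 < r) (hr2 : 2 < r ^ 2) (hrp : r ^ 2 * (1 - 4 * p) = 1)
    {t' : ℝ} (ht : p ≤ t) (htt : t ≤ t') :
    speedGap r p t ^ 2 / (waveSq p t * (t + shift r p)) ≤
      speedGap r p t' ^ 2 / (waveSq p t' * (t' + shift r p)) := by
  obtain ⟨h4, -, -, -, h5⟩ := shift_spec hr hr2 hrp
  have hp8 := one_eighth_lt hr2 hrp
  have hp0 : 0 < p := by linarith
  have hc := speedGap_coeff_le hr hrp
  generalize shift r p = β at *
  have ht0 : 0 < t := hp0.trans_le ht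
  have ht0' : 0 < t' := ht0.trans_le htt
  have hK := one_le_waveSq hp0 ht
  have hK' := one_le_waveSq hp0 (ht.trans htt)
  have hr' : 0 < r - 1 := by linarith
  have hQ : 0 < speedGap r p t := by unfold speedGap; positivity
  have hQ' : 0 < speedGap r p t' := by unfold speedGap; positivity
  have hs : p ^ 2 / t' ≤ p ^ 2 / t := by gcongr
  have hs0 : 0 < p ^ 2 / t' := by positivity
  have m1 : speedGap r p t / waveSq p t ≤ speedGap r p t' / waveSq p t' := by
    rw [div_le_div_iff₀ (by linarith) (by linarith)]
    have a1 : (t' - t) * ((r + 1) * p) ≤ (t' - t) * ((r - 1) * (1 - 2 * p)) :=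
      mul_le_mul_of_nonneg_left hc (by linarith)
    have a2 : 0 ≤ (r - 1) * (t' * (p ^ 2 / t) - t * (p ^ 2 / t')) := by
      refine mul_nonneg hr'.le (sub_nonneg.mpr ?_)
      gcongr
    have a3 : 0 ≤ (r + 1) * p * (p ^ 2 / t - p ^ 2 / t') :=
      mul_nonneg (by positivity) (by linarith)
    unfold speedGap waveSq
    linarith
  have m2 : speedGap r p t / (t + β) ≤ speedGap r p t' / (t' + β) := by
    rw [div_le_div_iff₀ (by linarith) (by linarith)]
    have a1 : (t' - t) * ((r + 1) * p) ≤ (t' - t) * (β * (r - 1)) :=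
      mul_le_mul_of_nonneg_left h5 (by linarith)
    unfold speedGap
    linarith
  have e : ∀ x, speedGap r p x ^ 2 / (waveSq p x * (x + β)) =
      speedGap r p x / waveSq p x * (speedGap r p x / (x + β)) := fun x => by
    rw [div_mul_div_comm, sq]
  rw [e, e]
  have : 0 ≤ speedGap r p t' / waveSq p t' := div_nonneg hQ'.le (by linarith)
  have : 0 ≤ speedGap r p t / (t + β) := div_nonneg hQ.le (by linarith)
  gcongr

/-- What the overlap has to make up for: the Schur–Cohn expression is a positive multiple of the
difference of a quantity that tends to zero with the overlap and of `deficit`. -/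
def deficit (r p t : ℝ) : ℝ :=
  (16 * p * (1 + r) - 2 * r) * waveSq p t - 2 - 2 * r * (t - p ^ 2 / t)

theorem deficit_div_strictAnti (hr : 1 < r) (hr2 : 2 < r ^ 2) (hrp : r ^ 2 * (1 - 4 * p) = 1)
    {t' : ℝ} (ht : p ≤ t) (htt : t < t') :
    deficit r p t' / waveSq p t' < deficit r p t / waveSq p t := by
  have hp8 := one_eighth_lt hr2 hrp
  have hp0 : 0 < p := by linarith
  have ht0 : 0 < t := hp0.trans_le ht
  have ht0' : 0 < t' := ht0.trans htt
  have hK := one_le_waveSq hp0 ht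
  have hK' := one_le_waveSq hp0 (ht.trans htt.le)
  have hs : p ^ 2 / t' < p ^ 2 / t := div_lt_div_of_pos_left (by positivity) ht0 htt
  have hm := one_le_mul_one_sub hr hrp
  rw [div_lt_div_iff₀ (by linarith) (by linarith)]
  have a1 : 0 ≤ (t' - t + (p ^ 2 / t - p ^ 2 / t')) * (r * (1 - 2 * p) - 1) :=
    mul_nonneg (by linarith) (by linarith)
  have a2 : 0 ≤ r * (t' * (p ^ 2 / t) - t * (p ^ 2 / t')) := by
    refine mul_nonneg (by linarith) (sub_nonneg.mpr ?_)
    gcongr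
  unfold deficit waveSq
  linarith

end

/-! ### The crossing in the evanescent regime -/

/-- The stabilizing effect of the overlap `δ`, as a function of `v = (z₁ + z₂) / 2`: the mode with
`κ² = waveSq p (v²)` is damped if and only if `gain` exceeds `deficit`. Note that
`p / v = (z₂ - z₁) / 2`. -/
def gain (r p δ v : ℝ) : ℝ :=
  p ^ 2 * rayleighSum r p (v ^ 2) ^ 2 / Real.sinh (δ * v) ^ 2 *
      ((Real.sinh (δ * v) ^ 2 / v ^ 2 - Real.sinh (δ * (p / v)) ^ 2 / (p / v) ^ 2) /
        (v ^ 2 - (p / v) ^ 2)) +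
    speedGap r p (v ^ 2) ^ 2 / Real.cosh (δ * v) ^ 2 *
      ((Real.sinh (δ * v) ^ 2 - Real.sinh (δ * (p / v)) ^ 2) / (v ^ 2 - (p / v) ^ 2))

section

variable {r p δ v : ℝ}

theorem div_lt_of_lt_sq (hv : 0 < v) (hpv : p < v ^ 2) : p / v < v := by
  rw [div_lt_iff₀ hv]; nlinarith

/-- The Schur–Cohn expression in the variable `v = (z₁ + z₂) / 2`; the identity `hE` below
computes what remains after the cancellation of the leading terms, the `deficit`. -/
theorem evanescentForm_eq {κ z₁ z₂ : ℝ} (hp : 0 < p) (hrp : r ^ 2 * (1 - 4 * p) = 1) (hδ : 0 < δ)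
    (hv : 0 < v) (hpv : p < v ^ 2) (hκ : κ ^ 2 = waveSq p (v ^ 2)) (hz₁ : z₁ = v - p / v)
    (hz₂ : z₂ = v + p / v) :
    evanescentForm κ r z₁ z₂ (v * δ) (p / v * δ) =
      Real.sinh (δ * v) ^ 2 * Real.cosh (δ * v) ^ 2 * ((v ^ 2 - (p / v) ^ 2) / v ^ 2) *
        (gain r p δ v - deficit r p (v ^ 2)) := by
  have hu := div_lt_of_lt_sq hv hpv
  have hu0 : 0 < p / v := by positivity
  have hkc : κ ^ 2 * coupling κ r ^ 2 = coefA κ r * coefC κ r - r := (coupling_identity κ r).symm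
  have hpu : p = v * (p / v) := by field_simp
  have hK : κ ^ 2 = v ^ 2 + (p / v) ^ 2 + 1 - 2 * p := by
    rw [hκ, waveSq]; field_simp
  have hY : coefA κ r + coefC κ r * (z₁ * z₂) = rayleighSum r p (v ^ 2) := by
    rw [rayleighSum, ← hκ, coefA, coefC, hz₁, hz₂, hK]
    generalize p / v = u at *
    subst hpu
    ring
  have hQ : (z₁ - r * z₂) ^ 2 * v ^ 2 = speedGap r p (v ^ 2) ^ 2 := by
    rw [speedGap, hz₁, hz₂]
    generalize p / v = u at *
    subst hpu
    ring
  have hE : 4 * v ^ 2 * (κ ^ 2 * coupling κ r ^ 2) =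
      rayleighSum r p (v ^ 2) ^ 2 + deficit r p (v ^ 2) := by
    have hdef : deficit r p (v ^ 2) = (16 * p * (1 + r) - 2 * r) * κ ^ 2 - 2 -
        2 * r * (v ^ 2 - (p / v) ^ 2) := by
      rw [deficit, hκ]; field_simp
    rw [hdef, ← hY, hkc, coefA, coefC, hz₁, hz₂, hK]
    generalize p / v = u at *
    subst hpu
    linear_combination -hrp
  have hs : 0 < Real.sinh (δ * v) := Real.sinh_pos_iff.mpr (by positivity)
  have hc : 0 < Real.cosh (δ * v) := Real.cosh_pos _
  have hvu : 0 < v ^ 2 - (p / v) ^ 2 := by nlinarith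
  have hzz : z₁ * z₂ = v ^ 2 - (p / v) ^ 2 := by rw [hz₁, hz₂]; ring
  have hp2 : p ^ 2 = v ^ 2 * (p / v) ^ 2 := by field_simp
  unfold evanescentForm gain
  rw [hY, hzz, mul_comm v δ, mul_comm (p / v) δ, hp2]
  have hQ' : (z₁ - r * z₂) ^ 2 = speedGap r p (v ^ 2) ^ 2 / v ^ 2 := by
    rw [← hQ]; field_simp
  have hE' : κ ^ 2 * coupling κ r ^ 2 =
      (rayleighSum r p (v ^ 2) ^ 2 + deficit r p (v ^ 2)) / (4 * v ^ 2) := by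
    rw [← hE]; field_simp
  rw [hQ', hE']
  generalize rayleighSum r p (v ^ 2) = Y
  generalize speedGap r p (v ^ 2) = Q
  generalize deficit r p (v ^ 2) = E
  generalize Real.sinh (δ * (p / v)) = a
  generalize p / v = u at *
  generalize Real.sinh (δ * v) = b at *
  generalize Real.cosh (δ * v) = c at *
  have hvu' : v ^ 2 - u ^ 2 ≠ 0 := hvu.ne'
  field_simp
  ring

/-- `gain / waveSq` is a sum of products of positive increasing functions as long as
`δ² (v² + shift) ≤ 1`. -/
theorem gain_div_waveSq_le {v' : ℝ} (hr : 1 < r) (hr2 : 2 < r ^ 2)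
    (hrp : r ^ 2 * (1 - 4 * p) = 1) (hδ : 0 < δ) (hv : 0 < v) (hpv : p < v ^ 2) (hvv : v ≤ v')
    (hδv : δ ^ 2 * (v' ^ 2 + shift r p) ≤ 1) :
    gain r p δ v / waveSq p (v ^ 2) ≤ gain r p δ v' / waveSq p (v' ^ 2) := by
  have hp0 : 0 < p := by linarith [one_eighth_lt hr2 hrp]
  have hv' : 0 < v' := hv.trans_le hvv
  have htt : v ^ 2 ≤ v' ^ 2 := pow_le_pow_left₀ hv.le hvv 2
  have hpv' : p < v' ^ 2 := hpv.trans_le htt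
  have hβ : 4 ≤ shift r p := (shift_spec hr hr2 hrp).1
  have m1 := rayleighSum_sq_div_mono hr hr2 hrp hpv.le htt
  have m2 := speedGap_sq_div_mono hr hr2 hrp hpv.le htt
  have hx : (δ * v') ^ 2 + δ ^ 2 * shift r p ≤ 1 := by linarith
  have m3 := mul_sq_div_sinh_sq_le (B := δ ^ 2 * shift r p) (by positivity) (mul_pos hδ hv)
    (mul_le_mul_of_nonneg_left hvv hδ.le) hx
  have m4 := div_cosh_sq_le (B := δ ^ 2 * shift r p) (mul_pos hδ hv)
    (mul_le_mul_of_nonneg_left hvv hδ.le) hx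
  have hu := div_lt_of_lt_sq hv hpv
  have hu' := div_lt_of_lt_sq hv' hpv'
  have hu0 : 0 < p / v := by positivity
  have hu0' : 0 < p / v' := by positivity
  have m5 := sinh_sq_divided_difference_le δ hu0 hu0' hu hu' (mul_div_cancel₀ p hv.ne')
    (mul_div_cancel₀ p hv'.ne') hvv
  have m6 := sinh_mul_sinh_div_le δ hδ hu0 hu0' hu hu' (mul_div_cancel₀ p hv.ne')
    (mul_div_cancel₀ p hv'.ne') hvv
  have key : ∀ {w : ℝ}, 0 < w → p < w ^ 2 → gain r p δ w / waveSq p (w ^ 2) =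
      p ^ 2 / δ ^ 4 * (rayleighSum r p (w ^ 2) ^ 2 /
          (w ^ 2 * waveSq p (w ^ 2) * (w ^ 2 + shift r p)) *
        (((δ * w) ^ 2 + δ ^ 2 * shift r p) * (δ * w) ^ 2 / Real.sinh (δ * w) ^ 2) *
        ((Real.sinh (δ * w) ^ 2 / w ^ 2 - Real.sinh (δ * (p / w)) ^ 2 / (p / w) ^ 2) /
          (w ^ 2 - (p / w) ^ 2))) +
      1 / δ ^ 2 * (speedGap r p (w ^ 2) ^ 2 / (waveSq p (w ^ 2) * (w ^ 2 + shift r p)) *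
        (((δ * w) ^ 2 + δ ^ 2 * shift r p) / Real.cosh (δ * w) ^ 2) *
        ((Real.sinh (δ * w) ^ 2 - Real.sinh (δ * (p / w)) ^ 2) / (w ^ 2 - (p / w) ^ 2))) := by
    intro w hw hpw
    have hs : 0 < Real.sinh (δ * w) := Real.sinh_pos_iff.mpr (by positivity)
    have hc : 0 < Real.cosh (δ * w) := Real.cosh_pos _
    have hK : 0 < waveSq p (w ^ 2) := by linarith [one_le_waveSq hp0 hpw.le]
    have hb : 0 < w ^ 2 + shift r p := by positivity
    unfold gain
    generalize (Real.sinh (δ * w) ^ 2 / w ^ 2 - Real.sinh (δ * (p / w)) ^ 2 / (p / w) ^ 2) /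
          (w ^ 2 - (p / w) ^ 2) = D₁
    generalize (Real.sinh (δ * w) ^ 2 - Real.sinh (δ * (p / w)) ^ 2) / (w ^ 2 - (p / w) ^ 2) = D₂
    generalize rayleighSum r p (w ^ 2) = Y
    generalize speedGap r p (w ^ 2) = Q
    generalize Real.sinh (δ * w) = b at *
    generalize Real.cosh (δ * w) = c at *
    generalize waveSq p (w ^ 2) = K at *
    generalize shift r p = β at *
    field_simp
  have hK : 0 < waveSq p (v ^ 2) := by linarith [one_le_waveSq hp0 hpv.le]
  have hK' : 0 < waveSq p (v' ^ 2) := by linarith [one_le_waveSq hp0 hpv'.le]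
  have sq_mono : ∀ {x y : ℝ}, 0 < x → x < y → Real.sinh (δ * x) / x ≤ Real.sinh (δ * y) / y :=
    fun {x y} hx hxy => by
    have := sinh_div_le_sinh_div (mul_pos hδ hx) (mul_le_mul_of_nonneg_left hxy.le hδ.le)
    have hy := hx.trans hxy
    rw [div_le_div_iff₀ (by positivity) (by positivity)] at this ⊢
    have h2 : δ * (Real.sinh (δ * x) * y) ≤ δ * (Real.sinh (δ * y) * x) := by linarith
    exact le_of_mul_le_mul_left h2 hδ
  have p1 : 0 ≤ (Real.sinh (δ * v) ^ 2 / v ^ 2 - Real.sinh (δ * (p / v)) ^ 2 / (p / v) ^ 2) /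
          (v ^ 2 - (p / v) ^ 2) := by
    refine div_nonneg (sub_nonneg.mpr ?_) (by nlinarith)
    rw [← div_pow, ← div_pow]
    exact pow_le_pow_left₀ (div_nonneg (Real.sinh_nonneg_iff.mpr (by positivity)) hu0.le)
      (sq_mono hu0 hu) 2
  have p2 : 0 ≤ (Real.sinh (δ * v) ^ 2 - Real.sinh (δ * (p / v)) ^ 2) / (v ^ 2 - (p / v) ^ 2) := by
    refine div_nonneg (sub_nonneg.mpr ?_) (by nlinarith)
    refine pow_le_pow_left₀ (Real.sinh_nonneg_iff.mpr (by positivity)) ?_ 2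
    exact Real.sinh_le_sinh.mpr (mul_le_mul_of_nonneg_left hu.le hδ.le)
  rw [key hv hpv, key hv' hpv']
  gcongr

/-- For a fixed wave number, the effect of the overlap is of second order in `δ`. -/
theorem gain_le_mul_sq (hp : 0 < p) (hδ : 0 < δ) (hv : 0 < v) (hpv : p < v ^ 2)
    (hδv : δ ^ 2 * v ^ 2 ≤ 1) :
    gain r p δ v ≤ δ ^ 2 * ((2 * p ^ 2 * rayleighSum r p (v ^ 2) ^ 2 +
      speedGap r p (v ^ 2) ^ 2 * v ^ 2) / (v ^ 2 - (p / v) ^ 2)) := by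
  have hu := div_lt_of_lt_sq hv hpv
  have hu0 : 0 < p / v := by positivity
  have hvu : 0 < v ^ 2 - (p / v) ^ 2 := by nlinarith
  have hχ : 0 < δ * v := by positivity
  have hs : δ * v ≤ Real.sinh (δ * v) := Real.self_le_sinh_iff.mpr hχ.le
  have hs' := sinh_le_mul_cosh hχ.le
  have hζ : δ * (p / v) ≤ Real.sinh (δ * (p / v)) := Real.self_le_sinh_iff.mpr (by positivity)
  have hc : 0 < Real.cosh (δ * v) := Real.cosh_pos _
  have hs0 : 0 < Real.sinh (δ * v) := hχ.trans_le hs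
  -- `sinh² χ ≤ χ² cosh² χ ≤ χ² exp (χ²) ≤ χ² (1 + 2 χ²)`
  have hc2 : Real.cosh (δ * v) ^ 2 ≤ 1 + 2 * (δ ^ 2 * v ^ 2) := by
    have h1 : Real.cosh (δ * v) ^ 2 ≤ Real.exp (δ ^ 2 * v ^ 2) := by
      refine (pow_le_pow_left₀ hc.le (Real.cosh_le_exp_half_sq (δ * v)) 2).trans_eq ?_
      rw [← Real.exp_nat_mul]
      congr 1
      push_cast
      ring
    have h2 := Real.abs_exp_sub_one_le (x := δ ^ 2 * v ^ 2) (by rwa [abs_of_nonneg (by positivity)])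
    rw [abs_of_nonneg (by positivity : 0 ≤ δ ^ 2 * v ^ 2)] at h2
    linarith [(abs_le.mp h2).2]
  have hs2 : Real.sinh (δ * v) ^ 2 ≤ (δ * v) ^ 2 * (1 + 2 * (δ ^ 2 * v ^ 2)) := by
    calc Real.sinh (δ * v) ^ 2 ≤ (δ * v * Real.cosh (δ * v)) ^ 2 := by gcongr
      _ = (δ * v) ^ 2 * Real.cosh (δ * v) ^ 2 := by ring
      _ ≤ _ := by gcongr
  have a1 : Real.sinh (δ * v) ^ 2 / v ^ 2 - Real.sinh (δ * (p / v)) ^ 2 / (p / v) ^ 2 ≤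
      2 * δ ^ 4 * v ^ 2 := by
    have b1 : Real.sinh (δ * v) ^ 2 / v ^ 2 ≤ δ ^ 2 * (1 + 2 * (δ ^ 2 * v ^ 2)) := by
      rw [div_le_iff₀ (by positivity)]
      linarith
    have b2 : δ ^ 2 ≤ Real.sinh (δ * (p / v)) ^ 2 / (p / v) ^ 2 := by
      rw [le_div_iff₀ (by positivity), ← mul_pow]
      gcongr
    linarith
  have t1 : p ^ 2 * rayleighSum r p (v ^ 2) ^ 2 / Real.sinh (δ * v) ^ 2 *
      ((Real.sinh (δ * v) ^ 2 / v ^ 2 - Real.sinh (δ * (p / v)) ^ 2 / (p / v) ^ 2) /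
        (v ^ 2 - (p / v) ^ 2)) ≤ p ^ 2 * rayleighSum r p (v ^ 2) ^ 2 / (δ * v) ^ 2 *
          (2 * δ ^ 4 * v ^ 2 / (v ^ 2 - (p / v) ^ 2)) := by
    calc _ ≤ p ^ 2 * rayleighSum r p (v ^ 2) ^ 2 / Real.sinh (δ * v) ^ 2 *
          (2 * δ ^ 4 * v ^ 2 / (v ^ 2 - (p / v) ^ 2)) := by gcongr
      _ ≤ _ := by gcongr
  have t2 : speedGap r p (v ^ 2) ^ 2 / Real.cosh (δ * v) ^ 2 *
      ((Real.sinh (δ * v) ^ 2 - Real.sinh (δ * (p / v)) ^ 2) / (v ^ 2 - (p / v) ^ 2)) ≤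
      speedGap r p (v ^ 2) ^ 2 / Real.cosh (δ * v) ^ 2 *
        ((δ * v * Real.cosh (δ * v)) ^ 2 / (v ^ 2 - (p / v) ^ 2)) := by
    gcongr
    refine (sub_le_self _ (sq_nonneg _)).trans ?_
    gcongr
  refine (add_le_add t1 t2).trans_eq ?_
  generalize v ^ 2 - (p / v) ^ 2 = d at *
  field_simp

/-- For `χ = δ v` bounded below, the overlap wins: `gain` is of the order `t²`, where `t = v²` is at
least of the order `1 / δ²`, whereas `deficit` is only of the order `t`. -/
theorem deficit_lt_gain (hr : 1 < r) (hr2 : 2 < r ^ 2) (hrp : r ^ 2 * (1 - 4 * p) = 1) (hδ : 0 < δ)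
    (hδ1 : δ < 1 / 2) (hδ2 : δ ^ 2 * (2176 * (1 + r)) < 1) (hv : 0 < v)
    (hδv : 1 / 2 ≤ δ ^ 2 * v ^ 2) : deficit r p (v ^ 2) < gain r p δ v := by
  have hp8 := one_eighth_lt hr2 hrp
  have hp4 := lt_one_fourth hrp
  have hp : 0 < p := by linarith
  have ht : 1088 * (1 + r) < v ^ 2 := by
    have : δ ^ 2 * (1088 * (1 + r)) < δ ^ 2 * v ^ 2 := by linarith
    exact lt_of_mul_lt_mul_left this (by positivity)
  have hpv : p < v ^ 2 := by linarith
  have hu := div_lt_of_lt_sq hv hpv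
  have hu0 : 0 < p / v := by positivity
  have hvu : 0 < v ^ 2 - (p / v) ^ 2 := by nlinarith
  have hχ : 0 < δ * v := by positivity
  have hζ : 0 < δ * (p / v) := by positivity
  have hs0 : 0 < Real.sinh (δ * v) := Real.sinh_pos_iff.mpr hχ
  -- `sinh² χ = 4 sinh² (χ / 2) (1 + sinh² (χ / 2)) ≥ χ² (1 + χ² / 4) ≥ (9 / 8) χ²`
  have f1 : 9 / 8 * (δ * v) ^ 2 ≤ Real.sinh (δ * v) ^ 2 := by
    have e : Real.sinh (δ * v) = 2 * Real.sinh (δ * v / 2) * Real.cosh (δ * v / 2) := by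
      rw [← Real.sinh_two_mul]; congr 1; ring
    have g1 : δ * v / 2 ≤ Real.sinh (δ * v / 2) := Real.self_le_sinh_iff.mpr (by positivity)
    have g2 : (δ * v / 2) ^ 2 ≤ Real.sinh (δ * v / 2) ^ 2 := by gcongr
    have g3 : 9 / 8 ≤ Real.cosh (δ * v / 2) ^ 2 := by rw [Real.cosh_sq]; linarith
    rw [e]
    have := mul_le_mul g2 g3 (by norm_num) (sq_nonneg _)
    linarith
  have hζ2 : (δ * (p / v)) ^ 2 ≤ 1 / 32 := by
    have h1 : δ ^ 4 ≤ (1 / 2) ^ 4 := by gcongr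
    have h2 : p ^ 2 ≤ (1 / 4) ^ 2 := by gcongr
    have h3 : (δ * (p / v)) ^ 2 * (δ ^ 2 * v ^ 2) = δ ^ 4 * p ^ 2 := by field_simp
    have h4 : δ ^ 4 * p ^ 2 ≤ (1 / 2) ^ 4 * (1 / 4) ^ 2 := by gcongr
    nlinarith [sq_nonneg (δ * (p / v))]
  have f2 : Real.sinh (δ * (p / v)) ^ 2 ≤ 17 / 16 * (δ * (p / v)) ^ 2 := by
    have h1 := pow_le_pow_left₀ (Real.sinh_nonneg_iff.mpr hζ.le) (sinh_le_mul_cosh hζ.le) 2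
    have h2 : Real.cosh (δ * (p / v)) ^ 2 ≤ Real.exp ((δ * (p / v)) ^ 2) := by
      refine (pow_le_pow_left₀ (Real.cosh_pos _).le (Real.cosh_le_exp_half_sq _) 2).trans_eq ?_
      rw [← Real.exp_nat_mul]
      congr 1
      push_cast
      ring
    have h3 := Real.abs_exp_sub_one_le (x := (δ * (p / v)) ^ 2)
      (by rw [abs_of_nonneg (by positivity)]; linarith)
    rw [abs_of_nonneg (by positivity : 0 ≤ (δ * (p / v)) ^ 2)] at h3
    have h4 : Real.cosh (δ * (p / v)) ^ 2 ≤ 17 / 16 := by linarith [(abs_le.mp h3).2]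
    calc _ ≤ _ := h1
      _ = Real.cosh (δ * (p / v)) ^ 2 * (δ * (p / v)) ^ 2 := by ring
      _ ≤ _ := by gcongr
  have a1 : 1 / 18 * (Real.sinh (δ * v) ^ 2 / v ^ 2) ≤
      Real.sinh (δ * v) ^ 2 / v ^ 2 - Real.sinh (δ * (p / v)) ^ 2 / (p / v) ^ 2 := by
    have b1 : 9 / 8 * δ ^ 2 ≤ Real.sinh (δ * v) ^ 2 / v ^ 2 := by
      rw [le_div_iff₀ (by positivity)]
      linarith
    have b2 : Real.sinh (δ * (p / v)) ^ 2 / (p / v) ^ 2 ≤ 17 / 16 * δ ^ 2 := by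
      rw [div_le_iff₀ (by positivity)]
      linarith
    linarith
  have hK1 : v ^ 2 ≤ waveSq p (v ^ 2) := by
    have : 0 < p ^ 2 / v ^ 2 := by positivity
    unfold waveSq; linarith
  have hK2 : waveSq p (v ^ 2) ≤ 2 * v ^ 2 := by
    have := sq_div_le hp hpv.le
    unfold waveSq; linarith
  have hY : 4 * (v ^ 2) ^ 2 ≤ rayleighSum r p (v ^ 2) := by
    have h1 : 4 * v ^ 2 ≤ r + 4 * waveSq p (v ^ 2) := by linarith
    have h2 : v ^ 2 / 2 ≤ v ^ 2 - p := by linarith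
    have h3 := mul_le_mul h1 h2 (by positivity) (by linarith [sq_nonneg v])
    unfold rayleighSum
    linarith
  have t1 : (v ^ 2) ^ 2 / 72 ≤ p ^ 2 * rayleighSum r p (v ^ 2) ^ 2 / Real.sinh (δ * v) ^ 2 *
      ((Real.sinh (δ * v) ^ 2 / v ^ 2 - Real.sinh (δ * (p / v)) ^ 2 / (p / v) ^ 2) /
        (v ^ 2 - (p / v) ^ 2)) := by
    calc (v ^ 2) ^ 2 / 72
        = (1 / 8) ^ 2 * (4 * (v ^ 2) ^ 2) ^ 2 / Real.sinh (δ * v) ^ 2 *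
          (1 / 18 * (Real.sinh (δ * v) ^ 2 / v ^ 2) / v ^ 2) := by field_simp; norm_num
      _ ≤ p ^ 2 * rayleighSum r p (v ^ 2) ^ 2 / Real.sinh (δ * v) ^ 2 *
          ((Real.sinh (δ * v) ^ 2 / v ^ 2 - Real.sinh (δ * (p / v)) ^ 2 / (p / v) ^ 2) /
            (v ^ 2 - (p / v) ^ 2)) := by
        have hd : v ^ 2 - (p / v) ^ 2 ≤ v ^ 2 := sub_le_self _ (sq_nonneg _)
        gcongr
        exact (by positivity : 0 ≤ 1 / 18 * (Real.sinh (δ * v) ^ 2 / v ^ 2)).trans a1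
  have t2 : 0 ≤ speedGap r p (v ^ 2) ^ 2 / Real.cosh (δ * v) ^ 2 *
      ((Real.sinh (δ * v) ^ 2 - Real.sinh (δ * (p / v)) ^ 2) / (v ^ 2 - (p / v) ^ 2)) := by
    refine mul_nonneg (by positivity) (div_nonneg (sub_nonneg.mpr ?_) hvu.le)
    refine pow_le_pow_left₀ (Real.sinh_nonneg_iff.mpr hζ.le) ?_ 2
    exact Real.sinh_le_sinh.mpr (mul_le_mul_of_nonneg_left hu.le hδ.le)
  have hE : deficit r p (v ^ 2) ≤ 8 * (1 + r) * v ^ 2 := by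
    have h1 : p ^ 2 / v ^ 2 ≤ v ^ 2 := (sq_div_le hp hpv.le).trans hpv.le
    have h2 : 0 ≤ r * (v ^ 2 - p ^ 2 / v ^ 2) := mul_nonneg (by linarith) (by linarith)
    have hK0 : 0 ≤ waveSq p (v ^ 2) := (sq_nonneg v).trans hK1
    have h3 : p * ((1 + r) * waveSq p (v ^ 2)) ≤ 1 / 4 * ((1 + r) * (2 * v ^ 2)) := by gcongr
    have h4 : 0 ≤ r * waveSq p (v ^ 2) := mul_nonneg (by linarith) (by linarith [sq_nonneg v])
    unfold deficit
    linarith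
  have : 8 * (1 + r) * v ^ 2 < (v ^ 2) ^ 2 / 72 := by nlinarith
  unfold gain
  linarith

theorem continuousAt_gain_sub_deficit (hp : 0 < p) (hδ : 0 < δ) (hv : 0 < v) (hpv : p < v ^ 2) :
    ContinuousAt (fun v => gain r p δ v - deficit r p (v ^ 2)) v := by
  have hu := div_lt_of_lt_sq hv hpv
  have hu0 : 0 < p / v := by positivity
  have hvu : v ^ 2 - (p / v) ^ 2 ≠ 0 := by nlinarith
  have hs : Real.sinh (δ * v) ≠ 0 := (Real.sinh_pos_iff.mpr (by positivity)).ne'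
  have hc : Real.cosh (δ * v) ≠ 0 := (Real.cosh_pos _).ne'
  unfold gain deficit rayleighSum speedGap waveSq
  fun_prop (disch := first | assumption | positivity)

/-- For small overlaps, `gain` crosses `deficit` exactly once. The quotient `gain / waveSq` is
increasing up to wave numbers of the order `1 / δ`, beyond which `gain` is the larger one, and
`deficit / waveSq` is strictly decreasing. -/
theorem exists_crossing (hr : 1 < r) (hr2 : 2 < r ^ 2) (hrp : r ^ 2 * (1 - 4 * p) = 1) :
    ∃ δ₀ : ℝ, 0 < δ₀ ∧ ∀ δ, 0 < δ → δ < δ₀ → ∃ w, 0 < w ∧ p < w ^ 2 ∧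
      gain r p δ w = deficit r p (w ^ 2) ∧
      (∀ v, 0 < v → p < v ^ 2 → v < w → gain r p δ v < deficit r p (v ^ 2)) ∧
      ∀ v, w < v → deficit r p (v ^ 2) < gain r p δ v := by
  have hp8 := one_eighth_lt hr2 hrp
  have hp : 0 < p := by linarith
  -- just above the cut-off `κ = 1`, which is `t = p`, the deficit is positive; this uses `r² > 2`
  obtain ⟨t₁, ht₁, hE⟩ : ∃ t, p < t ∧ 0 < deficit r p t := by
    have h0 : 0 < deficit r p p := by
      have : deficit r p p = (1 + r) * (16 * p - 2) := by
        unfold deficit waveSq; field_simp; ring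
      rw [this]
      exact mul_pos (by linarith) (by linarith)
    have hc : ContinuousAt (deficit r p) p := by
      unfold deficit waveSq
      fun_prop (disch := exact hp.ne')
    have h1 := (hc.eventually (lt_mem_nhds h0)).filter_mono
      (nhdsWithin_le_nhds (s := Set.Ioi p))
    obtain ⟨t, h2, h3⟩ := (h1.and self_mem_nhdsWithin).exists
    exact ⟨t, h3, h2⟩
  have ht₁0 : 0 < t₁ := hp.trans ht₁
  obtain ⟨v₁, hv₁, rfl⟩ : ∃ v, 0 < v ∧ v ^ 2 = t₁ :=
    ⟨√t₁, Real.sqrt_pos.mpr ht₁0, Real.sq_sqrt ht₁0.le⟩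
  have hβ : 4 ≤ shift r p := (shift_spec hr hr2 hrp).1
  obtain ⟨C, hC⟩ : ∃ C, C = (2 * p ^ 2 * rayleighSum r p (v₁ ^ 2) ^ 2 +
      speedGap r p (v₁ ^ 2) ^ 2 * v₁ ^ 2) / (v₁ ^ 2 - (p / v₁) ^ 2) := ⟨_, rfl⟩
  have hC0 : 0 ≤ C := by
    have hu := div_lt_of_lt_sq hv₁ ht₁
    have hu0 : 0 < p / v₁ := by positivity
    have : 0 < v₁ ^ 2 - (p / v₁) ^ 2 := by nlinarith
    rw [hC]; positivity
  refine ⟨min (1 / 2) (min (1 / (2176 * (1 + r))) (min (1 / (2 * (v₁ ^ 2 + shift r p)))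
    (deficit r p (v₁ ^ 2) / (C + 1)))), by positivity, ?_⟩
  intro δ hδ hδ₀
  rw [lt_min_iff, lt_min_iff, lt_min_iff, lt_div_iff₀ (by positivity), lt_div_iff₀ (by positivity),
    lt_div_iff₀ (by positivity), lt_div_iff₀ (by positivity)] at hδ₀
  obtain ⟨d1, d2, d3, d4⟩ := hδ₀
  have d1' : δ < 1 / 2 := by linarith
  have hδ2 : δ ^ 2 ≤ δ := by nlinarith
  have hsq : 0 < δ ^ 2 := by positivity
  have d2' : δ ^ 2 * (2176 * (1 + r)) < 1 := by
    refine lt_of_le_of_lt ?_ d2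
    gcongr
  have d3' : δ ^ 2 * (v₁ ^ 2 + shift r p) < 1 / 2 := by
    have : δ ^ 2 * (v₁ ^ 2 + shift r p) ≤ δ * (v₁ ^ 2 + shift r p) := by gcongr
    linarith
  have hδβ : δ ^ 2 * shift r p < 1 / 2 := by
    have : 0 ≤ δ ^ 2 * v₁ ^ 2 := by positivity
    linarith
  have hδv₁ : δ ^ 2 * v₁ ^ 2 < 1 / 2 := by
    have : 0 ≤ δ ^ 2 * shift r p := by positivity
    linarith
  have large : ∀ v, 0 < v → 1 ≤ δ ^ 2 * (v ^ 2 + shift r p) →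
      deficit r p (v ^ 2) < gain r p δ v := fun v hv h =>
    deficit_lt_gain hr hr2 hrp hδ d1' d2' hv (by linarith)
  obtain ⟨v₂, hv₂, hv₂'⟩ : ∃ v, 0 < v ∧ δ ^ 2 * (v ^ 2 + shift r p) = 1 := by
    have h : 0 < 1 / δ ^ 2 - shift r p := by
      rw [sub_pos, lt_div_iff₀ hsq]; linarith
    refine ⟨√(1 / δ ^ 2 - shift r p), Real.sqrt_pos.mpr h, ?_⟩
    rw [Real.sq_sqrt h.le]
    field_simp
    ring
  have h12 : v₁ ≤ v₂ := by
    refine (pow_le_pow_iff_left₀ hv₁.le hv₂.le two_ne_zero).mp ?_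
    refine le_of_mul_le_mul_left (?_ : δ ^ 2 * v₁ ^ 2 ≤ δ ^ 2 * v₂ ^ 2) hsq
    linarith
  have lo : gain r p δ v₁ - deficit r p (v₁ ^ 2) < 0 := by
    have h := gain_le_mul_sq (r := r) hp hδ hv₁ ht₁ (by linarith)
    rw [← hC] at h
    have : δ ^ 2 * C ≤ δ * C := by gcongr
    linarith
  have hi := large v₂ hv₂ hv₂'.ge
  have gt_p : ∀ {v}, v₁ ≤ v → p < v ^ 2 := fun {v} h =>
    ht₁.trans_le (pow_le_pow_left₀ hv₁.le h 2)
  obtain ⟨w, hw, hw0⟩ := intermediate_value_Icc h12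
    (fun v hv => (continuousAt_gain_sub_deficit (r := r) hp hδ (hv₁.trans_le hv.1)
      (gt_p hv.1)).continuousWithinAt) (show (0 : ℝ) ∈ Set.Icc _ _ from ⟨lo.le, by linarith⟩)
  have hw_pos : 0 < w := hv₁.trans_le hw.1
  have hpw := gt_p hw.1
  have hgw : gain r p δ w = deficit r p (w ^ 2) := sub_eq_zero.mp hw0
  have hδw : ∀ {v}, 0 < v → v ≤ v₂ → δ ^ 2 * (v ^ 2 + shift r p) ≤ 1 := fun {v} hv h => by
    rw [← hv₂']; gcongr
  refine ⟨w, hw_pos, hpw, hgw, fun v hv hpv hvw => ?_, fun v hwv => ?_⟩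
  · have hK : 0 < waveSq p (v ^ 2) := by linarith [one_le_waveSq hp hpv.le]
    have h1 := gain_div_waveSq_le hr hr2 hrp hδ hv hpv hvw.le (hδw hw_pos hw.2)
    have h2 := deficit_div_strictAnti hr hr2 hrp hpv.le (pow_lt_pow_left₀ hvw hv.le two_ne_zero)
    rw [hgw] at h1
    exact (div_lt_div_iff_of_pos_right hK).mp (h1.trans_lt h2)
  · have hv : 0 < v := hw_pos.trans hwv
    have hpv : p < v ^ 2 := gt_p (hw.1.trans hwv.le)
    rcases le_total v v₂ with h | h
    · have hK : 0 < waveSq p (v ^ 2) := by linarith [one_le_waveSq hp hpv.le]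
      have h1 := gain_div_waveSq_le hr hr2 hrp hδ hw_pos hpw hwv.le (hδw hv h)
      have h2 := deficit_div_strictAnti hr hr2 hrp hpw.le
        (pow_lt_pow_left₀ hwv hw_pos.le two_ne_zero)
      rw [hgw] at h1
      exact (div_lt_div_iff_of_pos_right hK).mp (h2.trans_le h1)
    · refine large v hv ?_
      rw [← hv₂']; gcongr

end

/-! ### The behaviour of the iteration in the three regimes -/

theorem rootC_of_nonneg {t : ℝ} (ht : 0 ≤ t) : rootC t = (√t : ℝ) := if_pos ht

theorem rootC_of_neg {t : ℝ} (ht : t < 0) : rootC t = Complex.I * (√(-t) : ℝ) := if_neg ht.not_ge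

section

variable {m : Material} {ω k g κ r δ : ℝ}

theorem exp_neg_I_mul (g l δ : ℝ) : Complex.exp (-(g * (Complex.I * l) * δ)) =
    (Real.cos (l * (g * δ)) : ℝ) - Complex.I * (Real.sin (l * (g * δ)) : ℝ) := by
  have h : -((g : ℂ) * (Complex.I * l) * δ) = ((-(l * (g * δ)) : ℝ) : ℂ) * Complex.I := by
    push_cast; ring
  rw [h, Complex.exp_mul_I, ← Complex.ofReal_cos, ← Complex.ofReal_sin, Real.cos_neg, Real.sin_neg]
  push_cast
  ring

theorem exp_neg_ofReal (g z δ : ℝ) :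
    Complex.exp (-((g : ℂ) * z * δ)) = (Real.exp (-(z * (g * δ))) : ℝ) := by
  rw [Complex.ofReal_exp]
  congr 1
  push_cast
  ring

theorem unimodular_cos_sub_I_mul_sin (θ : ℝ) :
    ((Real.cos θ : ℝ) - Complex.I * (Real.sin θ : ℝ) : ℂ) *
      (starRingEnd ℂ) ((Real.cos θ : ℝ) - Complex.I * (Real.sin θ : ℝ) : ℂ) = 1 := by
  have h : ((Real.cos θ : ℝ) : ℂ) ^ 2 + ((Real.sin θ : ℝ) : ℂ) ^ 2 = 1 := by
    exact_mod_cast Real.cos_sq_add_sin_sq θ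
  simp only [map_sub, map_mul, Complex.conj_ofReal, Complex.conj_I]
  linear_combination h - ((Real.sin θ : ℝ) : ℂ) ^ 2 * Complex.I_sq

/-- Propagating shear and pressure waves. -/
theorem behaviour_of_propagating {l₁ l₂ : ℝ}
    (h : IsScaling m ω k g κ r (Complex.I * l₁) (Complex.I * l₂)) (h₁ : 0 < l₁) (h₂ : 0 < l₂) :
    WellPosed m ω δ k (taylorSymbol m ω) (taylorSymbol m ω) ∧ Converges m ω δ k := by
  obtain ⟨hD, hΔ, hS⟩ := schurCohn_pos_of_propagating h.κ_pos (zero_lt_one.trans h.one_lt) h₁ h₂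
    (unimodular_cos_sub_I_mul_sin (l₁ * (g * δ))) (unimodular_cos_sub_I_mul_sin (l₂ * (g * δ)))
  have hA : (traceMatrix κ r 1 (Complex.I * l₁) (Complex.I * l₂)).det ≠ 0 := by
    rw [det_traceMatrix]; exact neg_ne_zero.mpr hD
  have hM := isIterationMatrix_iterationMatrix g κ r δ hD
  rw [exp_neg_I_mul, exp_neg_I_mul] at hM
  have hz : (κ : ℂ) ^ 2 - Complex.I * l₁ * (Complex.I * l₂) ≠ 0 := by
    have e : (κ : ℂ) ^ 2 - Complex.I * l₁ * (Complex.I * l₂) = ((κ ^ 2 + l₁ * l₂ : ℝ) : ℂ) := by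
      push_cast; linear_combination (-(l₁ : ℂ) * l₂) * Complex.I_sq
    have := h.κ_pos
    rw [e]
    exact_mod_cast (by positivity : κ ^ 2 + l₁ * l₂ ≠ 0)
  exact ⟨wellPosed_of_det_ne_zero h hA, (behaviour_of_schurCohn h hA hz hM hΔ).1 hS⟩

/-- Propagating shear waves and evanescent pressure waves, including both end points. -/
theorem behaviour_of_mixed {l₁ l₂ : ℝ} (h : IsScaling m ω k g κ r (Complex.I * l₁) l₂)
    (h₁ : 0 ≤ l₁) (h₂ : 0 ≤ l₂) (hl : 0 < l₁ ∨ 0 < l₂) (hδ : 0 < δ) :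
    WellPosed m ω δ k (taylorSymbol m ω) (taylorSymbol m ω) ∧
    (0 < mixedForm (coefA κ r) (coefC κ r * (l₁ * l₂)) l₁ (r * l₂) (Real.cos (l₁ * (g * δ)))
      (Real.sin (l₁ * (g * δ))) (Real.cosh (l₂ * (g * δ))) (Real.sinh (l₂ * (g * δ))) →
      Converges m ω δ k) ∧
    (mixedForm (coefA κ r) (coefC κ r * (l₁ * l₂)) l₁ (r * l₂) (Real.cos (l₁ * (g * δ)))
      (Real.sin (l₁ * (g * δ))) (Real.cosh (l₂ * (g * δ))) (Real.sinh (l₂ * (g * δ))) = 0 →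
      Stagnates m ω δ k) := by
  have hg := h.g_pos
  have hκ := h.κ_pos
  obtain ⟨hD, hΔ, q, hq, hS⟩ := schurCohn_mixed hκ (zero_lt_one.trans h.one_lt) h₁ h₂
    (Real.cos_sq_add_sin_sq (l₁ * (g * δ))) (Real.cosh_sq_sub_sinh_sq (l₂ * (g * δ)))
    (by rw [Real.cosh_sub_sinh]; positivity) (Real.sinh_nonneg_iff.mpr (by positivity))
    (hl.imp id fun hl => Real.sinh_pos_iff.mpr (by positivity))
  have hA : (traceMatrix κ r 1 (Complex.I * l₁) l₂).det ≠ 0 := by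
    rw [det_traceMatrix]; exact neg_ne_zero.mpr hD
  have hM := isIterationMatrix_iterationMatrix g κ r δ hD
  rw [exp_neg_I_mul, exp_neg_ofReal, ← Real.cosh_sub_sinh, Complex.ofReal_sub] at hM
  have hz : (κ : ℂ) ^ 2 - Complex.I * l₁ * l₂ ≠ 0 := by
    intro h0
    have := congrArg Complex.re h0
    simp [← Complex.ofReal_pow] at this
    exact hκ.ne' this
  obtain ⟨b1, b2, -⟩ := behaviour_of_schurCohn h hA hz hM hΔ
  rw [hS] at b1 b2
  exact ⟨wellPosed_of_det_ne_zero h hA, fun h0 => b1 (mul_pos hq h0),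
    fun h0 => b2 (by rw [h0, mul_zero])⟩

/-- Evanescent shear and pressure waves. -/
theorem behaviour_of_evanescent {z₁ z₂ : ℝ} (h : IsScaling m ω k g κ r z₁ z₂)
    (h₁ : 0 < z₁) (h₂ : 0 < z₂) (hδ : 0 < δ) :
    WellPosed m ω δ k (taylorSymbol m ω) (taylorSymbol m ω) ∧
    (0 < evanescentForm κ r z₁ z₂ ((z₁ + z₂) / 2 * (g * δ)) ((z₂ - z₁) / 2 * (g * δ)) →
      Converges m ω δ k) ∧
    (evanescentForm κ r z₁ z₂ ((z₁ + z₂) / 2 * (g * δ)) ((z₂ - z₁) / 2 * (g * δ)) = 0 →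
      Stagnates m ω δ k) ∧
    (evanescentForm κ r z₁ z₂ ((z₁ + z₂) / 2 * (g * δ)) ((z₂ - z₁) / 2 * (g * δ)) < 0 →
      Diverges m ω δ k) := by
  have hg := h.g_pos
  have hr := h.one_lt
  obtain ⟨hD, hΔ, q, hq, hS⟩ := schurCohn_evanescent (κ := κ) (zero_lt_one.trans hr) h₁ h₂
    (mul_pos hg hδ)
  have hA : (traceMatrix κ r 1 z₁ z₂).det ≠ 0 := by
    rw [det_traceMatrix]; exact neg_ne_zero.mpr hD
  have hM := isIterationMatrix_iterationMatrix g κ r δ hD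
  rw [exp_neg_ofReal, exp_neg_ofReal] at hM
  have hz : (κ : ℂ) ^ 2 - z₁ * z₂ ≠ 0 := by
    have e₁ : z₁ ^ 2 = κ ^ 2 - 1 := by exact_mod_cast h.sq₁
    have e₂ : z₂ ^ 2 = κ ^ 2 - 1 / r ^ 2 := by exact_mod_cast h.sq₂
    have : 0 < 1 / r ^ 2 := by positivity
    have : 0 < κ ^ 2 - z₁ * z₂ := by nlinarith [sq_nonneg (z₁ - z₂)]
    exact_mod_cast this.ne'
  obtain ⟨b1, b2, b3⟩ := behaviour_of_schurCohn h hA hz hM hΔ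
  rw [hS] at b1 b2 b3
  exact ⟨wellPosed_of_det_ne_zero h hA, fun h0 => b1 (mul_pos hq h0),
    fun h0 => b2 (by rw [h0, mul_zero]), fun h0 => b3 (mul_neg_of_pos_of_neg hq h0)⟩

end

/-- In the evanescent regime, half the sum `v` of the exponents determines the wave number. -/
theorem exists_half_sum {κ r p : ℝ} (hr : 1 < r) (hp : 0 < p) (hrp : r ^ 2 * (1 - 4 * p) = 1)
    (hκ : 1 < κ ^ 2) : ∃ v, 0 < v ∧ p < v ^ 2 ∧ κ ^ 2 = waveSq p (v ^ 2) ∧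
      √(κ ^ 2 - 1) = v - p / v ∧ √(κ ^ 2 - 1 / r ^ 2) = v + p / v := by
  have hq : 1 / r ^ 2 = 1 - 4 * p := by
    rw [div_eq_iff (by positivity)]; linarith
  have a1 : 0 < κ ^ 2 - 1 := by linarith
  have a2 : 0 < κ ^ 2 - 1 / r ^ 2 := by rw [hq]; linarith
  have s1 := Real.sq_sqrt a1.le
  have s2 := Real.sq_sqrt a2.le
  have p1 := Real.sqrt_pos.mpr a1
  have p2 := Real.sqrt_pos.mpr a2
  rw [hq] at s2 p2 ⊢
  generalize √(κ ^ 2 - 1) = z₁ at *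
  generalize √(κ ^ 2 - (1 - 4 * p)) = z₂ at *
  obtain ⟨v, hv⟩ : ∃ v, v = (z₁ + z₂) / 2 := ⟨_, rfl⟩
  have hv0 : 0 < v := by rw [hv]; positivity
  have hu : p / v = (z₂ - z₁) / 2 := by
    rw [div_eq_iff hv0.ne', hv]; linear_combination (s1 - s2) / 4
  have hvu : p = v * ((z₂ - z₁) / 2) := by rw [← hu]; field_simp
  refine ⟨v, hv0, ?_, ?_, ?_, ?_⟩
  · rw [hvu, sq]
    exact mul_lt_mul_of_pos_left (by rw [hv]; linarith) hv0
  · have e : p ^ 2 / v ^ 2 = ((z₂ - z₁) / 2) ^ 2 := by rw [← div_pow, hu]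
    rw [waveSq, e, hv]
    linear_combination -s1 / 2 - s2 / 2
  · rw [hu, hv]; ring
  · rw [hu, hv]; ring

/-- The wave number `κ = κ*` at which the iteration stops diverging. -/
theorem exists_critical_wave_number {r : ℝ} (hr : 1 < r) (hr2 : 2 < r ^ 2) :
    ∃ δ₀ : ℝ, 0 < δ₀ ∧ ∀ δ, 0 < δ → δ < δ₀ → ∃ κs, 1 < κs ∧ ∀ κ, 1 < κ →
      ∀ z₁ z₂ : ℝ, z₁ = √(κ ^ 2 - 1) → z₂ = √(κ ^ 2 - 1 / r ^ 2) →
        (κs < κ → 0 < evanescentForm κ r z₁ z₂ ((z₁ + z₂) / 2 * δ) ((z₂ - z₁) / 2 * δ)) ∧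
        (κ = κs → evanescentForm κ r z₁ z₂ ((z₁ + z₂) / 2 * δ) ((z₂ - z₁) / 2 * δ) = 0) ∧
        (κ < κs → evanescentForm κ r z₁ z₂ ((z₁ + z₂) / 2 * δ) ((z₂ - z₁) / 2 * δ) < 0) := by
  obtain ⟨p, hp⟩ : ∃ p, p = (1 - 1 / r ^ 2) / 4 := ⟨_, rfl⟩
  have hrp : r ^ 2 * (1 - 4 * p) = 1 := by rw [hp]; field_simp; ring
  have hp0 : 0 < p := by linarith [one_eighth_lt hr2 hrp]
  obtain ⟨δ₀, hδ₀, H⟩ := exists_crossing hr hr2 hrp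
  refine ⟨δ₀, hδ₀, fun δ hδ hδ' => ?_⟩
  obtain ⟨w, hw, hpw, heq, hlt, hgt⟩ := H δ hδ hδ'
  have hKp : waveSq p p = 1 := by unfold waveSq; field_simp; ring
  have hK : 1 < waveSq p (w ^ 2) := by
    rw [← hKp]; exact waveSq_lt_waveSq hp0 le_rfl hpw
  have hs := Real.sq_sqrt (zero_lt_one.trans hK).le
  refine ⟨√(waveSq p (w ^ 2)), Real.lt_sqrt_of_sq_lt (by simpa using hK), ?_⟩
  rintro κ hκ z₁ z₂ rfl rfl
  have hκ0 : 0 < κ := by linarith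
  obtain ⟨v, hv, hpv, hκv, hz₁, hz₂⟩ := exists_half_sum hr hp0 hrp (by nlinarith : 1 < κ ^ 2)
  have e1 : (√(κ ^ 2 - 1) + √(κ ^ 2 - 1 / r ^ 2)) / 2 = v := by rw [hz₁, hz₂]; ring
  have e2 : (√(κ ^ 2 - 1 / r ^ 2) - √(κ ^ 2 - 1)) / 2 = p / v := by rw [hz₁, hz₂]; ring
  rw [e1, e2, evanescentForm_eq hp0 hrp hδ hv hpv hκv hz₁ hz₂]
  have hc : 0 < Real.sinh (δ * v) ^ 2 * Real.cosh (δ * v) ^ 2 *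
      ((v ^ 2 - (p / v) ^ 2) / v ^ 2) := by
    have h1 : 0 < Real.sinh (δ * v) := Real.sinh_pos_iff.mpr (by positivity)
    have h2 := Real.cosh_pos (δ * v)
    have h3 := div_lt_of_lt_sq hv hpv
    have h4 : 0 < p / v := by positivity
    have h5 : 0 < v ^ 2 - (p / v) ^ 2 := by nlinarith
    positivity
  have mono : ∀ {x y : ℝ}, 0 < x → p < x ^ 2 → x < y → waveSq p (x ^ 2) < waveSq p (y ^ 2) :=
    fun hx hpx hxy => waveSq_lt_waveSq hp0 hpx.le (pow_lt_pow_left₀ hxy hx.le two_ne_zero)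
  refine ⟨fun h => mul_pos hc (sub_pos.mpr (hgt v ?_)), fun h => ?_,
    fun h => mul_neg_of_pos_of_neg hc (sub_neg.mpr (hlt v hv hpv ?_))⟩
  · by_contra! h'
    have h1 := pow_lt_pow_left₀ h (Real.sqrt_nonneg _) two_ne_zero
    rw [hs, hκv] at h1
    rcases h'.eq_or_lt with rfl | h'
    · exact lt_irrefl _ h1
    · exact lt_asymm h1 (mono hv hpv h')
  · have h1 : waveSq p (v ^ 2) = waveSq p (w ^ 2) := by rw [← hκv, h, hs]
    have hvw : v = w := by
      rcases lt_trichotomy v w with h' | h' | h'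
      · exact absurd h1 (mono hv hpv h').ne
      · exact h'
      · exact absurd h1 (mono hw hpw h').ne'
    rw [hvw, heq, sub_self, mul_zero]
  · by_contra! h'
    have h1 := pow_lt_pow_left₀ h hκ0.le two_ne_zero
    rw [hs, hκv] at h1
    rcases h'.eq_or_lt with rfl | h'
    · exact lt_irrefl _ h1
    · exact lt_asymm h1 (mono hw hpw h')

end NavierSchwarz

end

theorem theorem3p4 (ω Cp Cs : ℝ) (hω : 0 < ω) (hCs : 0 < Cs) (hCp : 0 < Cp)
    (hCpCs : 2 * Cs ^ 2 < Cp ^ 2) :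
    ∃ δ₀ : ℝ, 0 < δ₀ ∧ ∀ δ : ℝ, 0 < δ → δ < δ₀ →
      ∃ kstar : ℝ, ω / Cs < kstar ∧
        ∀ m : NavierSchwarz.Material, m.Cp = Cp → m.Cs = Cs →
          (∀ k : ℝ, 0 < k → NavierSchwarz.WellPosed m ω δ k
            (NavierSchwarz.taylorSymbol m ω) (NavierSchwarz.taylorSymbol m ω)) ∧
          (∀ k ∈ Set.Ioo 0 (ω / Cp) ∪ Set.Ioo (ω / Cp) (ω / Cs) ∪ Set.Ioi kstar,
            NavierSchwarz.Converges m ω δ k) ∧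
          (∀ k ∈ Set.Ioo (ω / Cs) kstar, NavierSchwarz.Diverges m ω δ k) ∧
          (∀ k ∈ ({ω / Cp, ω / Cs, kstar} : Set ℝ), NavierSchwarz.Stagnates m ω δ k) := by
  open NavierSchwarz in
  obtain ⟨r, hr⟩ : ∃ r, r = Cp / Cs := ⟨_, rfl⟩
  obtain ⟨g, hg⟩ : ∃ g, g = ω / Cs := ⟨_, rfl⟩
  have hCp' : Cp = r * Cs := by rw [hr]; field_simp
  have hr0 : 0 < r := by rw [hr]; positivity
  have hr2 : 2 < r ^ 2 := by
    rw [hCp', mul_pow] at hCpCs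
    exact lt_of_mul_lt_mul_right hCpCs (sq_nonneg Cs)
  have hr1 : 1 < r := by nlinarith
  have hg0 : 0 < g := by rw [hg]; positivity
  have hgr : ω / Cp = g / r := by rw [hg, hCp']; field_simp
  obtain ⟨δ₁, hδ₁, H₁⟩ := exists_mixedForm_pos hr1
  obtain ⟨δ₂, hδ₂, H₂⟩ := exists_critical_wave_number hr1 hr2
  -- in the scaling in which `ω / Cs` becomes `1`, the overlap is `g * δ`
  refine ⟨min δ₁ δ₂ / g, by positivity, fun δ hδ hδ₀ => ?_⟩
  rw [lt_div_iff₀ hg0, lt_min_iff, mul_comm] at hδ₀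
  have hgδ : 0 < g * δ := by positivity
  obtain ⟨κs, hκs, H₂⟩ := H₂ (g * δ) hgδ hδ₀.2
  rw [← hg, hgr]
  refine ⟨g * κs, lt_mul_of_one_lt_right hg0 hκs, ?_⟩
  rintro m hmp hms
  have scaling : ∀ {k}, 0 < k → IsScaling m ω k g (k / g) r (rootC ((k / g) ^ 2 - 1))
      (rootC ((k / g) ^ 2 - 1 / r ^ 2)) := fun {k} hk => by
    have := isScaling_rootC (m := m) (by rwa [hms]) hr1 (by rw [hmp, hms, hCp']) hω hk
    rwa [hms, ← hg] at this
  have hrg : g / r < g := div_lt_self hg0 hr1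
  have hr' : 1 / r ^ 2 < 1 := by rw [div_lt_one (by positivity)]; linarith
  -- the three regimes and their end points, by the position of `k / g` relative to `1 / r` and `1`
  have low : ∀ k, 0 < k → k < g / r → WellPosed m ω δ k (taylorSymbol m ω) (taylorSymbol m ω) ∧
      Converges m ω δ k := by
    intro k hk hkr
    have h := scaling hk
    have hκ : k / g < 1 / r := by
      rw [div_lt_div_iff₀ hg0 hr0]; rw [lt_div_iff₀ hr0] at hkr; linarith
    have hκ2 : (k / g) ^ 2 < 1 / r ^ 2 := by
      rw [← one_div_pow]; exact pow_lt_pow_left₀ hκ (by positivity) two_ne_zero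
    rw [rootC_of_neg (by linarith), rootC_of_neg (by linarith)] at h
    exact behaviour_of_propagating h (Real.sqrt_pos.mpr (by linarith))
      (Real.sqrt_pos.mpr (by linarith))
  have at_one : ∀ k, k = g → WellPosed m ω δ k (taylorSymbol m ω) (taylorSymbol m ω) ∧
      Stagnates m ω δ k := by
    rintro k rfl
    have h := scaling hg0
    have e : rootC ((k / k) ^ 2 - 1) = Complex.I * ((0 : ℝ) : ℂ) := by
      rw [div_self hg0.ne', rootC_of_nonneg (by norm_num)]; simp
    rw [e, rootC_of_nonneg (by rw [div_self hg0.ne']; linarith)] at h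
    obtain ⟨b1, -, b2⟩ := behaviour_of_mixed h le_rfl (Real.sqrt_nonneg _)
      (.inr (Real.sqrt_pos.mpr (by rw [div_self hg0.ne']; linarith))) hδ
    exact ⟨b1, b2 (mixedForm_of_left_eq_zero ..)⟩
  have middle : ∀ k, g / r ≤ k → k < g →
      WellPosed m ω δ k (taylorSymbol m ω) (taylorSymbol m ω) ∧
      (g / r < k → Converges m ω δ k) ∧ (k = g / r → Stagnates m ω δ k) := by
    intro k hk hkg
    have hk0 : 0 < k := lt_of_lt_of_le (by positivity) hk
    have h := scaling hk0
    have hκ1 : k / g < 1 := (div_lt_one hg0).mpr hkg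
    have hκ0 : 0 < k / g := by positivity
    have hκr : 1 / r ≤ k / g := by
      rw [div_le_div_iff₀ hr0 hg0]; rw [div_le_iff₀ hr0] at hk; linarith
    have hκ2 : 1 / r ^ 2 ≤ (k / g) ^ 2 := by
      rw [← one_div_pow]; exact pow_le_pow_left₀ (by positivity) hκr 2
    have hκ3 : (k / g) ^ 2 < 1 := by nlinarith
    rw [rootC_of_neg (by linarith), rootC_of_nonneg (by linarith)] at h
    have hl₁ : 0 < √(-((k / g) ^ 2 - 1)) := Real.sqrt_pos.mpr (by linarith)
    obtain ⟨b1, b2, b3⟩ := behaviour_of_mixed h hl₁.le (Real.sqrt_nonneg _) (.inl hl₁) hδ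
    refine ⟨b1, fun hlt => b2 ?_, fun heq => b3 ?_⟩
    · have hκr' : 1 / r < k / g := by
        rw [div_lt_div_iff₀ hr0 hg0]; rw [div_lt_iff₀ hr0] at hlt; linarith
      have hκ2' : 1 / r ^ 2 < (k / g) ^ 2 := by
        rw [← one_div_pow]; exact pow_lt_pow_left₀ hκr' (by positivity) two_ne_zero
      refine H₁ (g * δ) hgδ hδ₀.1 (k / g) hκr' hκ1 _ _ hl₁ (Real.sqrt_pos.mpr (by linarith)) ?_ ?_
      · rw [Real.sq_sqrt (by linarith)]; ring
      · rw [Real.sq_sqrt (by linarith)]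
    · have e : (k / g) ^ 2 - 1 / r ^ 2 = 0 := by rw [heq]; field_simp; ring
      rw [e, Real.sqrt_zero, zero_mul, Real.sinh_zero]
      exact mixedForm_of_right_eq_zero ..
  have high : ∀ k, g < k → WellPosed m ω δ k (taylorSymbol m ω) (taylorSymbol m ω) ∧
      (g * κs < k → Converges m ω δ k) ∧ (k = g * κs → Stagnates m ω δ k) ∧
      (k < g * κs → Diverges m ω δ k) := by
    intro k hk
    have hk0 : 0 < k := hg0.trans hk
    have h := scaling hk0
    have hκ1 : 1 < k / g := (one_lt_div hg0).mpr hk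
    have hκ2 : 1 < (k / g) ^ 2 := by nlinarith
    rw [rootC_of_nonneg (by linarith), rootC_of_nonneg (by linarith)] at h
    obtain ⟨b1, b2, b3, b4⟩ := behaviour_of_evanescent h (Real.sqrt_pos.mpr (by linarith))
      (Real.sqrt_pos.mpr (by linarith)) hδ
    obtain ⟨c1, c2, c3⟩ := H₂ (k / g) hκ1 _ _ rfl rfl
    refine ⟨b1, fun h => b2 (c1 ?_), fun h => b3 (c2 ?_), fun h => b4 (c3 ?_)⟩
    · rwa [lt_div_iff₀ hg0, mul_comm]
    · rw [h]; field_simp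
    · rwa [div_lt_iff₀ hg0, mul_comm]
  have hgκs : g < g * κs := lt_mul_of_one_lt_right hg0 hκs
  refine ⟨fun k hk => ?_, ?_, fun k hk => (high k hk.1).2.2.2 hk.2, ?_⟩
  · rcases lt_or_ge k (g / r) with h | h
    · exact (low k hk h).1
    rcases lt_trichotomy k g with h' | h' | h'
    · exact (middle k h h').1
    · exact (at_one k h').1
    · exact (high k h').1
  · rintro k ((hk | hk) | hk)
    · exact (low k hk.1 hk.2).2
    · exact (middle k hk.1.le hk.2).2.1 hk.1
    · exact (high k (hgκs.trans hk)).2.1 hk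
  · rintro k (rfl | rfl | rfl)
    · exact (middle _ le_rfl hrg).2.2 rfl
    · exact (at_one _ rfl).2
    · exact (high _ hgκs).2.2.1 rfl
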